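/- **Theorem 4.4.** Containment relative to a DTD for $\mathrm{XP}(/,/\!/,[\,],*,|)$ is in EXPTIME, in the following sense. Fix a countably infinite set of labels (the words over $\{0,1\}$). A *tree* is a non-empty finite unranked ordered tree whose vertices carry labels. A *DTD* is a tuple $(d,S_d,\Sigma_d)$ where $\Sigma_d$ is a finite set of labels, $S_d\in\Sigma_d$, and $d$ maps each symbol of $\Sigma_d$ to a regular expression over $\Sigma_d$. A tree *matches* the DTD if its root has label $S_d$ and if every vertex has a label $a\in\Sigma_d$ such that the word formed by the labels of its children, from left to right, belongs to $L(d(a))$. The *expressions* of $\mathrm{XP}(/,/\!/,[\,],*,|)$ are the location paths generated by $$\mathrm{lpath}::=\mathrm{lstep}\ \big|\ \mathrm{lpath}\,/\,\mathrm{lpath}\ \big|\ \mathrm{lpath}\,'|'\,\mathrm{lpath},\qquad \mathrm{lstep}::=\mathrm{axis}::\mathrm{test}\,([\mathrm{fexpr}])^*,\qquad \mathrm{fexpr}::=\mathrm{lpath}\ \big|\ \mathrm{lpath}\ \mathrm{or}\ \mathrm{lpath},$$ where an axis is self, child or descendant (descendants are proper) and a test is a label or the wild-card $*$. Each location path $p$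 induces on every tree $t$ a binary relation $[\![p]\!]_t$ on the vertices of $t$: $(u,v)$ is in the relation of a location step iff $v$ equals $u$, is a child of $u$, or is a descendant of $u$, according to the axis, $v$ passes the test, and every filter of the step is true at $v$; the filter $p$ is true at $v$ iff $(v,w)\in[\![p]\!]_t$ for some $w$, and the filter "$p$ or $q$" is true at $v$ iff $p$ or $q$ is; $[\![p/q]\!]_t$ is the composition $[\![p]\!]_t\circ[\![q]\!]_t$, that is, the set of pairs $(u,v)$ with $(u,w)\in[\![p]\!]_t$ and $(w,v)\in[\![q]\!]_t$ for some $w$; and $[\![p\,|\,q]\!]_t=[\![p]\!]_t\cup[\![q]\!]_t$. Write $t\models p$ if $(\varepsilon,v)\in[\![p]\!]_t$ for some vertex $v$, where $\varepsilon$ is the root of $t$. For a DTD $d$ and expressions $p,q$, write $p\subseteq_d q$ if every tree $t$ that matches $d$ and satisfies $t\models p$ also satisfies $t\models q$. Then there are a deterministic multi-stack Turing machine and a polynomial $P$ such that, on every input consisting of a DTD $d$ and two expressions $p,q$, written in prefix notation as a word of length $n$ over a fixed finite alphabet, the machine decides within $2^{P(n)}$ steps whether $p\subseteq_d q$. -/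

import Mathlib

namespace XPath

/-- Element names: words over a binary alphabet (a countably infinite set of labels). -/
abbrev Label : Type := List Bool

/-! ### Trees -/

/-- Finite unranked ordered labelled trees. -/
inductive XTree : Type
  | node (label : Label) (children : List XTree) : XTree

namespace XTree

/-- The label of the root. -/
def label : XTree → Label
  | node a _ => a

/-- The list of the subtrees rooted at the children of the root, from left to right. -/
def children : XTree → List XTree
  | node _ cs => cs

/-- The subtree `t_v` rooted at the address `v`, if `v` is a vertex of the tree.
Vertices are addressed as in a tree domain: the root is the empty word and the children of `v`
are `v ++ [0]`, `v ++ [1]`, ... from left to right. -/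
def subtree? : XTree → List ℕ → Option XTree
  | t, [] => some t
  | t, i :: w => (t.children[i]?).bind fun c => c.subtree? w

/-- `v` belongs to the tree domain of `t`. -/
def IsVertex (t : XTree) (v : List ℕ) : Prop := ∃ s, t.subtree? v = some s

/-- `v` is a vertex of `t` with label `a`. -/
def HasLabel (t : XTree) (v : List ℕ) (a : Label) : Prop :=
  ∃ s, t.subtree? v = some s ∧ s.label = a

end XTree

/-! ### XPath expressions -/

/-- The three axes. -/
inductive Axis : Type
  | self
  | child
  | descendant

/-- A node test is the wild-card or a label. -/
inductive NodeTest : Type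
  | wildcard
  | name (a : Label)

mutual

/-- Location paths, `lpath ::= lstep | lpath / lpath | lpath '|' lpath`. -/
inductive LPath : Type
  | step (s : LStep)
  | seq (p q : LPath)
  | union (p q : LPath)

/-- Location steps, `lstep ::= axis :: node-test ([fexpr])*`:
`axis :: node-test` followed by filters that are appended one at a time. -/
inductive LStep : Type
  | base (a : Axis) (n : NodeTest)
  | filter (s : LStep) (e : FExpr)

/-- Filter expressions, `fexpr ::= lpath | lpath or lpath`. -/
inductive FExpr : Type
  | path (p : LPath)
  | or (p q : LPath)

end

/-- The relation between addresses that an axis stands for. -/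
def Axis.Rel : Axis → List ℕ → List ℕ → Prop
  | self, u, v => v = u
  | child, u, v => ∃ i, v = u ++ [i]
  | descendant, u, v => ∃ w, w ≠ [] ∧ v = u ++ w

/-- The vertex `v` of `t` passes the node test. -/
def NodeTest.Holds (t : XTree) : NodeTest → List ℕ → Prop
  | wildcard, v => t.IsVertex v
  | name a, v => t.HasLabel v a

mutual

/-- `p.Sem t u v`: the pair `(u, v)` of vertices of `t` belongs to `⟦p⟧_t`. -/
def LPath.Sem (t : XTree) : LPath → List ℕ → List ℕ → Prop
  | .step s, u, v => LStep.Sem t s u v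
  | .seq p q, u, v => ∃ w, LPath.Sem t p u w ∧ LPath.Sem t q w v
  | .union p q, u, v => LPath.Sem t p u v ∨ LPath.Sem t q u v

/-- The binary relation induced by a location step. -/
def LStep.Sem (t : XTree) : LStep → List ℕ → List ℕ → Prop
  | .base a n, u, v => t.IsVertex u ∧ t.IsVertex v ∧ a.Rel u v ∧ n.Holds t v
  | .filter s e, u, v => LStep.Sem t s u v ∧ FExpr.Holds t e v

/-- `e.Holds t v`: the filter expression `e` is true at the vertex `v`. -/
def FExpr.Holds (t : XTree) : FExpr → List ℕ → Prop
  | .path p, v => ∃ w, LPath.Sem t p v w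
  | .or p q, v => (∃ w, LPath.Sem t p v w) ∨ (∃ w, LPath.Sem t q v w)

end

/-- `t ⊨ p`: starting at the root, `p` selects some vertex of `t`. -/
def LPath.Models (t : XTree) (p : LPath) : Prop := ∃ v, p.Sem t [] v

/-! ### DTDs -/

/-- The list of the symbols that occur in a regular expression. -/
def regexSymbols {α : Type} : RegularExpression α → List α
  | .zero => []
  | .epsilon => []
  | .char a => [a]
  | .plus r s => regexSymbols r ++ regexSymbols s
  | .comp r s => regexSymbols r ++ regexSymbols s
  | .star r => regexSymbols r

/-- A DTD `(d, S_d, Σ_d)`. The map `d` is given by the list of its rules `a → d(a)`, exactly one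
for each symbol `a` of `Σ_d`, so `Σ_d` is the set of left-hand sides of the rules. -/
structure DTD : Type where
  /-- The start symbol `S_d`. -/
  start : Label
  /-- The rules `a → d(a)`. -/
  rules : List (Label × RegularExpression Label)
  /-- There is only one rule for each symbol. -/
  nodup : (rules.map Prod.fst).Nodup
  /-- The start symbol belongs to `Σ_d`. -/
  start_mem : start ∈ rules.map Prod.fst
  /-- The right-hand sides are regular expressions over `Σ_d`. -/
  closed : ∀ x ∈ rules, ∀ a ∈ regexSymbols x.2, a ∈ rules.map Prod.fst

/-- The tree `t` matches the DTD: its root carries the start symbol, and at every vertex the word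
of the labels of the children belongs to the language of the expression assigned to the label of
the vertex. -/
def DTD.Matches (d : DTD) (t : XTree) : Prop :=
  t.label = d.start ∧
    ∀ u s, t.subtree? u = some s →
      ∃ r, (s.label, r) ∈ d.rules ∧ s.children.map XTree.label ∈ r.matches'

/-- Boolean containment `p ⊆_d q` relative to a DTD. -/
def ContainedRel (d : DTD) (p q : LPath) : Prop :=
  ∀ t : XTree, d.Matches t → p.Models t → q.Models t

/-! ### Instances of the containment problem and their encoding -/

/-- An input of the containment problem relative to a DTD. -/
structure Input : Type where
  /-- The DTD. -/
  dtd : DTD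
  /-- The left expression. -/
  p : LPath
  /-- The right expression. -/
  q : LPath

/-- The decision problem: is `p` contained in `q` relative to the DTD? -/
def XDContainment (x : Input) : Prop := ContainedRel x.dtd x.p x.q

/-- The finite alphabet over which inputs are written. -/
inductive Tok : Type
  | bit (b : Bool) | endLabel
  | axSelf | axChild | axDescendant
  | wildcard | name
  | step | seq | union
  | base | filter
  | filterPath | filterOr
  | rzero | repsilon | rchar | rplus | rcomp | rstar
  | rule | endRules
  deriving DecidableEq, Fintype

/-- A label is written letter by letter and closed by an end marker. -/
def encLabel (a : Label) : List Tok := a.map Tok.bit ++ [Tok.endLabel]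

/-- Code of an axis. -/
def encAxis : Axis → List Tok
  | .self => [Tok.axSelf]
  | .child => [Tok.axChild]
  | .descendant => [Tok.axDescendant]

/-- Code of a node test. -/
def encNodeTest : NodeTest → List Tok
  | .wildcard => [Tok.wildcard]
  | .name a => Tok.name :: encLabel a

mutual

/-- Location paths are written in prefix notation. -/
def encLPath : LPath → List Tok
  | .step s => Tok.step :: encLStep s
  | .seq p q => Tok.seq :: (encLPath p ++ encLPath q)
  | .union p q => Tok.union :: (encLPath p ++ encLPath q)

/-- Location steps in prefix notation. -/
def encLStep : LStep → List Tok
  | .base a n => Tok.base :: (encAxis a ++ encNodeTest n)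
  | .filter s e => Tok.filter :: (encLStep s ++ encFExpr e)

/-- Filter expressions in prefix notation. -/
def encFExpr : FExpr → List Tok
  | .path p => Tok.filterPath :: encLPath p
  | .or p q => Tok.filterOr :: (encLPath p ++ encLPath q)

end

/-- Regular expressions in prefix notation. -/
def encRegex : RegularExpression Label → List Tok
  | .zero => [Tok.rzero]
  | .epsilon => [Tok.repsilon]
  | .char a => Tok.rchar :: encLabel a
  | .plus r s => Tok.rplus :: (encRegex r ++ encRegex s)
  | .comp r s => Tok.rcomp :: (encRegex r ++ encRegex s)
  | .star r => Tok.rstar :: encRegex r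

/-- The rules of a DTD are written one after the other and closed by an end marker. -/
def encRules : List (Label × RegularExpression Label) → List Tok
  | [] => [Tok.endRules]
  | x :: l => Tok.rule :: (encLabel x.1 ++ encRegex x.2 ++ encRules l)

/-- Code of a DTD. -/
def encDTD (d : DTD) : List Tok := encLabel d.start ++ encRules d.rules

/-- Code of an input: the DTD, then the two expressions. -/
def encInput (x : Input) : List Tok := encDTD x.dtd ++ encLPath x.p ++ encLPath x.q

/-! The code is uniquely readable. -/

theorem encLabel_append_inj :
    ∀ (a b : Label) (r s : List Tok), encLabel a ++ r = encLabel b ++ s → a = b ∧ r = s := by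
  intro a
  induction a with
  | nil =>
    intro b r s h
    cases b <;> simp_all [encLabel]
  | cons x a ih =>
    intro b r s h
    cases b with
    | nil => simp [encLabel] at h
    | cons y b =>
      simp only [encLabel, List.map_cons, List.cons_append, List.cons.injEq, Tok.bit.injEq] at h
      obtain ⟨rfl, h2⟩ := h
      obtain ⟨rfl, rfl⟩ := ih b r s h2
      exact ⟨rfl, rfl⟩

theorem encAxis_append_inj (a b : Axis) (r s : List Tok)
    (h : encAxis a ++ r = encAxis b ++ s) : a = b ∧ r = s := by
  cases a <;> cases b <;> simp_all [encAxis]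

theorem encNodeTest_append_inj (a b : NodeTest) (r s : List Tok)
    (h : encNodeTest a ++ r = encNodeTest b ++ s) : a = b ∧ r = s := by
  cases a <;> cases b <;> simp [encNodeTest] at h ⊢
  · exact h
  · exact encLabel_append_inj _ _ _ _ h

mutual

theorem encLPath_append_inj : ∀ (a b : LPath) (r s : List Tok),
    encLPath a ++ r = encLPath b ++ s → a = b ∧ r = s
  | .step x, b, r, s, h => by
    cases b <;> simp [encLPath] at h ⊢
    exact encLStep_append_inj _ _ _ _ h
  | .seq p q, b, r, s, h => by
    cases b <;> simp [encLPath] at h ⊢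
    obtain ⟨h1, h2⟩ := encLPath_append_inj p _ _ _ h
    obtain ⟨h3, h4⟩ := encLPath_append_inj q _ _ _ h2
    exact ⟨⟨h1, h3⟩, h4⟩
  | .union p q, b, r, s, h => by
    cases b <;> simp [encLPath] at h ⊢
    obtain ⟨h1, h2⟩ := encLPath_append_inj p _ _ _ h
    obtain ⟨h3, h4⟩ := encLPath_append_inj q _ _ _ h2
    exact ⟨⟨h1, h3⟩, h4⟩

theorem encLStep_append_inj : ∀ (a b : LStep) (r s : List Tok),
    encLStep a ++ r = encLStep b ++ s → a = b ∧ r = s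
  | .base x n, b, r, s, h => by
    cases b <;> simp [encLStep] at h ⊢
    obtain ⟨h1, h2⟩ := encAxis_append_inj x _ _ _ h
    obtain ⟨h3, h4⟩ := encNodeTest_append_inj n _ _ _ h2
    exact ⟨⟨h1, h3⟩, h4⟩
  | .filter x e, b, r, s, h => by
    cases b <;> simp [encLStep] at h ⊢
    obtain ⟨h1, h2⟩ := encLStep_append_inj x _ _ _ h
    obtain ⟨h3, h4⟩ := encFExpr_append_inj e _ _ _ h2
    exact ⟨⟨h1, h3⟩, h4⟩

theorem encFExpr_append_inj : ∀ (a b : FExpr) (r s : List Tok),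
    encFExpr a ++ r = encFExpr b ++ s → a = b ∧ r = s
  | .path p, b, r, s, h => by
    cases b <;> simp [encFExpr] at h ⊢
    exact encLPath_append_inj _ _ _ _ h
  | .or p q, b, r, s, h => by
    cases b <;> simp [encFExpr] at h ⊢
    obtain ⟨h1, h2⟩ := encLPath_append_inj p _ _ _ h
    obtain ⟨h3, h4⟩ := encLPath_append_inj q _ _ _ h2
    exact ⟨⟨h1, h3⟩, h4⟩

end

theorem encRegex_append_inj : ∀ (a b : RegularExpression Label) (r s : List Tok),
    encRegex a ++ r = encRegex b ++ s → a = b ∧ r = s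
  | .zero, b, r, s, h => by
    cases b <;> simp [encRegex] at h
    exact ⟨rfl, h⟩
  | .epsilon, b, r, s, h => by
    cases b <;> simp [encRegex] at h
    exact ⟨rfl, h⟩
  | .char a, b, r, s, h => by
    cases b <;> simp [encRegex] at h
    obtain ⟨rfl, h2⟩ := encLabel_append_inj _ _ _ _ h
    exact ⟨rfl, h2⟩
  | .plus p q, b, r, s, h => by
    cases b <;> simp [encRegex] at h
    obtain ⟨rfl, h2⟩ := encRegex_append_inj p _ _ _ h
    obtain ⟨rfl, h4⟩ := encRegex_append_inj q _ _ _ h2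
    exact ⟨rfl, h4⟩
  | .comp p q, b, r, s, h => by
    cases b <;> simp [encRegex] at h
    obtain ⟨rfl, h2⟩ := encRegex_append_inj p _ _ _ h
    obtain ⟨rfl, h4⟩ := encRegex_append_inj q _ _ _ h2
    exact ⟨rfl, h4⟩
  | .star p, b, r, s, h => by
    cases b <;> simp [encRegex] at h
    obtain ⟨rfl, h2⟩ := encRegex_append_inj p _ _ _ h
    exact ⟨rfl, h2⟩

theorem encRules_append_inj : ∀ (a b : List (Label × RegularExpression Label)) (r s : List Tok),
    encRules a ++ r = encRules b ++ s → a = b ∧ r = s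
  | [], b, r, s, h => by
    cases b <;> simp [encRules] at h
    exact ⟨rfl, h⟩
  | (x, e) :: l, b, r, s, h => by
    rcases b with _ | ⟨⟨y, f⟩, m⟩ <;> simp [encRules] at h
    obtain ⟨rfl, h2⟩ := encLabel_append_inj _ _ _ _ h
    obtain ⟨rfl, h3⟩ := encRegex_append_inj _ _ _ _ h2
    obtain ⟨rfl, h4⟩ := encRules_append_inj l _ _ _ h3
    exact ⟨rfl, h4⟩

theorem encInput_injective : Function.Injective encInput := by
  rintro ⟨⟨s, l, _, _, _⟩, p, q⟩ ⟨⟨s', l', _, _, _⟩, p', q'⟩ h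
  simp only [encInput, encDTD, List.append_assoc] at h
  obtain ⟨h1, h2⟩ := encLabel_append_inj _ _ _ _ h
  obtain ⟨h3, h4⟩ := encRules_append_inj _ _ _ _ h2
  obtain ⟨h5, h6⟩ := encLPath_append_inj _ _ _ _ h4
  obtain ⟨h7, -⟩ := encLPath_append_inj q q' [] [] (by simpa using h6)
  subst h1 h3 h5 h7
  rfl

open Classical in
/-- The encoding of inputs as words over the finite alphabet `Tok`. -/
noncomputable def inputEncoding : Computability.Encoding Input Tok where
  encode := encInput
  decode w := if h : ∃ x, encInput x = w then some h.choose else none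
  decode_encode x := by
    have h : ∃ y, encInput y = encInput x := ⟨x, rfl⟩
    rw [dif_pos h]
    exact congrArg some (encInput_injective h.choose_spec)

/-! ### Exponential time -/

open Classical in
/-- The decision problem `P`, whose inputs are written as words over a finite alphabet by means of
the encoding `e`, is in EXPTIME: some deterministic multi-stack Turing machine computes the answer
on each input within `2 ^ p(n)` steps, where `n` is the length of the code of the input and `p` is
a fixed polynomial. -/
def InEXPTIME {α Γ : Type} [Fintype Γ] (e : Computability.Encoding α Γ) (P : α → Prop) : Prop :=
  ∃ (M : Turing.TM2ComputableInTime e.encode Computability.encodeBool fun x => decide (P x))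
    (p : Polynomial ℕ), ∀ n, M.time n ≤ 2 ^ p.eval n

end XPath

namespace StackProg

open Turing Function

/-- Structured programs that act on a family of stacks. -/
inductive Prog {K : Type} (Γ : K → Type) : Type
  | skip : Prog Γ
  | push (k : K) (a : Γ k) : Prog Γ
  | seq (p q : Prog Γ) : Prog Γ
  /-- pop a letter and branch on it -/
  | pop (k : K) (f : Option (Γ k) → Prog Γ) : Prog Γ
  /-- pop a letter, run the body for it, and repeat if the guard holds for the letter -/
  | loop (k : K) (g : Option (Γ k) → Bool) (f : Option (Γ k) → Prog Γ) : Prog Γ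

variable {K : Type} [DecidableEq K] {Γ : K → Type}

/-- Big-step semantics with exact step counts. -/
inductive Exec : Prog Γ → (∀ k, List (Γ k)) → ℕ → (∀ k, List (Γ k)) → Prop
  | skip (S) : Exec .skip S 1 S
  | push (k a S) : Exec (.push k a) S 1 (update S k (a :: S k))
  | seq {p q S S' S'' m n} : Exec p S m S' → Exec q S' n S'' → Exec (.seq p q) S (1 + m + n) S''
  | pop {k f S S' n} : Exec (f (S k).head?) (update S k (S k).tail) n S' →
      Exec (.pop k f) S (1 + n) S'
  | loopExit {k g f S S' n} : g (S k).head? = false →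
      Exec (f (S k).head?) (update S k (S k).tail) n S' → Exec (.loop k g f) S (1 + n) S'
  | loopNext {k g f S S' S'' m n} : g (S k).head? = true →
      Exec (f (S k).head?) (update S k (S k).tail) m S' → Exec (.loop k g f) S' n S'' →
      Exec (.loop k g f) S (1 + m + n) S''

/-- The continuations that occur when `p` is run before the continuation `c`. -/
def reach : Prog Γ → List (Prog Γ) → Set (List (Prog Γ))
  | .skip, c => {.skip :: c}
  | .push k a, c => {.push k a :: c}
  | .seq p q, c => {.seq p q :: c} ∪ (reach p (q :: c) ∪ reach q c)
  | .pop k f, c => {.pop k f :: c} ∪ ⋃ o, reach (f o) c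
  | .loop k g f, c =>
      {.loop k g f :: c} ∪ ⋃ o, (reach (f o) c ∪ reach (f o) (.loop k g f :: c))

omit [DecidableEq K] in
theorem self_mem_reach (p : Prog Γ) (c : List (Prog Γ)) : p :: c ∈ reach p c := by
  cases p <;> simp [reach]

omit [DecidableEq K] in
theorem finite_reach [∀ k, Finite (Γ k)] (p : Prog Γ) :
    ∀ c, (reach p c).Finite := by
  induction p with
  | skip => intro c; simp [reach]
  | push => intro c; simp [reach]
  | seq p q hp hq =>
    intro c
    exact (Set.finite_singleton _).union ((hp _).union (hq _))
  | pop k f h =>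
    intro c
    exact (Set.finite_singleton _).union (Set.finite_iUnion fun o => h o c)
  | loop k g f h =>
    intro c
    exact (Set.finite_singleton _).union
      (Set.finite_iUnion fun o => (h o c).union (h o _))

variable [∀ k, Fintype (Γ k)]

/-- The value popped from the stack `k`, recorded in the internal state. -/
def popped (k : K) (v : Option (Σ k, Option (Γ k))) : Option (Γ k) :=
  v.elim none fun v => if h : v.1 = k then h ▸ v.2 else none

omit [∀ k, Fintype (Γ k)] in
@[simp] theorem popped_some (k : K) (o : Option (Γ k)) : popped k (some ⟨k, o⟩) = o := by
  simp [popped]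

/-- The statement that performs the first step of a continuation; `lift` maps continuations to
labels. -/
def stmtOf {Λ : Type} (lift : List (Prog Γ) → Λ) :
    List (Prog Γ) → TM2.Stmt Γ Λ (Option (Σ k, Option (Γ k)))
  | [] => .load (fun _ => none) .halt
  | .skip :: c => .goto fun _ => lift c
  | .push k a :: c => .push k (fun _ => a) (.goto fun _ => lift c)
  | .seq p q :: c => .goto fun _ => lift (p :: q :: c)
  | .pop k f :: c => .pop k (fun _ o => some ⟨k, o⟩) (.goto fun v => lift (f (popped k v) :: c))
  | .loop k g f :: c => .pop k (fun _ o => some ⟨k, o⟩) (.goto fun v =>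
      lift (if g (popped k v) then f (popped k v) :: .loop k g f :: c else f (popped k v) :: c))

open Classical in
/-- A continuation as an element of a set of labels that contains the empty continuation. -/
noncomputable def toLabel {A : Set (List (Prog Γ))} (h : [] ∈ A) (c : List (Prog Γ)) : A :=
  if hc : c ∈ A then ⟨c, hc⟩ else ⟨[], h⟩

omit [∀ k, Fintype (Γ k)] [DecidableEq K] in
theorem coe_toLabel {A : Set (List (Prog Γ))} (h : [] ∈ A) {c : List (Prog Γ)} (hc : c ∈ A) :
    (toLabel h c).1 = c := by
  simp [toLabel, hc]

omit [∀ k, Fintype (Γ k)] in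
theorem iterate_step {A : Set (List (Prog Γ))} (hA : [] ∈ A) {c c' : List (Prog Γ)}
    (hc : c ∈ A) {S S' v v' n} {X : TM2.Cfg Γ A _}
    (h1 : TM2.stepAux (stmtOf (toLabel hA) c) v S = ⟨some (toLabel hA c'), v', S'⟩)
    (h2 : (fun o => o.bind (TM2.step fun l : A => stmtOf (toLabel hA) l.1))^[n]
      (some ⟨some (toLabel hA c'), v', S'⟩) = some X) :
    (fun o => o.bind (TM2.step fun l : A => stmtOf (toLabel hA) l.1))^[n + 1]
      (some ⟨some (toLabel hA c), v, S⟩) = some X := by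
  rw [iterate_succ_apply, ← h2, ← h1, Option.bind_some, TM2.step, coe_toLabel hA hc]

omit [∀ k, Fintype (Γ k)] in
theorem exec_iterate {A : Set (List (Prog Γ))} (hA : [] ∈ A) {p : Prog Γ}
    {S S' : ∀ k, List (Γ k)} {n : ℕ} (h : Exec p S n S') :
    ∀ (c : List (Prog Γ)) (v : Option (Σ k, Option (Γ k))), c ∈ A → reach p c ⊆ A →
      ∃ v', (fun o => o.bind (TM2.step fun l : A => stmtOf (toLabel hA) l.1))^[n]
        (some ⟨some (toLabel hA (p :: c)), v, S⟩) = some ⟨some (toLabel hA c), v', S'⟩ := by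
  induction h with
  | skip S =>
    intro c v hc hr
    exact ⟨v, iterate_step hA (hr (self_mem_reach _ _)) (n := 0) rfl rfl⟩
  | push k a S =>
    intro c v hc hr
    exact ⟨v, iterate_step hA (hr (self_mem_reach _ _)) (n := 0) rfl rfl⟩
  | @seq p q S S' S'' m n _ _ ih1 ih2 =>
    intro c v hc hr
    have hq : reach q c ⊆ A := fun x hx => hr (by simp [reach, hx])
    have hp : reach p (q :: c) ⊆ A := fun x hx => hr (by simp [reach, hx])
    obtain ⟨v1, h1⟩ := ih1 (q :: c) v (hq (self_mem_reach _ _)) hp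
    obtain ⟨v2, h2⟩ := ih2 c v1 hc hq
    refine ⟨v2, ?_⟩
    rw [show 1 + m + n = (n + m) + 1 by omega]
    refine iterate_step hA (c' := p :: q :: c) (hr (self_mem_reach _ _)) rfl ?_
    rw [iterate_add_apply, h1, h2]
  | @pop k f S S' n _ ih =>
    intro c v hc hr
    have hf : reach (f (S k).head?) c ⊆ A := fun x hx => hr (by
      simp only [reach, Set.mem_union, Set.mem_iUnion]; exact Or.inr ⟨_, hx⟩)
    obtain ⟨v1, h1⟩ := ih c (some ⟨k, (S k).head?⟩) hc hf
    refine ⟨v1, ?_⟩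
    rw [add_comm]
    exact iterate_step hA (S := S) (v := v) (hr (self_mem_reach _ _)) (by simp only [stmtOf, TM2.stepAux, popped_some]) h1
  | @loopExit k g f S S' n hg _ ih =>
    intro c v hc hr
    have hf : reach (f (S k).head?) c ⊆ A := fun x hx => hr (by
      simp only [reach, Set.mem_union, Set.mem_iUnion]; exact Or.inr ⟨_, Or.inl hx⟩)
    obtain ⟨v1, h1⟩ := ih c (some ⟨k, (S k).head?⟩) hc hf
    refine ⟨v1, ?_⟩
    rw [add_comm]
    exact iterate_step hA (S := S) (v := v) (hr (self_mem_reach _ _)) (by simp only [stmtOf, TM2.stepAux, popped_some, hg, Bool.false_eq_true, if_false]) h1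
  | @loopNext k g f S S' S'' m n hg _ _ ih1 ih2 =>
    intro c v hc hr
    have h0 := hr (self_mem_reach _ _)
    have hf : reach (f (S k).head?) (.loop k g f :: c) ⊆ A := fun x hx => hr (by
      simp only [reach, Set.mem_union, Set.mem_iUnion]; exact Or.inr ⟨_, Or.inr hx⟩)
    obtain ⟨v1, h1⟩ := ih1 (.loop k g f :: c) (some ⟨k, (S k).head?⟩) h0 hf
    obtain ⟨v2, h2⟩ := ih2 c v1 hc hr
    refine ⟨v2, ?_⟩
    rw [show 1 + m + n = (n + m) + 1 by omega]
    refine iterate_step hA (S := S) (v := v) (c' := f (S k).head? :: .loop k g f :: c)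
      (v' := some ⟨k, (S k).head?⟩) (S' := update S k (S k).tail) h0 (by simp [stmtOf, hg]) ?_
    rw [iterate_add_apply, h1, h2]

/-- The labels of the machine for `p`. -/
def labels (p : Prog Γ) : Set (List (Prog Γ)) := insert [] (reach p [])

omit [∀ k, Fintype (Γ k)] [DecidableEq K] in
theorem nil_mem_labels (p : Prog Γ) : [] ∈ labels p := Set.mem_insert _ _

/-- The machine that runs `p` on the stacks `k`, with input stack `k₀` and output stack `k₁`. -/
noncomputable def machine [Fintype K] (p : Prog Γ) (k₀ k₁ : K) : FinTM2 where
  K := K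
  k₀ := k₀
  k₁ := k₁
  Γ := Γ
  Λ := labels p
  main := toLabel (nil_mem_labels p) [p]
  ΛFin := ((finite_reach p []).insert []).fintype
  σ := Option (Σ k, Option (Γ k))
  initialState := none
  m := fun l => stmtOf (toLabel (nil_mem_labels p)) l.1

/-- The stacks that are all empty except for `k`. -/
def single (k : K) (s : List (Γ k)) : ∀ k, List (Γ k) := update (fun _ => []) k s

theorem initList_machine [Fintype K] (p : Prog Γ) (k₀ k₁ : K) (s : List (Γ k₀)) :
    initList (machine p k₀ k₁) s =
      (⟨some (toLabel (A := labels p) (nil_mem_labels p) [p]), none, single k₀ s⟩ :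
        TM2.Cfg Γ (labels p) _) := by
  refine congrArg (TM2.Cfg.mk _ _) (funext fun (k : K) => ?_)
  by_cases hk : k = k₀
  · subst hk
    exact (dif_pos rfl).trans (update_self k s fun _ => []).symm
  · exact (dif_neg hk).trans (update_of_ne hk s fun _ => []).symm

theorem haltList_machine [Fintype K] (p : Prog Γ) (k₀ k₁ : K) (s : List (Γ k₁)) :
    haltList (machine p k₀ k₁) s =
      (⟨none, none, single k₁ s⟩ : TM2.Cfg Γ (labels p) _) := by
  refine congrArg (TM2.Cfg.mk _ _) (funext fun (k : K) => ?_)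
  by_cases hk : k = k₁
  · subst hk
    exact (dif_pos rfl).trans (update_self k s fun _ => []).symm
  · exact (dif_neg hk).trans (update_of_ne hk s fun _ => []).symm

/-- A program that transforms codes of inputs into codes of values within a time bound gives rise
to a machine. -/
noncomputable def machineComputes [Fintype K] (p : Prog Γ) (k₀ k₁ : K) {α β : Type}
    (ea : α → List (Γ k₀)) (eb : β → List (Γ k₁)) (f : α → β) (T : ℕ → ℕ)
    (h : ∀ a, ∃ n ≤ T (ea a).length, Exec p (single k₀ (ea a)) n (single k₁ (eb (f a)))) :
    TM2ComputableInTime ea eb f where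
  tm := machine p k₀ k₁
  inputAlphabet := Equiv.refl _
  outputAlphabet := Equiv.refl _
  time n := T n + 1
  outputsFun a := by
    have h0 : ∃ n ≤ T (ea a).length + 1, (flip bind (machine p k₀ k₁).step)^[n]
        (some (initList (machine p k₀ k₁) (ea a))) =
          some (haltList (machine p k₀ k₁) (eb (f a))) := by
      obtain ⟨n, hn, he⟩ := h a
      obtain ⟨v, hv⟩ := exec_iterate (A := labels p) (nil_mem_labels p) he [] none
        (nil_mem_labels p) (Set.subset_insert _ _)
      refine ⟨n + 1, by omega, ?_⟩
      rw [initList_machine, haltList_machine, iterate_succ_apply']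
      refine (congrArg (fun o : Option (TM2.Cfg Γ (labels p) _) =>
        o.bind (TM2.step fun l : labels p =>
          stmtOf (toLabel (nil_mem_labels p)) l.1)) hv).trans ?_
      simp only [Option.bind_some, TM2.step, coe_toLabel (nil_mem_labels p) (nil_mem_labels p)]
      rfl
    refine ⟨⟨h0.choose, ?_⟩, h0.choose_spec.1⟩
    have e : ∀ {X : Type} (l : List X), l.map (Equiv.refl X).invFun = l := fun l => List.map_id l
    exact (congrArg (fun l => (flip bind (machine p k₀ k₁).step)^[h0.choose]
      (some (initList (machine p k₀ k₁) l))) (e (ea a))).trans (h0.choose_spec.2.trans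
        (congrArg (fun l => some (haltList (machine p k₀ k₁) l)) (e (eb (f a))).symm))

end StackProg

namespace Saturation

open StackProg Function

/-! ### Horn clauses over words -/

section Clauses

variable (A Q : Type)

/-- A fact: a predicate applied to words. -/
structure Fact where
  pred : Q
  args : List (List A)
  deriving DecidableEq

/-- Terms are words over letters and variables. -/
inductive Item where
  | letter (a : A)
  | var (i : ℕ)

/-- A predicate applied to terms. -/
structure Atom where
  pred : Q
  args : List (List (Item A))

/-- A Horn clause. -/
structure Clause where
  concl : Atom A Q
  prems : List (Atom A Q)

/-- The alphabet in which lists of facts are written. -/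
inductive Sym where
  | letter (a : A)
  | pred (q : Q)
  | sep
  | fin
  deriving DecidableEq, Fintype

variable {A Q}

/-- The word that a term stands for. -/
def Item.inst (σ : ℕ → List A) : Item A → List A
  | letter a => [a]
  | var i => σ i

/-- The fact that an atom stands for. -/
def Atom.inst (σ : ℕ → List A) (p : Atom A Q) : Fact A Q :=
  ⟨p.pred, p.args.map fun l => l.flatMap (Item.inst σ)⟩

/-- The code of a fact. -/
def Fact.code (F : Fact A Q) : List (Sym A Q) :=
  .pred F.pred :: F.args.flatMap fun l => l.map .letter ++ [.sep]

/-- The code of an atom. -/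
def Atom.code (p : Atom A Q) : List (Sym A Q ⊕ ℕ) :=
  .inl (.pred p.pred) :: p.args.flatMap fun l =>
    (l.map fun | .letter a => .inl (.letter a) | .var i => .inr i) ++ [.inl .sep]

/-- The word that a coded term stands for. -/
def instSym (σ : ℕ → List A) : Sym A Q ⊕ ℕ → List (Sym A Q)
  | .inl s => [s]
  | .inr i => (σ i).map .letter

theorem Atom.code_inst (σ : ℕ → List A) (p : Atom A Q) :
    p.code.flatMap (instSym σ) = (p.inst σ).code := by
  simp only [Atom.code, List.flatMap_cons, instSym, Fact.code, Atom.inst, List.singleton_append,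
    List.cons.injEq, true_and]
  induction p.args with
  | nil => rfl
  | cons l ls ih =>
    simp only [List.flatMap_cons, List.map_cons, List.flatMap_append, ih, List.flatMap_nil,
      instSym, List.append_nil]
    congr 2
    induction l with
    | nil => rfl
    | cons x l ih => cases x <;> simp [Item.inst, instSym, ih]

theorem sep_args_injective :
    ∀ l l' : List (List A), (l.flatMap fun l => l.map (Sym.letter (Q := Q)) ++ [.sep]) =
      (l'.flatMap fun l => l.map .letter ++ [.sep]) → l = l' := by
  have key : ∀ (x y : List A) (r s : List (Sym A Q)),
      x.map .letter ++ .sep :: r = y.map .letter ++ .sep :: s → x = y ∧ r = s := by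
    intro x
    induction x with
    | nil => intro y r s h; cases y <;> simp_all
    | cons a x ih =>
      intro y r s h
      cases y with
      | nil => simp at h
      | cons b y =>
        simp only [List.map_cons, List.cons_append, List.cons.injEq, Sym.letter.injEq] at h
        obtain ⟨rfl, rfl⟩ := ih _ _ _ h.2
        exact ⟨by rw [h.1], rfl⟩
  intro l
  induction l with
  | nil => intro l' h; cases l' <;> simp_all
  | cons x l ih =>
    intro l' h
    cases l' with
    | nil => simp at h
    | cons y l' =>
      simp only [List.flatMap_cons, List.append_assoc, List.singleton_append] at h
      obtain ⟨rfl, h2⟩ := key _ _ _ _ h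
      rw [ih _ h2]

theorem Fact.code_injective : Injective (Fact.code : Fact A Q → List (Sym A Q)) := by
  rintro ⟨q, l⟩ ⟨q', l'⟩ h
  simp only [Fact.code, List.cons.injEq, Sym.pred.injEq] at h
  rw [h.1, sep_args_injective _ _ h.2]

theorem Fact.fin_notMem_code (F : Fact A Q) : Sym.fin ∉ F.code := by
  simp [Fact.code]

end Clauses

/-! ### The stacks of the machine -/

/-- The stacks of the saturation machine. -/
inductive Stk
  | inp | out | w | w' | d | d' | e | t | t' | f | g | m | go
  deriving DecidableEq

instance : Fintype Stk :=
  ⟨{.inp, .out, .w, .w', .d, .d', .e, .t, .t', .f, .g, .m, .go}, fun x => by cases x <;> decide⟩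

variable (A Q : Type) [Fintype A]

/-- The number of digits of the counter: one for each letter, and one for the separator. -/
abbrev base : ℕ := Fintype.card (Option A)

/-- The stack alphabets. -/
@[reducible] def Alph : Stk → Type
  | .inp => A
  | .out => Bool
  | .w | .w' => Fin (base A)
  | .d | .d' | .e | .t | .t' => Sym A Q
  | .f | .g | .m | .go => Unit

instance [Fintype Q] : ∀ k, Fintype (Alph A Q k)
  | .inp => inferInstanceAs (Fintype A)
  | .out => inferInstanceAs (Fintype Bool)
  | .w | .w' => inferInstanceAs (Fintype (Fin _))
  | .d | .d' | .e | .t | .t' => inferInstanceAs (Fintype (Sym A Q))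
  | .f | .g | .m | .go => inferInstanceAs (Fintype Unit)

/-- The contents of the stacks. -/
structure St where
  inp : List A := []
  out : List Bool := []
  w : List (Fin (base A)) := []
  w' : List (Fin (base A)) := []
  d : List (Sym A Q) := []
  d' : List (Sym A Q) := []
  e : List (Sym A Q) := []
  t : List (Sym A Q) := []
  t' : List (Sym A Q) := []
  f : List Unit := []
  g : List Unit := []
  m : List Unit := []
  go : List Unit := []

variable {A Q}

namespace St

/-- The contents as a family. -/
def stk (s : St A Q) : ∀ k, List (Alph A Q k)
  | .inp => s.inp
  | .out => s.out
  | .w => s.w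
  | .w' => s.w'
  | .d => s.d
  | .d' => s.d'
  | .e => s.e
  | .t => s.t
  | .t' => s.t'
  | .f => s.f
  | .g => s.g
  | .m => s.m
  | .go => s.go

/-- Replace the contents of one stack. -/
def set (s : St A Q) : ∀ k, List (Alph A Q k) → St A Q
  | .inp, x => { s with inp := x }
  | .out, x => { s with out := x }
  | .w, x => { s with w := x }
  | .w', x => { s with w' := x }
  | .d, x => { s with d := x }
  | .d', x => { s with d' := x }
  | .e, x => { s with e := x }
  | .t, x => { s with t := x }
  | .t', x => { s with t' := x }
  | .f, x => { s with f := x }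
  | .g, x => { s with g := x }
  | .m, x => { s with m := x }
  | .go, x => { s with go := x }

theorem update_stk (s : St A Q) (k : Stk) (x : List (Alph A Q k)) :
    update s.stk k x = (s.set k x).stk := by
  funext k'
  cases k <;> cases k' <;> first | exact update_self _ _ _ | exact update_of_ne (by decide) _ _

theorem stk_set_self (s : St A Q) (k : Stk) (x : List (Alph A Q k)) : (s.set k x).stk k = x := by
  rw [← update_stk, update_self]

theorem stk_set_of_ne (s : St A Q) {k k' : Stk} (h : k' ≠ k) (x : List (Alph A Q k)) :
    (s.set k x).stk k' = s.stk k' := by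
  rw [← update_stk, update_of_ne h]

theorem set_stk_self (s : St A Q) (k : Stk) : s.set k (s.stk k) = s := by
  cases k <;> rfl

theorem set_set (s : St A Q) (k : Stk) (x y : List (Alph A Q k)) :
    (s.set k x).set k y = s.set k y := by
  cases k <;> rfl

theorem set_comm (s : St A Q) {k k' : Stk} (h : k ≠ k') (x : List (Alph A Q k))
    (y : List (Alph A Q k')) : (s.set k x).set k' y = (s.set k' y).set k x := by
  cases k <;> cases k' <;> first | rfl | exact absurd rfl h

end St

/-! ### Program logic -/

/-- Programs of the saturation machine. -/
abbrev Code (A Q : Type) [Fintype A] := Prog (Alph A Q)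

/-- The program `p` transforms `s` into `s'` within `B` steps. -/
def Run (p : Code A Q) (s s' : St A Q) (B : ℕ) : Prop := ∃ n ≤ B, Exec p s.stk n s'.stk

namespace Run

theorem mono {p : Code A Q} {s s' B B'} (h : Run p s s' B) (hB : B ≤ B') : Run p s s' B' :=
  let ⟨n, hn, he⟩ := h
  ⟨n, hn.trans hB, he⟩

theorem skip {s : St A Q} : Run .skip s s 1 := ⟨1, le_rfl, .skip _⟩

theorem push {s : St A Q} (k a) : Run (.push k a) s (s.set k (a :: s.stk k)) 1 :=
  ⟨1, le_rfl, s.update_stk k _ ▸ .push k a s.stk⟩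

theorem seq {p q : Code A Q} {s s' s'' B B'} (h : Run p s s' B) (h' : Run q s' s'' B') :
    Run (.seq p q) s s'' (1 + B + B') :=
  let ⟨m, hm, he⟩ := h
  let ⟨n, hn, he'⟩ := h'
  ⟨1 + m + n, by omega, .seq he he'⟩

theorem pop {k} {f : _ → Code A Q} {s s' B}
    (h : Run (f (s.stk k).head?) (s.set k (s.stk k).tail) s' B) : Run (.pop k f) s s' (1 + B) :=
  let ⟨m, hm, he⟩ := h
  ⟨1 + m, by omega, .pop (by rwa [St.update_stk])⟩

theorem loopExit {k g} {f : _ → Code A Q} {s s' B} (hg : g (s.stk k).head? = false)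
    (h : Run (f (s.stk k).head?) (s.set k (s.stk k).tail) s' B) :
    Run (.loop k g f) s s' (1 + B) :=
  let ⟨m, hm, he⟩ := h
  ⟨1 + m, by omega, .loopExit hg (by rwa [St.update_stk])⟩

theorem loopNext {k g} {f : _ → Code A Q} {s s' s'' B B'} (hg : g (s.stk k).head? = true)
    (h : Run (f (s.stk k).head?) (s.set k (s.stk k).tail) s' B)
    (h' : Run (.loop k g f) s' s'' B') :
    Run (.loop k g f) s s'' (1 + B + B') :=
  let ⟨m, hm, he⟩ := h
  let ⟨n, hn, he'⟩ := h'
  ⟨1 + m + n, by omega, .loopNext hg (by rwa [St.update_stk]) he'⟩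

end Run

/-- Run the body for every letter of a stack, until the stack is empty. -/
def each (k : Stk) (f : Alph A Q k → Code A Q) : Code A Q :=
  .loop k Option.isSome fun o => o.elim .skip f

namespace Run

theorem each_nil {k} {f : _ → Code A Q} {s : St A Q} (h : s.stk k = []) :
    Run (each k f) s s 2 := by
  refine loopExit (B := 1) (by rw [h]; rfl) ?_
  have : s.set k [] = s := by rw [← h, St.set_stk_self]
  rw [h, List.tail_nil, this]
  exact skip

theorem each_cons {k} {f : _ → Code A Q} {s s' s'' : St A Q} {a l B B'} (h : s.stk k = a :: l)
    (h1 : Run (f a) (s.set k l) s' B) (h2 : Run (each k f) s' s'' B') :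
    Run (each k f) s s'' (1 + B + B') :=
  loopNext (by rw [h]; rfl) (by rw [h]; exact h1) h2

end Run

/-- Empty a stack. -/
def drain (k : Stk) : Code A Q := each k fun _ => .skip

/-- Move the contents of a stack to another one. -/
def move (k k' : Stk) (f : Alph A Q k → Alph A Q k') : Code A Q := each k fun a => .push k' (f a)

theorem Run.drain (k : Stk) (s : St A Q) : Run (drain k) s (s.set k []) (2 * (s.stk k).length + 2) := by
  generalize hl : s.stk k = l
  induction l generalizing s with
  | nil =>
    have : s.set k [] = s := by rw [← hl, St.set_stk_self]
    rw [this]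
    exact each_nil hl
  | cons a l ih =>
    have := ih (s.set k l) (St.stk_set_self _ _ _)
    rw [St.set_set] at this
    exact (each_cons hl skip this).mono (by simp only [List.length_cons]; omega)

theorem Run.move {k k' : Stk} (hk : k ≠ k') (f : Alph A Q k → Alph A Q k') (s : St A Q) :
    Run (move k k' f) s ((s.set k []).set k' (((s.stk k).map f).reverse ++ s.stk k'))
      (2 * (s.stk k).length + 2) := by
  generalize hl : s.stk k = l
  induction l generalizing s with
  | nil =>
    have : s.set k [] = s := by rw [← hl, St.set_stk_self]
    rw [this, List.map_nil, List.reverse_nil, List.nil_append, St.set_stk_self]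
    exact each_nil hl
  | cons a l ih =>
    have := ih ((s.set k l).set k' (f a :: s.stk k'))
      (by rw [St.stk_set_of_ne _ hk, St.stk_set_self])
    rw [St.set_comm _ hk.symm, St.set_set, St.set_set, St.stk_set_self] at this
    have h0 := Run.push (s := s.set k l) k' (f a)
    rw [St.stk_set_of_ne _ hk.symm] at h0
    rw [List.map_cons, List.reverse_cons, List.append_assoc]
    exact (each_cons hl h0 this).mono (by simp only [List.length_cons]; omega)

end Saturation

namespace Saturation

open StackProg Function

variable {A Q : Type} [Fintype A]

/-! ### Reading variables from the counter -/

/-- The letter or separator that a digit stands for. -/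
noncomputable def dig : Fin (base A) ≃ Option A := (Fintype.equivFin _).symm

/-- The word before the first separator. -/
noncomputable def fld : List (Fin (base A)) → List A
  | [] => []
  | i :: W => (dig i).elim [] fun a => a :: fld W

/-- The digits after the first separator. -/
noncomputable def rest : List (Fin (base A)) → List (Fin (base A))
  | [] => []
  | i :: W => if (dig i).isSome then rest W else W

/-- The `i`-th word in a list of digits. -/
noncomputable def field (W : List (Fin (base A))) (i : ℕ) : List A := fld (rest^[i] W)

theorem length_rest_le (W : List (Fin (base A))) : (rest W).length ≤ W.length := by
  induction W with
  | nil => simp [rest]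
  | cons i W ih => rw [rest]; split_ifs <;> simp only [List.length_cons] <;> omega

theorem length_fld_le (W : List (Fin (base A))) : (fld W).length ≤ W.length := by
  induction W with
  | nil => simp [fld]
  | cons i W ih => rw [fld]; cases dig i <;> simp; omega

theorem length_rest_iterate_le (W : List (Fin (base A))) (i : ℕ) :
    (rest^[i] W).length ≤ W.length := by
  induction i with
  | zero => simp
  | succ i ih => rw [iterate_succ_apply']; exact (length_rest_le _).trans ih

theorem length_field_le (W : List (Fin (base A))) (i : ℕ) : (field W i).length ≤ W.length :=
  (length_fld_le _).trans (length_rest_iterate_le _ _)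

/-- Advance to the next separator, and copy the word before it if `copy` is set. -/
noncomputable def scan (copy : Bool) : Code A Q :=
  .loop .w (fun o => (o.bind dig).isSome) fun o => o.elim .skip fun i =>
    .seq (.push .w' i)
      (if copy then (dig i).elim .skip fun a => .push .t (.letter a) else .skip)

theorem Run.scan (copy : Bool) (s : St A Q) :
    ∃ w₂, w₂.reverse ++ rest s.w = s.w'.reverse ++ s.w ∧
      Run (scan copy) s { s with
        w := rest s.w, w' := w₂,
        t := if copy then ((fld s.w).map .letter).reverse ++ s.t else s.t }
        (4 * s.w.length + 4) := by
  obtain ⟨i0, o0, w, w', d, d', e, t, t', f, g, m, go⟩ := s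
  dsimp only
  induction w generalizing w' t with
  | nil =>
    refine ⟨w', by simp [rest], ?_⟩
    have : (if copy then ((fld []).map .letter).reverse ++ t else t) = t := by simp [fld]
    simp only [rest, this]
    exact mono (loopExit (B := 1) rfl skip) (by omega)
  | cons i w ih =>
    cases hi : dig i with
    | none =>
      refine ⟨i :: w', by simp [rest, hi], ?_⟩
      have h1 : (if copy then ((fld (i :: w)).map .letter).reverse ++ t else t) = t := by
        simp [fld, hi]
      have h2 : rest (i :: w) = w := by simp [rest, hi]
      rw [h1, h2]
      refine mono (loopExit (B := 1 + 1 + 1) (congrArg Option.isSome hi) ?_)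
        (by simp only [List.length_cons]; omega)
      refine Run.seq (Run.push _ _) ?_
      rw [hi]
      cases copy <;> exact skip
    | some a =>
      obtain ⟨w₂, h1, h2⟩ := ih (i :: w') (if copy then .letter a :: t else t)
      refine ⟨w₂, by simp [rest, hi, h1], ?_⟩
      have h3 : (if copy then ((fld (i :: w)).map .letter).reverse ++ t else t) =
          if copy then ((fld w).map .letter).reverse ++ (if copy then .letter a :: t else t)
          else (if copy then .letter a :: t else t) := by
        cases copy <;> simp [fld, hi]
      have h4 : rest (i :: w) = rest w := by simp [rest, hi]
      rw [h3, h4]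
      refine mono (loopNext (B := 1 + 1 + 1) (congrArg Option.isSome hi)
        (Run.seq (Run.push _ _) ?_) h2) (by simp only [List.length_cons]; omega)
      rw [hi]
      cases copy
      · exact skip
      · exact Run.push _ _

/-- Advance to the `i`-th word of the counter and copy it. -/
noncomputable def scanTo : ℕ → Code A Q
  | 0 => scan true
  | i + 1 => .seq (scan false) (scanTo i)

theorem Run.scanTo (i : ℕ) (s : St A Q) :
    ∃ w₂, w₂.reverse ++ rest^[i + 1] s.w = s.w'.reverse ++ s.w ∧
      Run (scanTo i) s { s with
        w := rest^[i + 1] s.w, w' := w₂, t := ((field s.w i).map .letter).reverse ++ s.t }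
        ((i + 1) * (4 * s.w.length + 5)) := by
  induction i generalizing s with
  | zero =>
    obtain ⟨w₂, h1, h2⟩ := Run.scan true s
    exact ⟨w₂, h1, mono h2 (by omega)⟩
  | succ i ih =>
    obtain ⟨w₁, h1, h2⟩ := Run.scan false s
    obtain ⟨w₂, h3, h4⟩ := ih { s with w := rest s.w, w' := w₁ }
    refine ⟨w₂, h3.trans h1, mono (Run.seq h2 h4) ?_⟩
    have := Nat.mul_le_mul_left (i + 1) (Nat.mul_le_mul_left 4 (length_rest_le s.w))
    dsimp only
    nlinarith

/-- Copy the `i`-th word of the counter. -/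
noncomputable def copyField (i : ℕ) : Code A Q := .seq (scanTo i) (move .w' .w id)

theorem Run.copyField (i : ℕ) (s : St A Q) (hs : s.w' = []) :
    Run (copyField i) s { s with t := ((field s.w i).map .letter).reverse ++ s.t }
      ((i + 2) * (4 * s.w.length + 5)) := by
  obtain ⟨w₂, h1, h2⟩ := Run.scanTo i s
  rw [hs, List.reverse_nil, List.nil_append] at h1
  have h3 := Run.move (k := .w') (k' := .w) (by decide) id
    { s with w := rest^[i + 1] s.w, w' := w₂, t := ((field s.w i).map .letter).reverse ++ s.t }
  have h4 : ((w₂.map id).reverse ++ rest^[i + 1] s.w) = s.w := by rw [List.map_id, h1]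
  have h5 : w₂.length ≤ s.w.length := by
    rw [← h1, List.length_append, List.length_reverse]; omega
  have h6 := Run.seq h2 h3
  dsimp only [St.set, St.stk] at h6
  rw [h4, ← hs] at h6
  exact mono h6 (by nlinarith)

/-- Write an instance of a coded atom. -/
noncomputable def build : List (Sym A Q ⊕ ℕ) → Code A Q
  | [] => .skip
  | .inl x :: l => .seq (.push .t x) (build l)
  | .inr i :: l => .seq (copyField i) (build l)

theorem Run.build (l : List (Sym A Q ⊕ ℕ)) :
    ∃ c, ∀ s : St A Q, s.w' = [] →
      Run (build l) s { s with t := (l.flatMap (instSym (field s.w))).reverse ++ s.t }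
        (c * (s.w.length + 1)) := by
  induction l with
  | nil => exact ⟨1, fun s _ => mono skip (by omega)⟩
  | cons x l ih =>
    obtain ⟨c, hc⟩ := ih
    cases x with
    | inl x =>
      refine ⟨c + 2, fun s hs => ?_⟩
      have := hc { s with t := x :: s.t } hs
      simp only [List.flatMap_cons, List.reverse_cons, instSym, List.append_assoc,
        List.cons_append, List.nil_append]
      exact mono (Run.seq (Run.push _ _) this) (by nlinarith)
    | inr i =>
      refine ⟨c + 5 * (i + 2) + 1, fun s hs => ?_⟩
      have := hc { s with t := ((field s.w i).map .letter).reverse ++ s.t } hs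
      simp only [List.flatMap_cons, List.reverse_append, instSym, List.append_assoc]
      exact mono (Run.seq (Run.copyField i s hs) this) (by dsimp only; nlinarith)

theorem length_instSym_le (l : List (Sym A Q ⊕ ℕ)) : ∃ c, ∀ W : List (Fin (base A)),
    (l.flatMap (instSym (field W))).length ≤ c * (W.length + 1) := by
  induction l with
  | nil => exact ⟨0, by simp⟩
  | cons x l ih =>
    obtain ⟨c, hc⟩ := ih
    refine ⟨c + 1, fun W => ?_⟩
    have h : (instSym (field W) x).length ≤ W.length + 1 := by
      cases x with
      | inl x => simp [instSym]
      | inr i => simp only [instSym, List.length_map]; exact (length_field_le W i).trans (by omega)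
    have := hc W
    rw [List.flatMap_cons, List.length_append]
    nlinarith

/-! ### Looking up facts -/

variable [DecidableEq A] [DecidableEq Q]

/-- Compare the word on `e` with the word on `t` and record equality on `g`. -/
def compare : Code A Q :=
  .seq (each .e fun a => .pop .t fun o => o.elim (.push .f ()) fun b =>
    .seq (.push .t' b) (if a = b then .skip else .push .f ())) <|
  .seq (.pop .t fun o => o.elim .skip fun b => .seq (.push .t' b) (.push .f ())) <|
  .seq (move .t' .t id) <|
  .pop .f fun o => if o = none then .push .g () else drain .f

theorem Run.compare_loop (s : St A Q) :
    ∃ F t₁, (F = [] ↔ s.f = [] ∧ s.t = s.e ++ s.t.drop s.e.length) ∧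
      F.length ≤ s.f.length + s.e.length ∧
      t₁.reverse ++ s.t.drop s.e.length = s.t'.reverse ++ s.t ∧
      Run (each .e fun a => .pop .t fun o => o.elim (.push .f ()) fun b =>
        .seq (.push .t' b) (if a = b then .skip else .push .f ())) s
        { s with e := [], t := s.t.drop s.e.length, t' := t₁, f := F } (6 * s.e.length + 2) := by
  obtain ⟨i0, o0, w, w', d, d', e, t, t', f, g, m, go⟩ := s
  dsimp only
  induction e generalizing t t' f with
  | nil => exact ⟨f, t', by simp, by simp, rfl, each_nil rfl⟩
  | cons a e ih =>
    cases t with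
    | nil =>
      obtain ⟨F, t₁, h1, h2, h3, h4⟩ := ih [] t' (() :: f)
      refine ⟨F, t₁, ?_, ?_, by simpa using h3, ?_⟩
      · simp [h1]
      · simp only [List.length_cons] at h2 ⊢; omega
      · rw [List.drop_nil] at h4 ⊢
        exact mono (each_cons (B := 1 + 1) rfl (Run.pop (Run.push _ _)) h4)
          (by simp only [List.length_cons]; omega)
    | cons b t =>
      obtain ⟨F, t₁, h1, h2, h3, h4⟩ := ih t (b :: t') (if a = b then f else () :: f)
      refine ⟨F, t₁, ?_, ?_, ?_, ?_⟩
      · rw [h1]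
        split_ifs with hab
        · simp [hab]
        · simp [Ne.symm hab]
      · split_ifs at h2 <;> simp only [List.length_cons] at h2 ⊢ <;> omega
      · simp [h3]
      · refine mono (each_cons (B := 1 + (1 + 1 + 1)) rfl (Run.pop (Run.seq (Run.push _ _) ?_)) h4)
          (by simp only [List.length_cons]; omega)
        split_ifs
        · exact skip
        · exact Run.push _ _

theorem Run.compare (s : St A Q) (hf : s.f = []) (ht : s.t' = []) :
    Run compare s { s with e := [], g := if s.e = s.t then () :: s.g else s.g }
      (20 * (s.e.length + s.t.length + 1)) := by
  obtain ⟨F, t₁, h1, h2, h3, h4⟩ := Run.compare_loop s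
  obtain ⟨i0, o0, w, w', d, d', e, t, t', f, g, m, go⟩ := s
  dsimp only at *
  subst hf ht
  simp only [List.length_nil, zero_add, true_and, List.reverse_nil, List.nil_append] at h1 h2 h3
  obtain ⟨F', t₃, h5, h6, h7, h8⟩ : ∃ F' t₃, (F' = [] ↔ e = t) ∧
      F'.length ≤ e.length + 1 ∧ t₃.reverse ++ (t.drop e.length).tail = t ∧
      Run (.pop .t fun o => o.elim .skip fun b => .seq (.push .t' b) (.push .f ()))
        (⟨i0, o0, w, w', d, d', [], t.drop e.length, t₁, F, g, m, go⟩ : St A Q)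
        ⟨i0, o0, w, w', d, d', [], (t.drop e.length).tail, t₃, F', g, m, go⟩ 4 := by
    cases h : t.drop e.length with
    | nil =>
      rw [h] at h1 h3
      refine ⟨F, t₁, ?_, by omega, h3, mono (Run.pop (B := 1) skip) (by omega)⟩
      rw [h1, List.append_nil, eq_comm]
    | cons b l =>
      rw [h] at h1 h3
      refine ⟨() :: F, b :: t₁, ?_, by simp only [List.length_cons]; omega, by simpa using h3,
        mono (Run.pop (Run.seq (Run.push _ _) (Run.push _ _))) (by omega)⟩
      have : e ≠ t := by rintro rfl; simp at h
      simp [this]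
  have h9 : t₃.length ≤ t.length := by
    have := congrArg List.length h7
    rw [List.length_append, List.length_reverse] at this; omega
  have h10 := Run.move (k := .t') (k' := .t) (by decide) id
    (⟨i0, o0, w, w', d, d', [], (t.drop e.length).tail, t₃, F', g, m, go⟩ : St A Q)
  dsimp only [St.set, St.stk] at h10
  rw [List.map_id, h7] at h10
  refine mono (Run.seq h4 (Run.seq h8 (Run.seq h10 (Run.pop
    (B := 2 * (e.length + 1) + 2) ?_)))) (by omega)
  cases F' with
  | nil => rw [if_pos (h5.1 rfl)]; exact mono (Run.push _ _) (by omega)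
  | cons x F' =>
    have h11 : e ≠ t := fun h => by simpa using h5.2 h
    rw [if_neg h11]
    simp only [List.length_cons] at h6
    exact mono (Run.drain .f (⟨i0, o0, w, w', d, d', [], t, [], F', g, m, go⟩ : St A Q))
      (by simp only [St.stk]; omega)

/-- The code of a list of facts. -/
def codes (L : List (Fact A Q)) : List (Sym A Q) := L.flatMap fun F => F.code ++ [.fin]

/-- Record on `g` the occurrences on `d` of the reversal of the word on `t`. -/
def lookup : Code A Q :=
  .seq (each .d fun a => .seq (.push .d' a) (if a = .fin then Saturation.compare else .push .e a))
    (move .d' .d id)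

/-- The effect of `lookup` on the stacks `e` and `g`. -/
def lookupAux (t : List (Sym A Q)) : List (Sym A Q) → List (Sym A Q) → List Unit →
    List (Sym A Q) × List Unit
  | [], e, g => (e, g)
  | a :: l, e, g =>
    if a = .fin then lookupAux t l [] (if e = t then () :: g else g) else lookupAux t l (a :: e) g

omit [Fintype A] in
theorem lookupAux_append (t F l : List (Sym A Q)) (hF : Sym.fin ∉ F) (e g) :
    lookupAux t (F ++ .fin :: l) e g =
      lookupAux t l [] (if F.reverse ++ e = t then () :: g else g) := by
  induction F generalizing e with
  | nil => rw [List.nil_append, lookupAux, if_pos rfl]; rfl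
  | cons a F ih =>
    have h1 : a ≠ .fin := fun h => hF (by simp [h])
    rw [List.cons_append, lookupAux, if_neg h1, ih fun h => hF (by simp [h])]
    simp

omit [Fintype A] in
theorem lookupAux_codes (X : Fact A Q) (L : List (Fact A Q)) (g) :
    ∃ g', lookupAux X.code.reverse (codes L) [] g = ([], g') ∧ (g' = [] ↔ g = [] ∧ X ∉ L) ∧
      g'.length ≤ g.length + L.length := by
  induction L generalizing g with
  | nil => exact ⟨g, rfl, by simp, by simp⟩
  | cons F L ih =>
    obtain ⟨g', h1, h2, h3⟩ := ih (if F = X then () :: g else g)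
    refine ⟨g', ?_, ?_, ?_⟩
    · rw [codes, List.flatMap_cons, List.append_assoc, List.singleton_append,
        lookupAux_append _ _ _ F.fin_notMem_code, List.append_nil]
      simp only [List.reverse_inj, Fact.code_injective.eq_iff]
      exact h1
    · rw [h2]
      by_cases h : F = X <;> simp [h, Ne.symm]
    · split_ifs at h3 <;> simp only [List.length_cons] at h3 ⊢ <;> omega

omit [Fintype A] [DecidableEq A] [DecidableEq Q] in
theorem length_le_codes (L : List (Fact A Q)) : L.length ≤ (codes L).length := by
  induction L with
  | nil => simp
  | cons F L ih =>
    simp only [codes, List.flatMap_cons, List.length_append, List.length_cons, List.length_nil]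
      at ih ⊢
    omega

theorem Run.lookup_loop (s : St A Q) (hf : s.f = []) (ht : s.t' = []) {N : ℕ}
    (hN : s.d.length + s.e.length + s.t.length ≤ N) :
    Run (each .d fun a =>
        .seq (.push .d' a) (if a = .fin then Saturation.compare else .push .e a)) s
      { s with d := [], d' := s.d.reverse ++ s.d', e := (lookupAux s.t s.d s.e s.g).1,
               g := (lookupAux s.t s.d s.e s.g).2 } (s.d.length * (20 * (N + 1) + 4) + 2) := by
  obtain ⟨i0, o0, w, w', d, d', e, t, t', f, g, m, go⟩ := s
  dsimp only at *
  subst hf ht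
  induction d generalizing d' e g with
  | nil => exact mono (each_nil rfl) (by simp)
  | cons a d ih =>
    simp only [List.length_cons] at hN
    have h1 : (a :: d).reverse ++ d' = d.reverse ++ a :: d' := by simp
    have h3 : (a :: d).length * (20 * (N + 1) + 4) + 2 =
        1 + (1 + 1 + (20 * (N + 1) + 1)) + (d.length * (20 * (N + 1) + 4) + 2) := by
      simp only [List.length_cons, add_mul]; omega
    rw [h1, lookupAux, h3]
    by_cases ha : a = .fin
    · simp only [if_pos ha]
      have h2 := ih (a :: d') [] (if e = t then () :: g else g)
        (by simp only [List.length_nil]; omega)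
      refine each_cons rfl (Run.seq (Run.push _ _) ?_) h2
      rw [if_pos ha]
      exact mono (Run.compare (⟨i0, o0, w, w', d, a :: d', e, t, [], [], g, m, go⟩ : St A Q)
        rfl rfl) (by dsimp only; omega)
    · simp only [if_neg ha]
      have h2 := ih (a :: d') (a :: e) g (by simp only [List.length_cons]; omega)
      refine each_cons rfl (Run.seq (Run.push _ _) ?_) h2
      rw [if_neg ha]
      exact mono (Run.push _ _) (by omega)

theorem Run.lookup (s : St A Q) (L : List (Fact A Q)) (X : Fact A Q) (hd : s.d = codes L)
    (ht : s.t = X.code.reverse) (he : s.e = []) (hf : s.f = []) (ht' : s.t' = [])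
    (hd' : s.d' = []) :
    ∃ g', (g' = [] ↔ s.g = [] ∧ X ∉ L) ∧ g'.length ≤ s.g.length + s.d.length ∧
      Run lookup s { s with g := g' } (30 * (s.d.length + s.t.length + 1) ^ 2) := by
  obtain ⟨g', h1, h2, h3⟩ := lookupAux_codes X L s.g
  refine ⟨g', h2, ?_, ?_⟩
  · rw [hd]
    have := length_le_codes L
    omega
  · have h4 := Run.lookup_loop s hf ht' le_rfl
    rw [← hd, ← ht, ← he] at h1
    have h5 := Run.move (k := .d') (k' := .d) (by decide) id
      { s with d := [], d' := s.d.reverse ++ s.d', e := (lookupAux s.t s.d s.e s.g).1,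
               g := (lookupAux s.t s.d s.e s.g).2 }
    rw [h1] at h4 h5
    obtain ⟨i0, o0, w, w', d, d', e, t, t', f, g, m, go⟩ := s
    dsimp only [St.set, St.stk] at *
    subst hd' he
    simp only [List.append_nil, List.map_id, List.reverse_reverse, List.length_nil, add_zero,
      List.length_reverse] at h4 h5
    exact mono (Run.seq h4 h5) (by nlinarith)

end Saturation

namespace Saturation

open StackProg Function

variable {A Q : Type} [Fintype A] [DecidableEq A] [DecidableEq Q]

/-! ### Applying a clause -/

/-- Record on `m` that the instance of an atom is not on the list of facts. -/
noncomputable def testPrem (p : Atom A Q) : Code A Q :=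
  .seq (build p.code) <| .seq lookup <| .seq (drain .t) <|
    .pop .g fun o => if o = none then .push .m () else drain .g

theorem Run.testPrem (p : Atom A Q) : ∃ c, ∀ w (L : List (Fact A Q)) m go,
    Run (testPrem p) { w := w, d := codes L, m := m, go := go }
      { w := w, d := codes L, m := if p.inst (field w) ∈ L then m else () :: m, go := go }
      (c * ((codes L).length + w.length + 1) ^ 2) := by
  obtain ⟨c₁, h₁⟩ := Run.build p.code
  obtain ⟨c₂, h₂⟩ := length_instSym_le p.code
  refine ⟨c₁ + 30 * (c₂ + 1) ^ 2 + 2 * c₂ + 10, fun w L m go => ?_⟩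
  have e₁ := h₁ { w := w, d := codes L, m := m, go := go } rfl
  have e₂ := h₂ w
  dsimp only at e₁
  rw [Atom.code_inst] at e₁ e₂
  rw [List.append_nil] at e₁
  obtain ⟨g', hg, hg', e₃⟩ := Run.lookup
    { w := w, d := codes L, t := (p.inst (field w)).code.reverse, m := m, go := go } L (p.inst (field w)) rfl rfl rfl
    rfl rfl rfl
  have e₄ := Run.drain .t
    { w := w, d := codes L, t := (p.inst (field w)).code.reverse, g := g', m := m, go := go }
  dsimp only [St.set, St.stk] at *
  simp only [true_and, List.length_nil, zero_add] at hg hg'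
  refine mono (Run.seq e₁ (Run.seq e₃ (Run.seq e₄ (Run.pop
    (B := 2 * (codes L).length + 2) ?_)))) ?_
  · cases g' with
    | nil => rw [if_neg (hg.1 rfl)]; exact mono (Run.push _ _) (by omega)
    | cons x g' =>
      have h : p.inst (field w) ∈ L := by
        by_contra h
        simpa using hg.2 h
      rw [if_pos h]
      simp only [List.length_cons] at hg'
      exact mono (Run.drain .g { w := w, d := codes L, g := g', m := m, go := go })
        (by simp only [St.stk]; omega)
  · rw [List.length_reverse]
    set T := (p.inst (field w)).code.length
    set D := (codes L).length
    have h1 : D + T + 1 ≤ (c₂ + 1) * (D + w.length + 1) := by nlinarith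
    have h2 := Nat.pow_le_pow_left h1 2
    rw [mul_pow] at h2
    have h3 : D + w.length + 1 ≤ (D + w.length + 1) ^ 2 := Nat.le_self_pow (by omega) _
    set X := (D + w.length + 1) ^ 2
    have h4 : w.length + 1 ≤ X := by omega
    have h5 : c₁ * (w.length + 1) ≤ c₁ * X := Nat.mul_le_mul_left _ h4
    have h6 : c₂ * (w.length + 1) ≤ c₂ * X := Nat.mul_le_mul_left _ h4
    simp only [add_mul, mul_assoc] at *
    omega

/-- Test all the premises of a clause. -/
noncomputable def testPrems : List (Atom A Q) → Code A Q
  | [] => .skip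
  | p :: ps => .seq (testPrem p) (testPrems ps)

theorem Run.testPrems (ps : List (Atom A Q)) : ∃ c, ∀ w (L : List (Fact A Q)) m go,
    ∃ m', (m' = [] ↔ m = [] ∧ ∀ p ∈ ps, p.inst (field w) ∈ L) ∧ m'.length ≤ m.length + ps.length ∧
    Run (testPrems ps) { w := w, d := codes L, m := m, go := go }
      { w := w, d := codes L, m := m', go := go }
      (c * ((codes L).length + w.length + 1) ^ 2) := by
  induction ps with
  | nil => exact ⟨1, fun w L m go => ⟨m, by simp, by simp, mono skip
      (by nlinarith [Nat.zero_le ((codes L).length + w.length)])⟩⟩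
  | cons p ps ih =>
    obtain ⟨c₁, h₁⟩ := Run.testPrem p
    obtain ⟨c₂, h₂⟩ := ih
    refine ⟨c₁ + c₂ + 1, fun w L m go => ?_⟩
    obtain ⟨m', h3, h4, h5⟩ := h₂ w L (if p.inst (field w) ∈ L then m else () :: m) go
    refine ⟨m', ?_, ?_, mono (Run.seq (h₁ w L m go) h5) ?_⟩
    · rw [h3]
      by_cases h : p.inst (field w) ∈ L <;> simp [h]
    · split_ifs at h4 <;> simp only [List.length_cons] at h4 ⊢ <;> omega
    · have : 1 ≤ ((codes L).length + w.length + 1) ^ 2 := Nat.one_le_pow _ _ (by omega)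
      nlinarith

/-- The effect of a clause on a list of facts, for the values of the variables given by `w`. -/
noncomputable def derive (r : Clause A Q) (w : List (Fin (base A))) (L : List (Fact A Q)) : List (Fact A Q) :=
  if ∀ p ∈ r.prems, p.inst (field w) ∈ L then r.concl.inst (field w) :: L else L

/-- Apply a clause. -/
noncomputable def applyClause (r : Clause A Q) : Code A Q :=
  .seq (testPrems r.prems) <| .pop .m fun o =>
    if o = none then .seq (build r.concl.code) (.seq (.push .d .fin) (move .t .d id))
    else drain .m

theorem Run.applyClause (r : Clause A Q) : ∃ c, ∀ w (L : List (Fact A Q)) go,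
    (codes (derive r w L)).length ≤ (codes L).length + c * (w.length + 1) ∧
    Run (applyClause r) { w := w, d := codes L, go := go }
      { w := w, d := codes (derive r w L), go := go }
      (c * ((codes L).length + w.length + 1) ^ 2) := by
  obtain ⟨c₁, h₁⟩ := Run.testPrems r.prems
  obtain ⟨c₂, h₂⟩ := Run.build r.concl.code
  obtain ⟨c₃, h₃⟩ := length_instSym_le r.concl.code
  refine ⟨c₁ + c₂ + 2 * c₃ + 2 * r.prems.length + 20, fun w L go => ?_⟩
  obtain ⟨m', h4, h5, h6⟩ := h₁ w L [] go
  have e₂ := h₂ { w := w, d := codes L, go := go } rfl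
  have e₃ := h₃ w
  dsimp only at e₂
  rw [Atom.code_inst] at e₂ e₃
  rw [List.append_nil] at e₂
  have e₄ := Run.move (k := .t) (k' := .d) (by decide) id
    { w := w, d := .fin :: codes L, t := (r.concl.inst (field w)).code.reverse, go := go }
  dsimp only [St.set, St.stk] at e₂ e₄
  have e₅ : ((List.map id (r.concl.inst (field w)).code.reverse).reverse ++ .fin :: codes L) =
      codes (r.concl.inst (field w) :: L) := by simp [codes]
  rw [e₅] at e₄
  have h7 : ((codes L).length + w.length + 1) ≤ ((codes L).length + w.length + 1) ^ 2 :=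
    Nat.le_self_pow (by omega) _
  have h8 : (w.length + 1) ≤ ((codes L).length + w.length + 1) ^ 2 := by omega
  simp only [true_and, List.length_nil, zero_add] at h4 h5
  constructor
  · have : (codes (r.concl.inst (field w) :: L)).length =
        (r.concl.inst (field w)).code.length + 1 + (codes L).length := by
      simp [codes]; omega
    unfold derive
    split_ifs
    · rw [this]; simp only [add_mul, mul_assoc]; omega
    · omega
  · refine mono (Run.seq h6 (Run.pop
      (B := c₂ * (w.length + 1) + 2 * (c₃ * (w.length + 1)) + 10 + 2 * r.prems.length) ?_)) ?_
    · cases m' with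
      | nil =>
        have h : derive r w L = r.concl.inst (field w) :: L := if_pos (h4.1 rfl)
        rw [h]
        rw [List.length_reverse] at e₄
        exact mono (Run.seq e₂ (Run.seq (Run.push _ _) e₄)) (by omega)
      | cons x m' =>
        have h : derive r w L = L := if_neg fun h => by simpa using h4.2 h
        rw [h]
        simp only [List.length_cons] at h5
        exact mono (Run.drain .m { w := w, d := codes L, m := m', go := go })
          (by simp only [St.stk]; omega)
    · have h9 := Nat.mul_le_mul_left c₂ h8
      have h10 := Nat.mul_le_mul_left c₃ h8
      have h11 : 2 * r.prems.length * 1 ≤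
        2 * r.prems.length * ((codes L).length + w.length + 1) ^ 2 :=
        Nat.mul_le_mul_left _ (by omega)
      simp only [add_mul, mul_assoc] at *
      omega

/-- The effect of a list of clauses. -/
noncomputable def deriveAll (rs : List (Clause A Q)) (w : List (Fin (base A))) (L : List (Fact A Q)) :
    List (Fact A Q) := rs.foldl (fun L r => derive r w L) L

/-- Apply a list of clauses. -/
noncomputable def applyAll : List (Clause A Q) → Code A Q
  | [] => .skip
  | r :: rs => .seq (applyClause r) (applyAll rs)

theorem Run.applyAll (rs : List (Clause A Q)) : ∃ c, ∀ w (L : List (Fact A Q)) go,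
    (codes (deriveAll rs w L)).length ≤ (codes L).length + c * (w.length + 1) ∧
    Run (applyAll rs) { w := w, d := codes L, go := go }
      { w := w, d := codes (deriveAll rs w L), go := go }
      (c * ((codes L).length + w.length + 1) ^ 2) := by
  induction rs with
  | nil => exact ⟨1, fun w L go => ⟨by simp [deriveAll], mono skip
      (by nlinarith [Nat.zero_le ((codes L).length + w.length)])⟩⟩
  | cons r rs ih =>
    obtain ⟨c₁, h₁⟩ := Run.applyClause r
    obtain ⟨c₂, h₂⟩ := ih
    refine ⟨c₁ + c₂ * (c₁ + 1) ^ 2 + 1 + c₂, fun w L go => ?_⟩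
    obtain ⟨h3, h4⟩ := h₁ w L go
    obtain ⟨h5, h6⟩ := h₂ w (derive r w L) go
    refine ⟨?_, mono (Run.seq h4 h6) ?_⟩
    · change (codes (deriveAll rs w (derive r w L))).length ≤ _
      nlinarith [Nat.zero_le (c₂ * (c₁ + 1) ^ 2 * (w.length + 1))]
    · have h7 : (codes (derive r w L)).length + w.length + 1 ≤
          (c₁ + 1) * ((codes L).length + w.length + 1) := by nlinarith
      have h8 := Nat.mul_le_mul_left c₂ (Nat.pow_le_pow_left h7 2)
      rw [mul_pow, ← mul_assoc] at h8
      have h9 : 1 ≤ ((codes L).length + w.length + 1) ^ 2 := Nat.one_le_pow _ _ (by omega)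
      simp only [add_mul]
      have := Nat.zero_le (c₂ * ((codes L).length + w.length + 1) ^ 2)
      omega

/-! ### The counter -/

/-- The next digit, cyclically. -/
noncomputable def nextDigit (i : Fin (base A)) : Fin (base A) :=
  ⟨(i + 1) % base A, Nat.mod_lt _ Fintype.card_pos⟩

/-- The digits of `j`, least significant first. -/
noncomputable def digits : ℕ → ℕ → List (Fin (base A))
  | 0, _ => []
  | M + 1, j => ⟨j % base A, Nat.mod_lt _ Fintype.card_pos⟩ :: digits M (j / base A)

omit [DecidableEq A] in
@[simp] theorem length_digits (M j : ℕ) : (digits (A := A) M j).length = M := by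
  induction M generalizing j with
  | zero => rfl
  | succ M ih => simp [digits, ih]

omit [DecidableEq A] in
theorem digits_zero (M : ℕ) :
    digits (A := A) M 0 = List.replicate M ⟨0, Fintype.card_pos⟩ := by
  induction M with
  | zero => rfl
  | succ M ih => simp [digits, ih, List.replicate_succ]

/-- Add one to the counter, and record on `go` that it has not overflowed. -/
noncomputable def increment : Code A Q :=
  .seq (.loop .w (fun o => o.elim false fun i => (i : ℕ) + 1 = base A) fun o =>
      o.elim .skip fun i => .seq (.push .w' (nextDigit i))
        (if (i : ℕ) + 1 = base A then .skip else .push .go ())) <|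
    move .w' .w id

omit [DecidableEq A] [DecidableEq Q] in
theorem Run.increment_loop (M j : ℕ) (d : List (Sym A Q)) (w') :
    ∃ w₁ w₂, w₂.reverse ++ w₁ = w'.reverse ++ digits M (j + 1) ∧
      Run (.loop .w (fun o => o.elim false fun i => (i : ℕ) + 1 = base A) fun o =>
        o.elim .skip fun i => .seq (.push .w' (nextDigit i))
          (if (i : ℕ) + 1 = base A then .skip else .push .go ()))
        { w := digits M j, w' := w', d := d }
        { w := w₁, w' := w₂, d := d, go := if base A ^ M ∣ j + 1 then [] else [()] }
        (4 * M + 4) := by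
  have hb : 0 < base A := Fintype.card_pos
  induction M generalizing j w' with
  | zero =>
    refine ⟨[], w', by simp [digits], mono (loopExit (B := 1) rfl ?_) (by omega)⟩
    simp only [pow_zero, one_dvd, if_true]
    exact skip
  | succ M ih =>
    by_cases h : base A ∣ j + 1
    · obtain ⟨w₁, w₂, h1, h2⟩ := ih (j / base A) (nextDigit ⟨j % base A, Nat.mod_lt _ hb⟩ :: w')
      have h3 : (j + 1) / base A = j / base A + 1 := Nat.succ_div_of_dvd h
      have h4 : j % base A + 1 = base A := by
        have h6 := Nat.div_add_mod j (base A)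
        have h7 := Nat.div_mul_cancel h
        rw [h3] at h7
        nlinarith
      have h5 : base A ^ M ∣ j / base A + 1 ↔ base A ^ (M + 1) ∣ j + 1 := by
        rw [← h3, pow_succ']
        exact Nat.dvd_div_iff_mul_dvd h
      simp only [h5] at h2
      refine ⟨w₁, w₂, ?_, ?_⟩
      · rw [h1, digits, h3]
        simp [nextDigit, Nat.add_mod]
      · refine mono (loopNext (B := 1 + 1 + 1) (decide_eq_true h4) ?_ h2) (by omega)
        refine Run.seq (Run.push _ _) ?_
        rw [if_pos (by simpa using h4)]
        exact skip
    · have h4 : j % base A + 1 ≠ base A := fun h' => h (by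
        have h6 := Nat.div_add_mod j (base A)
        refine ⟨j / base A + 1, ?_⟩
        rw [mul_add]; omega)
      have h3 : (j + 1) / base A = j / base A := Nat.succ_div_of_not_dvd h
      have h5 : ¬ base A ^ (M + 1) ∣ j + 1 := fun h' =>
        h ((dvd_pow_self _ (by omega)).trans h')
      refine ⟨digits M (j / base A), nextDigit ⟨j % base A, Nat.mod_lt _ hb⟩ :: w', ?_, ?_⟩
      · rw [digits, h3]
        simp [nextDigit, Nat.add_mod]
      · rw [if_neg h5]
        refine mono (loopExit (B := 1 + 1 + 1) (decide_eq_false h4) ?_) (by omega)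
        refine Run.seq (Run.push _ _) ?_
        rw [if_neg (by simpa using h4)]
        exact Run.push _ _

omit [DecidableEq A] [DecidableEq Q] in
theorem Run.increment (M j : ℕ) (d : List (Sym A Q)) :
    Run increment { w := digits M j, d := d }
      { w := digits M (j + 1), d := d, go := if base A ^ M ∣ j + 1 then [] else [()] }
      (6 * M + 10) := by
  obtain ⟨w₁, w₂, h1, h2⟩ := Run.increment_loop M j d []
  have h3 := Run.move (k := .w') (k' := .w) (by decide) id
    { w := w₁, w' := w₂, d := d, go := if base A ^ M ∣ j + 1 then [] else [()] }
  dsimp only [St.set, St.stk] at h3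
  rw [List.map_id, h1, List.reverse_nil, List.nil_append] at h3
  have h4 := congrArg List.length h1
  simp only [List.length_append, List.length_reverse, List.length_nil, length_digits] at h4
  exact mono (Run.seq h2 h3) (by omega)

/-! ### The main loop -/

/-- The list of facts after `j` rounds of the main loop. -/
noncomputable def rounds (rs : List (Clause A Q)) (M : ℕ) (L : List (Fact A Q)) :
    ℕ → List (Fact A Q)
  | 0 => L
  | j + 1 => deriveAll rs (digits M j) (rounds rs M L j)

theorem Run.mainLoop (rs : List (Clause A Q)) : ∃ c, ∀ M (L : List (Fact A Q)),
    (∀ j, (codes (rounds rs M L j)).length ≤ (codes L).length + j * (c * (M + 1))) ∧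
    ∀ j k, j + k + 1 = base A ^ M →
    Run (each .go fun _ => .seq (Saturation.applyAll rs) Saturation.increment)
      { w := digits M j, d := codes (rounds rs M L j), go := [()] }
      { w := digits M (base A ^ M), d := codes (rounds rs M L (base A ^ M)) }
      ((k + 1) * (c * ((codes L).length + base A ^ M * (c * (M + 1)) + M + 1) ^ 2) + 2) := by
  obtain ⟨c, hc⟩ := Run.applyAll rs
  have hX : ∀ M (L : List (Fact A Q)) j,
      (codes (rounds rs M L j)).length ≤ (codes L).length + j * (c * (M + 1)) := by
    intro M L j
    induction j with
    | zero => simp [rounds]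
    | succ j ih =>
      have := (hc (digits M j) (rounds rs M L j) []).1
      rw [length_digits] at this
      rw [rounds, add_mul]
      omega
  refine ⟨c + 20, fun M L => ⟨fun j => (hX M L j).trans ?_, fun j k => ?_⟩⟩
  · gcongr; omega
  set Y := (codes L).length + base A ^ M * ((c + 20) * (M + 1)) + M + 1 with hY
  have hY1 : M + 1 ≤ Y := by omega
  have hY2 : Y ≤ Y ^ 2 := Nat.le_self_pow (by omega) _
  have step : ∀ j, j < base A ^ M → Run (.seq (Saturation.applyAll rs) Saturation.increment)
      { w := digits M j, d := codes (rounds rs M L j) }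
      { w := digits M (j + 1), d := codes (rounds rs M L (j + 1)),
        go := if base A ^ M ∣ j + 1 then [] else [()] } ((c + 18) * Y ^ 2) := by
    intro j hj
    refine mono (Run.seq (hc (digits M j) (rounds rs M L j) []).2
      (Run.increment M j (codes (rounds rs M L (j + 1))))) ?_
    have h1 : (codes (rounds rs M L j)).length + (digits (A := A) M j).length + 1 ≤ Y := by
      rw [length_digits]
      have h2 := hX M L j
      have h3 : j * (c * (M + 1)) ≤ base A ^ M * ((c + 20) * (M + 1)) := by gcongr; omega
      omega
    have h2 := Nat.mul_le_mul_left c (Nat.pow_le_pow_left h1 2)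
    rw [add_mul]
    omega
  induction k generalizing j with
  | zero =>
    intro hj
    have h := step j (by omega)
    rw [show j + 1 = base A ^ M by omega, if_pos dvd_rfl] at h
    refine mono (each_cons rfl h (each_nil rfl)) ?_
    simp only [add_mul] at *
    omega
  | succ k ih =>
    intro hj
    have h := step j (by omega)
    rw [if_neg (fun hd => by have := Nat.le_of_dvd (by omega) hd; omega)] at h
    refine mono (each_cons rfl h (ih (j + 1) (by omega))) ?_
    simp only [add_mul] at *
    omega

/-! ### The whole machine -/

/-- Push `n` zeros on the counter. -/
noncomputable def pushZeros : ℕ → Code A Q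
  | 0 => .skip
  | n + 1 => .seq (.push .w ⟨0, Fintype.card_pos⟩) (pushZeros n)

omit [DecidableEq A] [DecidableEq Q] in
theorem Run.pushZeros (n : ℕ) (s : St A Q) :
    Run (pushZeros n) s { s with w := List.replicate n ⟨0, Fintype.card_pos⟩ ++ s.w }
      (2 * n + 1) := by
  induction n generalizing s with
  | zero => exact skip
  | succ n ih =>
    have h := ih (s.set .w (⟨0, Fintype.card_pos⟩ :: s.w))
    dsimp only [St.set] at h
    have e : ∀ x : List (Fin (base A)), List.replicate n ⟨0, Fintype.card_pos⟩ ++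
        ⟨0, Fintype.card_pos⟩ :: x = List.replicate (n + 1) ⟨0, Fintype.card_pos⟩ ++ x := by
      intro x
      rw [List.replicate_succ', List.append_assoc, List.singleton_append]
    rw [e] at h
    exact mono (Run.seq (Run.push _ _) h) (by omega)

/-- Write the fact that states the input, and set up the counter. -/
noncomputable def setup (q₀ : Q) (C : ℕ) : Code A Q :=
  .seq (.push .t (.pred q₀)) <|
  .seq (each .inp fun a => .seq (.push .t (.letter a)) (pushZeros C)) <|
  .seq (pushZeros C) <| .seq (.push .t .sep) <| .seq (.push .d .fin) <|
  .seq (move .t .d id) (.push .go ())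

omit [DecidableEq A] [DecidableEq Q] in
theorem Run.setup_loop (C : ℕ) (x : List A) (w : List (Fin (base A)))
    (t : List (Sym A Q)) :
    Run (each .inp fun a => .seq (.push .t (.letter a)) (Saturation.pushZeros C))
      { inp := x, w := w, t := t }
      { w := List.replicate (C * x.length) ⟨0, Fintype.card_pos⟩ ++ w,
        t := (x.map .letter).reverse ++ t } (x.length * (2 * C + 4) + 2) := by
  induction x generalizing w t with
  | nil => simpa using each_nil (s := { w := w, t := t }) rfl
  | cons a x ih =>
    have h := ih (List.replicate C ⟨0, Fintype.card_pos⟩ ++ w) (.letter a :: t)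
    have e₁ : List.replicate (C * (a :: x).length) (⟨0, Fintype.card_pos⟩ : Fin (base A)) ++ w =
        List.replicate (C * x.length) ⟨0, Fintype.card_pos⟩ ++
          (List.replicate C ⟨0, Fintype.card_pos⟩ ++ w) := by
      rw [← List.append_assoc, List.replicate_append_replicate, List.length_cons, mul_add, mul_one]
    have e₂ : ((a :: x).map (Sym.letter (Q := Q))).reverse ++ t =
        (x.map .letter).reverse ++ .letter a :: t := by simp
    rw [e₁, e₂]
    refine mono (each_cons rfl (Run.seq (Run.push _ _) (Run.pushZeros C _)) h) ?_
    simp only [List.length_cons, add_mul]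
    omega

omit [DecidableEq A] [DecidableEq Q] in
theorem Run.setup (q₀ : Q) (C : ℕ) (x : List A) :
    Run (Saturation.setup q₀ C) { inp := x }
      { w := digits (C * (x.length + 1)) 0, d := codes [⟨q₀, [x]⟩], go := [()] }
      ((20 * C + 20) * (x.length + 1)) := by
  have h₁ := Run.setup_loop C x [] [Sym.pred q₀]
  have h₂ := Run.pushZeros C { w := List.replicate (C * x.length) ⟨0, Fintype.card_pos⟩ ++ [],
                               t := (x.map .letter).reverse ++ [Sym.pred q₀] }
  have h₃ := Run.move (k := .t) (k' := .d) (by decide) id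
    { w := digits (C * (x.length + 1)) 0, d := [.fin],
      t := .sep :: ((x.map .letter).reverse ++ [Sym.pred q₀]) }
  have e₁ : List.replicate C ⟨0, Fintype.card_pos⟩ ++
      (List.replicate (C * x.length) ⟨0, Fintype.card_pos⟩ ++ []) =
      digits (A := A) (C * (x.length + 1)) 0 := by
    rw [digits_zero, List.append_nil, List.replicate_append_replicate, mul_add, mul_one, add_comm]
  dsimp only [St.set, St.stk] at h₂ h₃
  rw [e₁] at h₂
  have e₂ : ((List.map id (Sym.sep :: ((x.map .letter).reverse ++ [Sym.pred q₀]))).reverse ++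
      [Sym.fin]) = codes [⟨q₀, [x]⟩] := by simp [codes, Fact.code]
  rw [e₂] at h₃
  refine mono (Run.seq (Run.push _ _) (Run.seq h₁ (Run.seq h₂ (Run.seq (Run.push _ _)
    (Run.seq (Run.push _ _) (Run.seq h₃ (Run.push _ _))))))) ?_
  simp only [List.length_cons, List.length_append, List.length_reverse, List.length_map,
    List.length_nil]
  nlinarith

/-- Saturate, and test whether the goal has not been derived. -/
noncomputable def program (rs : List (Clause A Q)) (q₀ q₁ : Q) (C : ℕ) : Code A Q :=
  .seq (Saturation.setup q₀ C) <|
  .seq (each .go fun _ => .seq (Saturation.applyAll rs) Saturation.increment) <|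
  .seq (testPrem ⟨q₁, []⟩) <|
  .seq (.pop .m fun o => .push .out o.isSome) <| .seq (drain .w) (drain .d)

/-- The facts that the machine has derived in the end. -/
noncomputable def derived (rs : List (Clause A Q)) (q₀ : Q) (C : ℕ) (x : List A) :
    List (Fact A Q) :=
  rounds rs (C * (x.length + 1)) [⟨q₀, [x]⟩] (base A ^ (C * (x.length + 1)))

theorem exists_time_bound (b C c₁ c₂ : ℕ) : ∃ c, ∀ n N M : ℕ,
    M = C * (n + 1) → N = b ^ M →
      (20 * C + 20) * (n + 1) +
        (N * (c₁ * (n + 3 + N * (c₁ * (M + 1)) + M + 1) ^ 2) + 2) +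
        c₂ * (n + 3 + N * (c₁ * (M + 1)) + M + 1) ^ 2 + 10 +
        (2 * M + 2) + (2 * (n + 3 + N * (c₁ * (M + 1))) + 2) ≤ 2 ^ (c * (n + 1)) := by
  set D := b * C + C + 3
  set c := 20 * C + 20 + c₁ * (c₁ + 2) ^ 2 + c₂ * (c₁ + 2) ^ 2 + 16 + 2 + 2 * (c₁ + 2)
  refine ⟨c + 5 * D, fun n N M hM hN => ?_⟩
  set Y := 2 ^ (D * (n + 1))
  have hp : ∀ k, k ≤ D → 2 ^ (k * (n + 1)) ≤ Y := fun k hk =>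
    Nat.pow_le_pow_right (by omega) (Nat.mul_le_mul_right _ hk)
  have h1 : n + 4 ≤ Y := by
    refine le_trans ?_ (hp 3 (by omega))
    have := Nat.lt_two_pow_self (n := n + 1)
    have h2 : 2 ^ (3 * (n + 1)) = 2 ^ (n + 1) * 2 ^ (2 * (n + 1)) := by rw [← pow_add]; congr 1; ring
    have h3 : 2 ^ 2 ≤ 2 ^ (2 * (n + 1)) := Nat.pow_le_pow_right (by omega) (by omega)
    nlinarith
  have h2 : N ≤ Y := by
    refine le_trans ?_ (hp (b * C) (by omega))
    rw [hN, hM, mul_assoc, pow_mul 2 b]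
    exact Nat.pow_le_pow_left Nat.lt_two_pow_self.le _
  have h3 : M + 1 ≤ Y := by
    refine le_trans ?_ (hp C (by omega))
    rw [hM]
    exact Nat.lt_two_pow_self
  have hY2 : Y ≤ Y ^ 2 := Nat.le_self_pow (by omega) _
  have hY4 : Y ^ 4 ≤ Y ^ 5 := Nat.pow_le_pow_right (by omega) (by omega)
  have hY24 : Y ^ 2 ≤ Y ^ 4 := Nat.pow_le_pow_right (by omega) (by omega)
  have h4 : N * (c₁ * (M + 1)) ≤ c₁ * Y ^ 2 := by
    calc N * (c₁ * (M + 1)) ≤ Y * (c₁ * Y) := by gcongr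
      _ = c₁ * Y ^ 2 := by ring
  have h5 : n + 3 + N * (c₁ * (M + 1)) + M + 1 ≤ (c₁ + 2) * Y ^ 2 := by
    rw [add_mul]; omega
  have h6 : (n + 3 + N * (c₁ * (M + 1)) + M + 1) ^ 2 ≤ (c₁ + 2) ^ 2 * Y ^ 4 := by
    calc _ ≤ ((c₁ + 2) * Y ^ 2) ^ 2 := Nat.pow_le_pow_left h5 2
      _ = _ := by ring
  set Z := n + 3 + N * (c₁ * (M + 1)) + M + 1
  have h7 : N * (c₁ * Z ^ 2) ≤ c₁ * (c₁ + 2) ^ 2 * Y ^ 5 := by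
    calc N * (c₁ * Z ^ 2) ≤ Y * (c₁ * ((c₁ + 2) ^ 2 * Y ^ 4)) := by gcongr
      _ = _ := by ring
  have h8 : c₂ * Z ^ 2 ≤ c₂ * (c₁ + 2) ^ 2 * Y ^ 5 := by
    calc c₂ * Z ^ 2 ≤ c₂ * ((c₁ + 2) ^ 2 * Y ^ 5) := by gcongr; exact h6.trans (by gcongr)
      _ = _ := by ring
  have h9 : (20 * C + 20) * (n + 1) ≤ (20 * C + 20) * Y ^ 5 := by gcongr; omega
  have h10 : (c₁ + 2) * Y ^ 2 ≤ (c₁ + 2) * Y ^ 5 := by gcongr <;> omega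
  have h11 : c * Y ^ 5 ≤ 2 ^ ((c + 5 * D) * (n + 1)) := by
    have e : 2 ^ ((c + 5 * D) * (n + 1)) = 2 ^ (c * (n + 1)) * Y ^ 5 := by
      rw [← pow_mul, ← pow_add]; congr 1; ring
    rw [e]
    gcongr
    exact Nat.lt_two_pow_self.le.trans (Nat.pow_le_pow_right (by omega) (by nlinarith))
  refine le_trans ?_ h11
  have h12 : c * Y ^ 5 = (20 * C + 20) * Y ^ 5 + c₁ * (c₁ + 2) ^ 2 * Y ^ 5 +
    c₂ * (c₁ + 2) ^ 2 * Y ^ 5 + 16 * Y ^ 5 + 2 * Y ^ 5 + 2 * ((c₁ + 2) * Y ^ 5) := by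
    simp only [c]; ring
  omega

theorem Run.program (rs : List (Clause A Q)) (q₀ q₁ : Q) (C : ℕ) : ∃ c, ∀ x : List A,
    Run (program rs q₀ q₁ C) { inp := x } { out := [decide (⟨q₁, []⟩ ∉ derived rs q₀ C x)] }
      (2 ^ (c * (x.length + 1))) := by
  obtain ⟨c₁, h₁⟩ := Run.mainLoop rs
  obtain ⟨c₂, h₂⟩ := Run.testPrem (⟨q₁, []⟩ : Atom A Q)
  obtain ⟨c, hc⟩ := exists_time_bound (base A) C c₁ c₂
  refine ⟨c, fun x => ?_⟩
  set M := C * (x.length + 1) with hM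
  have hN : 0 < base A ^ M := Nat.pow_pos Fintype.card_pos
  have hl : (codes [(⟨q₀, [x]⟩ : Fact A Q)]).length = x.length + 3 := by
    simp [codes, Fact.code]
  obtain ⟨h3, h4⟩ := h₁ M [⟨q₀, [x]⟩]
  have h5 := h4 0 (base A ^ M - 1) (by omega)
  have h6 := h₂ (digits M (base A ^ M)) (derived rs q₀ C x) [] []
  have h7 := Run.drain .w ({ w := digits M (base A ^ M), d := codes (derived rs q₀ C x),
                             out := [decide (⟨q₁, []⟩ ∉ derived rs q₀ C x)] } : St A Q)
  have h8 := Run.drain .d ({ d := codes (derived rs q₀ C x),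
                             out := [decide (⟨q₁, []⟩ ∉ derived rs q₀ C x)] } : St A Q)
  refine mono (Run.seq (Run.setup q₀ C x) (Run.seq h5 (Run.seq h6 (Run.seq (Run.pop (B := 1) ?_)
    (Run.seq h7 h8))))) (le_trans ?_ (hc x.length (base A ^ M) M rfl rfl))
  · by_cases h : (⟨q₁, []⟩ : Fact A Q) ∈ derived rs q₀ C x
    · have h' : (⟨q₁, []⟩ : Atom A Q).inst (field (digits M (base A ^ M))) ∈
        derived rs q₀ C x := h
      rw [if_pos h', decide_eq_false (not_not.2 h)]
      exact Run.push _ _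
    · have h' : (⟨q₁, []⟩ : Atom A Q).inst (field (digits M (base A ^ M))) ∉
        derived rs q₀ C x := h
      rw [if_neg h', decide_eq_true h]
      exact Run.push _ _
  · have h9 := h3 (base A ^ M)
    have h10 : base A ^ M - 1 + 1 = base A ^ M := by omega
    rw [hl] at h9 ⊢
    rw [h10, length_digits]
    have h11 : (codes (derived rs q₀ C x)).length ≤
      x.length + 3 + base A ^ M * (c₁ * (M + 1)) := h9
    have h12 : c₂ * ((codes (derived rs q₀ C x)).length + M + 1) ^ 2 ≤
        c₂ * (x.length + 3 + base A ^ M * (c₁ * (M + 1)) + M + 1) ^ 2 := by gcongr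
    simp only [St.stk, length_digits]
    omega

end Saturation

namespace Saturation

open StackProg Function

section Analysis

variable {A Q : Type}

/-- The variables of an atom are among the first `k`. -/
def Atom.VarsBelow (k : ℕ) (p : Atom A Q) : Bool :=
  p.args.all fun l => l.all fun | .letter _ => true | .var i => decide (i < k)

/-- The variables of a clause are among the first `k`. -/
def Clause.VarsBelow (k : ℕ) (r : Clause A Q) : Bool :=
  r.concl.VarsBelow k && r.prems.all (Atom.VarsBelow k)

theorem Atom.inst_congr {k : ℕ} {p : Atom A Q} (hp : p.VarsBelow k) {σ τ : ℕ → List A}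
    (h : ∀ i < k, σ i = τ i) : p.inst σ = p.inst τ := by
  simp only [VarsBelow, List.all_eq_true] at hp
  simp only [inst, Fact.mk.injEq, true_and, List.map_inj_left]
  intro l hl
  refine List.flatMap_congr fun x hx => ?_
  have := hp l hl x hx
  cases x with
  | letter a => rfl
  | var i => exact h i (by simpa using this)

/-- A set of facts is closed under a list of clauses. -/
def Closed (rs : List (Clause A Q)) (V : Set (Fact A Q)) : Prop :=
  ∀ r ∈ rs, ∀ σ, (∀ p ∈ r.prems, p.inst σ ∈ V) → r.concl.inst σ ∈ V

/-- The facts that can be derived from a fact about `x` when the values of the variables are not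
longer than `x`. -/
inductive Derives (rs : List (Clause A Q)) (q₀ : Q) (x : List A) : Fact A Q → Prop
  | input : Derives rs q₀ x ⟨q₀, [x]⟩
  | clause (r) (hr : r ∈ rs) (σ : ℕ → List A) (hσ : ∀ i, (σ i).length ≤ x.length)
      (h : ∀ p ∈ r.prems, Derives rs q₀ x (p.inst σ)) : Derives rs q₀ x (r.concl.inst σ)

variable [Fintype A]

theorem fld_append (v : List A) (T : List (Fin (base A))) :
    fld (v.map (fun a => dig.symm (some a)) ++ dig.symm none :: T) = v := by
  induction v with
  | nil => simp [fld]
  | cons a v ih => simp [fld, ih]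

theorem rest_append (v : List A) (T : List (Fin (base A))) :
    rest (v.map (fun a => dig.symm (some a)) ++ dig.symm none :: T) = T := by
  induction v with
  | nil => simp [rest]
  | cons a v ih => simp [rest, ih]

/-- Digits that stand for a list of words. -/
noncomputable def spell (vs : List (List A)) : List (Fin (base A)) :=
  vs.flatMap fun v => v.map (fun a => dig.symm (some a)) ++ [dig.symm none]

theorem field_spell (vs : List (List A)) (T : List (Fin (base A))) (i : ℕ) (hi : i < vs.length) :
    field (spell vs ++ T) i = vs[i] := by
  induction vs generalizing i with
  | nil => simp at hi
  | cons v vs ih =>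
    have e : spell (v :: vs) ++ T =
        v.map (fun a => dig.symm (some a)) ++ dig.symm none :: (spell vs ++ T) := by
      simp [spell]
    rw [e]
    cases i with
    | zero => exact fld_append _ _
    | succ i =>
      rw [field, iterate_succ_apply, rest_append]
      exact ih i (by simpa using hi)

theorem length_spell_le (vs : List (List A)) (n : ℕ) (h : ∀ v ∈ vs, v.length ≤ n) :
    (spell vs).length ≤ vs.length * (n + 1) := by
  induction vs with
  | nil => simp [spell]
  | cons v vs ih =>
    have h1 := ih fun v hv => h v (by simp [hv])
    have h2 := h v (by simp)
    simp only [spell, List.flatMap_cons, List.length_append, List.length_map, List.length_cons,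
      List.length_nil] at h1 ⊢
    rw [add_mul]
    omega

theorem exists_digits (M : ℕ) (V : List (Fin (base A))) (hV : V.length = M) :
    ∃ v < base A ^ M, digits M v = V := by
  have hb : 0 < base A := Fintype.card_pos
  induction M generalizing V with
  | zero => exact ⟨0, by simp, by simp [digits, List.length_eq_zero_iff.1 hV]⟩
  | succ M ih =>
    obtain ⟨i, V, rfl⟩ := List.exists_cons_of_length_eq_add_one hV
    obtain ⟨v, hv, h⟩ := ih V (by simpa using hV)
    refine ⟨i + base A * v, ?_, ?_⟩
    · have := i.2
      rw [pow_succ']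
      nlinarith
    · have h1 : ((i : ℕ) + base A * v) / base A = v := by
        rw [Nat.add_mul_div_left _ _ hb, Nat.div_eq_of_lt i.2, zero_add]
      simp only [digits, h1, h, List.cons.injEq, and_true]
      ext
      simp only [Nat.add_mul_mod_self_left]
      exact Nat.mod_eq_of_lt i.2

theorem digits_add (M N v u : ℕ) (hv : v < base A ^ M) :
    digits (A := A) (M + N) (v + base A ^ M * u) = digits M v ++ digits N u := by
  have hb : 0 < base A := Fintype.card_pos
  induction M generalizing v with
  | zero =>
    have : v = 0 := by simpa using hv
    simp [this, digits]
  | succ M ih =>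
    have e : v + base A ^ (M + 1) * u = v + base A * (base A ^ M * u) := by rw [pow_succ']; ring
    have h1 : v / base A < base A ^ M := Nat.div_lt_of_lt_mul (by rwa [← pow_succ'])
    rw [Nat.add_right_comm, e]
    simp only [digits, List.cons_append, List.cons.injEq]
    rw [Nat.add_mul_div_left _ _ hb, ih _ h1]
    simp

variable [DecidableEq A] [DecidableEq Q]

theorem subset_derive (r : Clause A Q) (w L) : L ⊆ derive r w L := by
  unfold derive
  split_ifs
  · exact List.subset_cons_self _ _
  · exact List.Subset.refl _

theorem subset_deriveAll (rs : List (Clause A Q)) (w L) : L ⊆ deriveAll rs w L := by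
  induction rs generalizing L with
  | nil => exact List.Subset.refl _
  | cons r rs ih => exact fun _ h => ih _ (subset_derive r w L h)

theorem mem_deriveAll (rs : List (Clause A Q)) (w L) (r) (hr : r ∈ rs)
    (h : ∀ p ∈ r.prems, p.inst (field w) ∈ L) : r.concl.inst (field w) ∈ deriveAll rs w L := by
  induction rs generalizing L with
  | nil => simp at hr
  | cons s rs ih =>
    change _ ∈ deriveAll rs w (derive s w L)
    rcases List.mem_cons.1 hr with rfl | hr
    · refine subset_deriveAll _ _ _ ?_
      rw [derive, if_pos h]
      exact List.mem_cons_self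
    · exact ih _ hr fun p hp => subset_derive _ _ _ (h p hp)

theorem deriveAll_subset {V : Set (Fact A Q)} (rs ss : List (Clause A Q)) (hV : Closed ss V)
    (hs : rs ⊆ ss) (w L) (h : ∀ F ∈ L, F ∈ V) : ∀ F ∈ deriveAll rs w L, F ∈ V := by
  induction rs generalizing L with
  | nil => exact h
  | cons r rs ih =>
    refine ih (fun x hx => hs (by simp [hx])) (derive r w L) ?_
    unfold derive
    split_ifs with hp
    · intro F hF
      rcases List.mem_cons.1 hF with rfl | hF
      · exact hV r (hs (by simp)) _ fun p h' => h _ (hp p h')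
      · exact h F hF
    · exact h

theorem derived_subset {V : Set (Fact A Q)} {rs : List (Clause A Q)} (hV : Closed rs V) {q₀ x}
    (h₀ : ⟨q₀, [x]⟩ ∈ V) (C : ℕ) : ∀ F ∈ derived rs q₀ C x, F ∈ V := by
  have key : ∀ M j, ∀ F ∈ rounds rs M [⟨q₀, [x]⟩] j, F ∈ V := by
    intro M j
    induction j with
    | zero => simpa [rounds] using h₀
    | succ j ih => exact deriveAll_subset rs rs hV (List.Subset.refl _) _ _ ih
  exact key _ _

theorem rounds_mono (rs : List (Clause A Q)) (M L) {i j : ℕ} (h : i ≤ j) :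
    rounds rs M L i ⊆ rounds rs M L j := by
  induction h with
  | refl => exact List.Subset.refl _
  | step _ ih => exact fun _ h => subset_deriveAll _ _ _ (ih h)

/-- The facts with derivations of height at most `i`. -/
def level (rs : List (Clause A Q)) (q₀ : Q) (x : List A) : ℕ → Set (Fact A Q)
  | 0 => {⟨q₀, [x]⟩}
  | i + 1 => level rs q₀ x i ∪ {F | ∃ r ∈ rs, ∃ σ : ℕ → List A, (∀ i, (σ i).length ≤ x.length) ∧
      (∀ p ∈ r.prems, p.inst σ ∈ level rs q₀ x i) ∧ r.concl.inst σ = F}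

end Analysis

/-- An increasing chain of subsets of a finite set stabilizes. -/
theorem exists_eq_succ {α : Type} (f : ℕ → Set α) (hf : ∀ i, f i ⊆ f (i + 1)) (U : Finset α)
    (hU : ∀ i, f i ⊆ U) : ∃ i ≤ U.card, f (i + 1) = f i := by
  by_contra! h
  have key : ∀ i ≤ U.card + 1, i ≤ (f i).ncard := by
    intro i
    induction i with
    | zero => simp
    | succ i ih =>
      intro hi
      have := Set.ncard_lt_ncard ((hf i).ssubset_of_ne (h i (by omega)).symm)
        (U.finite_toSet.subset (hU _))
      have := ih (by omega)
      omega
  have h1 := key _ le_rfl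
  have h2 := Set.ncard_le_ncard (hU (U.card + 1)) U.finite_toSet
  rw [Set.ncard_coe_finset] at h2
  omega

section Analysis

variable {A Q : Type} [Fintype A] [DecidableEq A] [DecidableEq Q]

omit [DecidableEq A] in
theorem exists_field_eq {k n : ℕ} (σ : ℕ → List A) (hσ : ∀ i, (σ i).length ≤ n) :
    ∃ v < base A ^ (k * (n + 1)), ∀ T : List (Fin (base A)), ∀ i < k,
      σ i = field (digits (k * (n + 1)) v ++ T) i := by
  set vs := (List.range k).map σ
  have hl : (spell vs).length ≤ k * (n + 1) := by
    have := length_spell_le vs n (by simp [vs, hσ])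
    simpa [vs] using this
  obtain ⟨v, hv, h⟩ := exists_digits (k * (n + 1))
    (spell vs ++ List.replicate (k * (n + 1) - (spell vs).length) (dig.symm none))
    (by simp; omega)
  refine ⟨v, hv, fun T i hi => ?_⟩
  rw [h, List.append_assoc, field_spell _ _ i (by simpa [vs] using hi)]
  simp [vs]

theorem level_subset_rounds {rs : List (Clause A Q)} {k : ℕ} (hk : rs.all (Clause.VarsBelow k))
    (q₀ : Q) (x : List A) (N i : ℕ) :
    ∀ F ∈ level rs q₀ x i, F ∈ rounds rs (k * (x.length + 1) + N) [⟨q₀, [x]⟩]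
      (base A ^ (k * (x.length + 1)) * i) := by
  induction i with
  | zero => intro F hF; simpa [rounds, level] using hF
  | succ i ih =>
    rintro F (hF | ⟨r, hr, σ, hσ, hp, rfl⟩)
    · exact rounds_mono rs _ _ (Nat.mul_le_mul_left _ (by omega)) (ih F hF)
    · obtain ⟨v, hv, h⟩ := exists_field_eq (k := k) σ hσ
      have h1 := List.all_eq_true.1 hk r hr
      simp only [Clause.VarsBelow, Bool.and_eq_true, List.all_eq_true] at h1
      have h2 : v + base A ^ (k * (x.length + 1)) * i + 1 ≤
          base A ^ (k * (x.length + 1)) * (i + 1) := by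
        rw [mul_add_one (base A ^ (k * (x.length + 1)))]; omega
      refine rounds_mono rs _ _ h2 ?_
      have h3 := h (digits N i)
      rw [← digits_add _ _ _ _ hv] at h3
      rw [Atom.inst_congr h1.1 h3]
      refine mem_deriveAll _ _ _ r hr fun p hp' => ?_
      rw [← Atom.inst_congr (h1.2 p hp') h3]
      exact rounds_mono rs _ _ (by omega) (ih _ (hp p hp'))

theorem mem_derived [Nonempty A] {rs : List (Clause A Q)} {k : ℕ}
    (hk : rs.all (Clause.VarsBelow k)) (q₀ : Q) (x : List A) {F : Fact A Q}
    (hF : Derives rs q₀ x F) : F ∈ derived rs q₀ (2 * k + rs.length + 1) x := by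
  classical
  set M := k * (x.length + 1)
  let U : Finset (Fact A Q) := insert ⟨q₀, [x]⟩ ((Finset.univ ×ˢ Finset.range (base A ^ M)).image
    fun y : Fin rs.length × ℕ => (rs[y.1]).concl.inst (field (digits M y.2)))
  have hU : ∀ i, level rs q₀ x i ⊆ U := by
    intro i
    induction i with
    | zero => simp [level, U]
    | succ i ih =>
      rintro F (hF | ⟨r, hr, σ, hσ, hp, rfl⟩)
      · exact ih hF
      · obtain ⟨v, hv, h⟩ := exists_field_eq (k := k) σ hσ
        obtain ⟨j, hj, rfl⟩ := List.getElem_of_mem hr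
        have h1 := List.all_eq_true.1 hk _ hr
        simp only [Clause.VarsBelow, Bool.and_eq_true, List.all_eq_true] at h1
        have h2 := h []
        rw [List.append_nil] at h2
        rw [Atom.inst_congr h1.1 h2]
        refine Finset.mem_coe.2 (Finset.mem_insert_of_mem (Finset.mem_image.2
          ⟨(⟨j, hj⟩, v), ?_, rfl⟩))
        simpa using hv
  have hc : U.card ≤ rs.length * base A ^ M + 1 := by
    refine (Finset.card_insert_le _ _).trans (Nat.add_le_add_right ?_ _)
    refine Finset.card_image_le.trans ?_
    simp
  obtain ⟨i, hi, he⟩ := exists_eq_succ (level rs q₀ x) (fun i => Set.subset_union_left) U hU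
  have h1 : F ∈ level rs q₀ x i := by
    have h0 : ∀ j, (⟨q₀, [x]⟩ : Fact A Q) ∈ level rs q₀ x j := by
      intro j
      induction j with
      | zero => rfl
      | succ j ih => exact Or.inl ih
    induction hF with
    | input => exact h0 i
    | clause r hr σ hσ _ ih =>
      rw [← he]
      exact Or.inr ⟨r, hr, σ, hσ, ih, rfl⟩
  have hb : 2 ≤ base A := by
    rw [base, Fintype.card_option]
    have := Fintype.card_pos (α := A)
    omega
  set N := (k + rs.length + 1) * (x.length + 1)
  have h2 := level_subset_rounds hk q₀ x N i F h1
  have h3 : (2 * k + rs.length + 1) * (x.length + 1) = M + N := by simp only [M, N]; ring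
  rw [derived, h3]
  refine rounds_mono rs _ _ ?_ h2
  rw [pow_add]
  refine Nat.mul_le_mul_left _ (hi.trans (hc.trans ?_))
  calc rs.length * base A ^ M + 1 ≤ (rs.length + 1) * base A ^ M := by
        have : 1 ≤ base A ^ M := Nat.one_le_pow _ _ (by omega)
        rw [add_mul]; omega
    _ ≤ base A ^ ((rs.length + 1) * (x.length + 1)) * base A ^ M := by
        gcongr
        calc rs.length + 1 ≤ 2 ^ (rs.length + 1) := Nat.lt_two_pow_self.le
          _ ≤ base A ^ (rs.length + 1) := Nat.pow_le_pow_left hb _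
          _ ≤ _ := Nat.pow_le_pow_right (by omega) (Nat.le_mul_of_pos_right _ (by omega))
    _ = base A ^ N := by rw [← pow_add]; congr 1; simp only [M, N]; ring

/-- A problem whose negative instances can be recognized by saturation is in EXPTIME. -/
theorem inEXPTIME [Nonempty A] [Fintype Q] {α : Type} (e : Computability.Encoding α A)
    (P : α → Prop) (rs : List (Clause A Q)) (q₀ q₁ : Q) (k : ℕ)
    (hk : rs.all (Clause.VarsBelow k))
    (sound : ∀ a, P a → ∃ V, Closed rs V ∧ ⟨q₀, [e.encode a]⟩ ∈ V ∧ (⟨q₁, []⟩ : Fact A Q) ∉ V)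
    (complete : ∀ a, ¬ P a → Derives rs q₀ (e.encode a) ⟨q₁, []⟩) :
    XPath.InEXPTIME e P := by
  classical
  obtain ⟨c, hc⟩ := Run.program rs q₀ q₁ (2 * k + rs.length + 1)
  have hs : ∀ x : List A, ({ inp := x } : St A Q).stk = single (Γ := Alph A Q) .inp x := by
    intro x; funext j; cases j <;> rfl
  have ho : ∀ x : List Bool, ({ out := x } : St A Q).stk = single (Γ := Alph A Q) .out x := by
    intro x; funext j; cases j <;> rfl
  refine ⟨machineComputes (Γ := Alph A Q) (program rs q₀ q₁ (2 * k + rs.length + 1)) .inp .out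
    e.encode Computability.encodeBool _ (fun n => 2 ^ (c * (n + 1))) fun a => ?_,
    Polynomial.C c * (Polynomial.X + 1) + 1, fun n => ?_⟩
  · obtain ⟨n, hn, he⟩ := hc (e.encode a)
    refine ⟨n, hn, ?_⟩
    rw [hs, ho] at he
    have hP : P a ↔ (⟨q₁, []⟩ : Fact A Q) ∉ derived rs q₀ (2 * k + rs.length + 1) (e.encode a) := by
      constructor
      · intro h h'
        obtain ⟨V, h1, h2, h3⟩ := sound a h
        exact h3 (derived_subset h1 h2 _ _ h')
      · intro h
        by_contra h'
        exact h (mem_derived hk q₀ _ (complete a h'))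
    convert he using 2
    simp [Computability.encodeBool, hP]
  · simp only [machineComputes, Polynomial.eval_add, Polynomial.eval_mul, Polynomial.eval_C,
      Polynomial.eval_X, Polynomial.eval_one, pow_succ]
    have := Nat.one_le_two_pow (n := c * (n + 1))
    omega

end Analysis

end Saturation

namespace XPath

/-! ### Subtrees -/

namespace XTree

theorem subtree?_append (t : XTree) (u w : List ℕ) :
    t.subtree? (u ++ w) = (t.subtree? u).bind fun s => s.subtree? w := by
  induction u generalizing t with
  | nil => simp [subtree?]
  | cons i u ih =>
    simp only [List.cons_append, subtree?, Option.bind_assoc]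
    exact congrArg _ (funext fun c => ih c)

theorem subtree?_nil (t : XTree) : t.subtree? [] = some t := by simp [subtree?]

theorem subtree?_append_of_eq {t s : XTree} {u : List ℕ} (h : t.subtree? u = some s)
    (w : List ℕ) : t.subtree? (u ++ w) = s.subtree? w := by
  rw [subtree?_append, h, Option.bind_some]

theorem isVertex_append {t s : XTree} {u : List ℕ} (h : t.subtree? u = some s) (w : List ℕ) :
    t.IsVertex (u ++ w) ↔ s.IsVertex w := by
  rw [IsVertex, IsVertex, subtree?_append_of_eq h]

theorem subtree?_cons_eq_some {t s : XTree} {i : ℕ} {w : List ℕ} :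
    t.subtree? (i :: w) = some s ↔ ∃ c, t.children[i]? = some c ∧ c.subtree? w = some s := by
  simp [subtree?, Option.bind_eq_some_iff]

/-- Induction along the child relation. -/
theorem induction_children {P : XTree → Prop} (h : ∀ t, (∀ c ∈ t.children, P c) → P t) (t) : P t :=
  XTree.rec (motive_1 := P) (motive_2 := fun l => ∀ c ∈ l, P c)
    (fun _ _ ih => h _ ih) (by simp) (fun _ _ h1 h2 => by
      intro c hc
      rcases List.mem_cons.1 hc with rfl | hc
      exacts [h1, h2 c hc]) t

end XTree

open XTree

/-! ### Locality of the semantics -/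

theorem NodeTest.holds_append {t s : XTree} {u : List ℕ} (h : t.subtree? u = some s)
    (n : NodeTest) (w : List ℕ) : n.Holds t (u ++ w) ↔ n.Holds s w := by
  cases n <;> simp only [NodeTest.Holds, isVertex_append h, HasLabel, subtree?_append_of_eq h]

theorem Axis.rel_append (a : Axis) (u v w : List ℕ) : a.Rel (u ++ v) (u ++ w) ↔ a.Rel v w := by
  cases a <;> simp [Axis.Rel]

theorem Axis.Rel.exists_append {a : Axis} {u v : List ℕ} (h : a.Rel u v) : ∃ w, v = u ++ w := by
  cases a with
  | self => exact ⟨[], by simpa [Axis.Rel] using h⟩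
  | child => obtain ⟨i, h⟩ := h; exact ⟨[i], h⟩
  | descendant => obtain ⟨w, -, h⟩ := h; exact ⟨w, h⟩

theorem LStep.sem_isVertex {t : XTree} :
    ∀ (s : LStep) {u v : List ℕ}, s.Sem t u v → t.IsVertex v ∧ ∃ w, v = u ++ w
  | .base a n, u, v, h => by
    rw [LStep.Sem] at h
    exact ⟨h.2.1, h.2.2.1.exists_append⟩
  | .filter s e, u, v, h => by
    rw [LStep.Sem] at h
    exact LStep.sem_isVertex s h.1

theorem LPath.sem_isVertex {t : XTree} :
    ∀ (p : LPath) {u v : List ℕ}, p.Sem t u v → t.IsVertex v ∧ ∃ w, v = u ++ w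
  | .step s, u, v, h => by
    rw [LPath.Sem] at h
    exact s.sem_isVertex h
  | .seq p q, u, v, h => by
    rw [LPath.Sem] at h
    obtain ⟨x, h1, h2⟩ := h
    obtain ⟨-, w1, rfl⟩ := LPath.sem_isVertex p h1
    obtain ⟨h3, w2, rfl⟩ := LPath.sem_isVertex q h2
    exact ⟨h3, w1 ++ w2, by simp⟩
  | .union p q, u, v, h => by
    rw [LPath.Sem] at h
    rcases h with h | h
    exacts [LPath.sem_isVertex p h, LPath.sem_isVertex q h]

mutual

theorem LPath.sem_append {t s : XTree} {u : List ℕ} (h : t.subtree? u = some s) :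
    ∀ (p : LPath) (v w : List ℕ), p.Sem t (u ++ v) (u ++ w) ↔ p.Sem s v w
  | .step r, v, w => by
    rw [LPath.Sem, LPath.Sem]
    exact LStep.sem_append h r v w
  | .seq p q, v, w => by
    rw [LPath.Sem, LPath.Sem]
    constructor
    · rintro ⟨x, h1, h2⟩
      obtain ⟨-, y, rfl⟩ := LPath.sem_isVertex p h1
      rw [List.append_assoc] at h1 h2
      exact ⟨v ++ y, (LPath.sem_append h p _ _).1 h1, (LPath.sem_append h q _ _).1 h2⟩
    · rintro ⟨x, h1, h2⟩
      exact ⟨u ++ x, (LPath.sem_append h p _ _).2 h1, (LPath.sem_append h q _ _).2 h2⟩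
  | .union p q, v, w => by
    rw [LPath.Sem, LPath.Sem]
    exact or_congr (LPath.sem_append h p v w) (LPath.sem_append h q v w)

theorem LStep.sem_append {t s : XTree} {u : List ℕ} (h : t.subtree? u = some s) :
    ∀ (r : LStep) (v w : List ℕ), r.Sem t (u ++ v) (u ++ w) ↔ r.Sem s v w
  | .base a n, v, w => by
    rw [LStep.Sem, LStep.Sem, isVertex_append h, isVertex_append h, a.rel_append,
      n.holds_append h]
  | .filter r e, v, w => by
    rw [LStep.Sem, LStep.Sem]
    exact and_congr (LStep.sem_append h r v w) (FExpr.holds_append h e w)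

theorem FExpr.holds_append {t s : XTree} {u : List ℕ} (h : t.subtree? u = some s) :
    ∀ (e : FExpr) (v : List ℕ), e.Holds t (u ++ v) ↔ e.Holds s v
  | .path p, v => by
    rw [FExpr.Holds, FExpr.Holds]
    constructor
    · rintro ⟨x, h1⟩
      obtain ⟨-, y, rfl⟩ := LPath.sem_isVertex p h1
      rw [List.append_assoc] at h1
      exact ⟨v ++ y, (LPath.sem_append h p _ _).1 h1⟩
    · rintro ⟨x, h1⟩
      exact ⟨u ++ x, (LPath.sem_append h p _ _).2 h1⟩
  | .or p q, v => by
    rw [FExpr.Holds, FExpr.Holds]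
    refine or_congr ?_ ?_
    · constructor
      · rintro ⟨x, h1⟩
        obtain ⟨-, y, rfl⟩ := LPath.sem_isVertex p h1
        rw [List.append_assoc] at h1
        exact ⟨v ++ y, (LPath.sem_append h p _ _).1 h1⟩
      · rintro ⟨x, h1⟩
        exact ⟨u ++ x, (LPath.sem_append h p _ _).2 h1⟩
    · constructor
      · rintro ⟨x, h1⟩
        obtain ⟨-, y, rfl⟩ := LPath.sem_isVertex q h1
        rw [List.append_assoc] at h1
        exact ⟨v ++ y, (LPath.sem_append h q _ _).1 h1⟩
      · rintro ⟨x, h1⟩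
        exact ⟨u ++ x, (LPath.sem_append h q _ _).2 h1⟩

end

/-! ### Truth values at the root -/

/-- The path `p` leads from the root of `t` to the root of a subtree in `K`. -/
def LPath.Sat (p : LPath) (K : XTree → Prop) (t : XTree) : Prop :=
  ∃ w s, p.Sem t [] w ∧ t.subtree? w = some s ∧ K s

/-- The axis of a step. -/
def LStep.axis : LStep → Axis
  | .base a _ => a
  | .filter s _ => s.axis

/-- The root of `t` passes the node test and the filters of a step. -/
def LStep.Passes (t : XTree) : LStep → Prop
  | .base _ n => n.Holds t []
  | .filter s e => s.Passes t ∧ e.Holds t []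

theorem LPath.sat_true {p : LPath} {t : XTree} :
    p.Sat (fun _ => True) t ↔ ∃ w, p.Sem t [] w := by
  constructor
  · rintro ⟨w, s, h, -⟩
    exact ⟨w, h⟩
  · rintro ⟨w, h⟩
    obtain ⟨⟨s, hs⟩, -⟩ := p.sem_isVertex h
    exact ⟨w, s, h, hs, trivial⟩

theorem FExpr.holds_path {p : LPath} {t : XTree} :
    (FExpr.path p).Holds t [] ↔ p.Sat (fun _ => True) t := by
  rw [FExpr.Holds, LPath.sat_true]

theorem FExpr.holds_or {p q : LPath} {t : XTree} :
    (FExpr.or p q).Holds t [] ↔ p.Sat (fun _ => True) t ∨ q.Sat (fun _ => True) t := by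
  rw [FExpr.Holds, LPath.sat_true, LPath.sat_true]

theorem LPath.sat_union {p q : LPath} {K t} :
    (LPath.union p q).Sat K t ↔ p.Sat K t ∨ q.Sat K t := by
  simp only [LPath.Sat, LPath.Sem, or_and_right, exists_or]

theorem LPath.sat_seq {p q : LPath} {K t} :
    (LPath.seq p q).Sat K t ↔ p.Sat (q.Sat K) t := by
  simp only [LPath.Sat, LPath.Sem]
  constructor
  · rintro ⟨w, s, ⟨x, h1, h2⟩, h3, h4⟩
    obtain ⟨⟨y, hy⟩, -⟩ := p.sem_isVertex h1
    obtain ⟨-, z, rfl⟩ := q.sem_isVertex h2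
    refine ⟨x, y, h1, hy, z, s, ?_, ?_, h4⟩
    · have := (q.sem_append hy [] z).1
      rw [List.append_nil] at this
      exact this h2
    · rwa [subtree?_append_of_eq hy] at h3
  · rintro ⟨x, y, h1, hy, z, s, h2, h3, h4⟩
    refine ⟨x ++ z, s, ⟨x, h1, ?_⟩, ?_, h4⟩
    · have := (q.sem_append hy [] z).2
      rw [List.append_nil] at this
      exact this h2
    · rwa [subtree?_append_of_eq hy]

theorem LStep.sem_root {t s : XTree} {w : List ℕ} (hs : t.subtree? w = some s) :
    ∀ r : LStep, r.Sem t [] w ↔ r.axis.Rel [] w ∧ r.Passes s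
  | .base a n => by
    have h1 : t.IsVertex [] := ⟨t, t.subtree?_nil⟩
    have h2 : t.IsVertex w := ⟨s, hs⟩
    have h3 := n.holds_append hs []
    rw [List.append_nil] at h3
    simp [LStep.Sem, LStep.axis, LStep.Passes, h1, h2, h3]
  | .filter r e => by
    have h3 := e.holds_append hs []
    rw [List.append_nil] at h3
    rw [LStep.Sem, LStep.axis, LStep.Passes, LStep.sem_root hs r, h3, and_assoc]

theorem LPath.sat_step {r : LStep} {K t} :
    (LPath.step r).Sat K t ↔
      ∃ w s, r.axis.Rel [] w ∧ t.subtree? w = some s ∧ r.Passes s ∧ K s := by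
  simp only [LPath.Sat, LPath.Sem]
  constructor
  · rintro ⟨w, s, h1, h2, h3⟩
    rw [r.sem_root h2] at h1
    exact ⟨w, s, h1.1, h2, h1.2, h3⟩
  · rintro ⟨w, s, h1, h2, h3, h4⟩
    exact ⟨w, s, (r.sem_root h2).2 ⟨h1, h3⟩, h2, h4⟩

theorem LPath.sat_step_self {r : LStep} (hr : r.axis = .self) {K t} :
    (LPath.step r).Sat K t ↔ r.Passes t ∧ K t := by
  rw [LPath.sat_step, hr]
  constructor
  · rintro ⟨w, s, h1, h2, h3⟩
    obtain rfl : w = [] := h1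
    rw [subtree?_nil] at h2
    obtain rfl := Option.some.inj h2
    exact h3
  · exact fun h => ⟨[], t, rfl, t.subtree?_nil, h⟩

theorem LPath.sat_step_child {r : LStep} (hr : r.axis = .child) {K t} :
    (LPath.step r).Sat K t ↔ ∃ c ∈ t.children, r.Passes c ∧ K c := by
  rw [LPath.sat_step, hr]
  constructor
  · rintro ⟨w, s, ⟨i, h1⟩, h2, h3⟩
    obtain rfl : w = [i] := h1
    obtain ⟨c, hc, h2⟩ := subtree?_cons_eq_some.1 h2
    rw [subtree?_nil] at h2
    obtain rfl := Option.some.inj h2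
    exact ⟨c, List.mem_of_getElem? hc, h3⟩
  · rintro ⟨c, hc, h⟩
    obtain ⟨i, hi⟩ := List.getElem?_of_mem hc
    exact ⟨[i], c, ⟨i, rfl⟩, subtree?_cons_eq_some.2 ⟨c, hi, c.subtree?_nil⟩, h⟩

theorem LPath.sat_step_descendant {r : LStep} (hr : r.axis = .descendant) {K t} :
    (LPath.step r).Sat K t ↔
      ∃ c ∈ t.children, (r.Passes c ∧ K c) ∨ (LPath.step r).Sat K c := by
  simp only [LPath.sat_step, hr]
  constructor
  · rintro ⟨w, s, ⟨w', hw, h1⟩, h2, h3⟩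
    obtain rfl : w = w' := h1
    obtain ⟨i, w, rfl⟩ := List.exists_cons_of_ne_nil hw
    obtain ⟨c, hc, h2⟩ := subtree?_cons_eq_some.1 h2
    refine ⟨c, List.mem_of_getElem? hc, ?_⟩
    by_cases hw : w = []
    · subst hw
      rw [subtree?_nil] at h2
      obtain rfl := Option.some.inj h2
      exact Or.inl h3
    · exact Or.inr ⟨w, s, ⟨w, hw, rfl⟩, h2, h3⟩
  · rintro ⟨c, hc, h⟩
    obtain ⟨i, hi⟩ := List.getElem?_of_mem hc
    rcases h with h | ⟨w, s, -, h2, h3⟩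
    · exact ⟨[i], c, ⟨[i], by simp, rfl⟩, subtree?_cons_eq_some.2 ⟨c, hi, c.subtree?_nil⟩, h⟩
    · exact ⟨i :: w, s, ⟨i :: w, by simp, rfl⟩, subtree?_cons_eq_some.2 ⟨c, hi, h2⟩, h3⟩

/-! ### Vectors of truth values -/

mutual

/-- The number of truth values kept for a path. -/
def LPath.size : LPath → ℕ
  | .step s => s.size + 2
  | .seq p q => p.size + q.size
  | .union p q => p.size + q.size

/-- The number of truth values kept for the filters of a step. -/
def LStep.size : LStep → ℕ
  | .base _ _ => 0
  | .filter s e => s.size + e.size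

/-- The number of truth values kept for a filter. -/
def FExpr.size : FExpr → ℕ
  | .path p => p.size
  | .or p q => p.size + q.size

end

open Classical in
mutual

/-- The truth values at the root of `t` for the steps that occur in a path, when the path has to
lead to `K`: whether a step may end at the root, and whether it may start there. -/
noncomputable def LPath.vec : LPath → (XTree → Prop) → XTree → List Bool
  | .step s, K, t =>
    decide (s.Passes t ∧ K t) :: decide ((LPath.step s).Sat K t) :: s.vec t
  | .seq p q, K, t => p.vec (q.Sat K) t ++ q.vec K t
  | .union p q, K, t => p.vec K t ++ q.vec K t

/-- The truth values for the filters of a step. -/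
noncomputable def LStep.vec : LStep → XTree → List Bool
  | .base _ _, _ => []
  | .filter s e, t => s.vec t ++ e.vec t

/-- The truth values for a filter. -/
noncomputable def FExpr.vec : FExpr → XTree → List Bool
  | .path p, t => p.vec (fun _ => True) t
  | .or p q, t => p.vec (fun _ => True) t ++ q.vec (fun _ => True) t

end

mutual

theorem LPath.length_vec : ∀ (p : LPath) (K t), (p.vec K t).length = p.size
  | .step s, K, t => by simp [LPath.vec, LPath.size, s.length_vec t]
  | .seq p q, K, t => by simp [LPath.vec, LPath.size, p.length_vec, q.length_vec]
  | .union p q, K, t => by simp [LPath.vec, LPath.size, p.length_vec, q.length_vec]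

theorem LStep.length_vec : ∀ (s : LStep) (t), (s.vec t).length = s.size
  | .base _ _, t => by simp [LStep.vec, LStep.size]
  | .filter s e, t => by simp [LStep.vec, LStep.size, s.length_vec, e.length_vec]

theorem FExpr.length_vec : ∀ (e : FExpr) (t), (e.vec t).length = e.size
  | .path p, t => by simp [FExpr.vec, FExpr.size, p.length_vec]
  | .or p q, t => by simp [FExpr.vec, FExpr.size, p.length_vec, q.length_vec]

end

mutual

theorem LPath.size_le : ∀ p : LPath, p.size ≤ (encLPath p).length
  | .step s => by
    have := s.size_le
    simp only [LPath.size, encLPath, List.length_cons]; omega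
  | .seq p q => by
    have := p.size_le
    have := q.size_le
    simp only [LPath.size, encLPath, List.length_cons, List.length_append]; omega
  | .union p q => by
    have := p.size_le
    have := q.size_le
    simp only [LPath.size, encLPath, List.length_cons, List.length_append]; omega

theorem LStep.size_le : ∀ s : LStep, s.size + 1 ≤ (encLStep s).length
  | .base a n => by
    simp only [LStep.size, encLStep, List.length_cons]; omega
  | .filter s e => by
    have := s.size_le
    have := e.size_le
    simp only [LStep.size, encLStep, List.length_cons, List.length_append]; omega

theorem FExpr.size_le : ∀ e : FExpr, e.size ≤ (encFExpr e).length
  | .path p => by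
    have := p.size_le
    simp only [FExpr.size, encFExpr, List.length_cons]; omega
  | .or p q => by
    have := p.size_le
    have := q.size_le
    simp only [FExpr.size, encFExpr, List.length_cons, List.length_append]; omega

end

/-- The disjunction of the vectors `f c`, of length `k`, for the members `c` of a list. -/
def orMap {X : Type} (k : ℕ) (f : X → List Bool) (l : List X) : List Bool :=
  l.foldr (fun c v => List.zipWith or (f c) v) (List.replicate k false)

section orMap

variable {X : Type} {f g : X → List Bool} {k m : ℕ}

theorem length_orMap (hf : ∀ c, (f c).length = k) (l : List X) : (orMap k f l).length = k := by
  induction l with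
  | nil => simp [orMap]
  | cons c l ih =>
    change (List.zipWith or (f c) (orMap k f l)).length = k
    simp [ih, hf]

theorem orMap_append (hf : ∀ c, (f c).length = k) (l : List X) :
    orMap (k + m) (fun c => f c ++ g c) l = orMap k f l ++ orMap m g l := by
  induction l with
  | nil => simp [orMap]
  | cons c l ih =>
    change List.zipWith or (f c ++ g c) (orMap (k + m) _ l) =
      List.zipWith or (f c) (orMap k f l) ++ List.zipWith or (g c) (orMap m g l)
    rw [ih, List.zipWith_append (by rw [hf, length_orMap hf])]

theorem orMap_cons (b : X → Bool) (l : List X) :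
    orMap (k + 1) (fun c => b c :: f c) l = l.any b :: orMap k f l := by
  induction l with
  | nil => simp [orMap, List.replicate_succ]
  | cons c l ih =>
    change List.zipWith or (b c :: f c) (orMap (k + 1) _ l) =
      (b c || l.any b) :: List.zipWith or (f c) (orMap k f l)
    rw [ih, List.zipWith_cons_cons]

theorem zipWith_or_replicate (v : List Bool) (h : v.length ≤ k) :
    List.zipWith or (List.replicate k false) v = v := by
  induction v generalizing k with
  | nil => simp
  | cons b v ih =>
    obtain ⟨k, rfl⟩ : ∃ j, k = j + 1 := ⟨k - 1, by simp at h; omega⟩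
    rw [List.replicate_succ, List.zipWith_cons_cons, ih (by simpa using h)]
    simp

theorem zipWith_or_assoc (u v w : List Bool) :
    List.zipWith or (List.zipWith or u v) w = List.zipWith or u (List.zipWith or v w) := by
  induction u generalizing v w with
  | nil => simp
  | cons a u ih => cases v <;> cases w <;> simp [ih, Bool.or_assoc]

theorem orMap_list_append (hf : ∀ c, (f c).length = k) (l l' : List X) :
    orMap k f (l ++ l') = List.zipWith or (orMap k f l) (orMap k f l') := by
  induction l with
  | nil => exact (zipWith_or_replicate _ (length_orMap hf l').le).symm
  | cons c l ih =>
    change List.zipWith or (f c) (orMap k f (l ++ l')) =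
      List.zipWith or (List.zipWith or (f c) (orMap k f l)) (orMap k f l')
    rw [ih, zipWith_or_assoc]

theorem orMap_singleton (hf : ∀ c, (f c).length = k) (c : X) : orMap k f [c] = f c := by
  change List.zipWith or (f c) (List.replicate k false) = f c
  rw [List.zipWith_comm_of_comm (fun a b => Bool.or_comm a b),
    zipWith_or_replicate _ (hf c).le]

end orMap

end XPath

namespace XPath

open XTree

/-! ### The vector of a tree in terms of the vectors of its children -/

/-- Whether a step can start at a vertex, given whether it may end at the vertex, whether it may
end at some child, and whether it can start at some child. -/
def Axis.combine : Axis → Bool → Bool → Bool → Bool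
  | self, b, _, _ => b
  | child, _, c, _ => c
  | descendant, _, c, d => c || d

/-- If the root has label `l` and the vectors of the children have disjunction `v`, then `x` is the
vector of the tree for the step `s`, and `c` tells whether the root passes the step. -/
def StepSpec (l : Label) (s : LStep) (v x : List Bool) (c : Bool) : Prop :=
  v.length = s.size ∧ ∀ t : XTree, t.label = l → orMap s.size s.vec t.children = v →
    s.vec t = x ∧ (s.Passes t ↔ c = true)

/-- If the root has label `l` and the vectors of the children have disjunction `v`, then `x` is the
vector of the tree for the filter `e`, and `c` tells whether the filter is true at the root. -/
def FilterSpec (l : Label) (e : FExpr) (v x : List Bool) (c : Bool) : Prop :=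
  v.length = e.size ∧ ∀ t : XTree, t.label = l → orMap e.size e.vec t.children = v →
    e.vec t = x ∧ (e.Holds t [] ↔ c = true)

/-- If the root has label `l`, the truth value of the target condition at the root is `k`, and the
vectors of the children have disjunction `v`, then `x` is the vector of the tree for the path `p`,
and `e` tells whether the path leads from the root to the target. -/
def PathSpec (l : Label) (p : LPath) (k : Bool) (v x : List Bool) (e : Bool) : Prop :=
  v.length = p.size ∧ ∀ (K : XTree → Prop) (t : XTree), t.label = l → (K t ↔ k = true) →
    orMap p.size (p.vec K) t.children = v → p.vec K t = x ∧ (p.Sat K t ↔ e = true)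

theorem StepSpec.wildcard (l : Label) (a : Axis) :
    StepSpec l (.base a .wildcard) [] [] true := by
  refine ⟨by simp [LStep.size], fun t _ _ => ⟨by simp [LStep.vec], ?_⟩⟩
  simp [LStep.Passes, NodeTest.Holds, IsVertex, subtree?_nil]

theorem StepSpec.name (l m : Label) (a : Axis) :
    StepSpec l (.base a (.name m)) [] [] (decide (l = m)) := by
  refine ⟨by simp [LStep.size], fun t h _ => ⟨by simp [LStep.vec], ?_⟩⟩
  simp [LStep.Passes, NodeTest.Holds, HasLabel, subtree?_nil, h]

theorem StepSpec.filter {l s e v x c v' x' d} (h : StepSpec l s v x c)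
    (h' : FilterSpec l e v' x' d) : StepSpec l (.filter s e) (v ++ v') (x ++ x') (c && d) := by
  refine ⟨by simp [LStep.size, h.1, h'.1], fun t ht hv => ?_⟩
  rw [LStep.size, show (LStep.filter s e).vec = fun t => s.vec t ++ e.vec t from
    funext fun t => by rw [LStep.vec], orMap_append s.length_vec] at hv
  obtain ⟨h1, h2⟩ := List.append_inj hv (by rw [length_orMap s.length_vec, h.1])
  obtain ⟨h3, h4⟩ := h.2 t ht h1
  obtain ⟨h5, h6⟩ := h'.2 t ht h2
  exact ⟨by rw [LStep.vec, h3, h5], by rw [LStep.Passes, h4, h6, Bool.and_eq_true]⟩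

theorem FilterSpec.path {l p v x e} (h : PathSpec l p true v x e) :
    FilterSpec l (.path p) v x e := by
  refine ⟨by simp [FExpr.size, h.1], fun t ht hv => ?_⟩
  rw [FExpr.size, show (FExpr.path p).vec = p.vec fun _ => True from
    funext fun t => by rw [FExpr.vec]] at hv
  rw [FExpr.vec, FExpr.holds_path]
  exact h.2 _ t ht (by simp) hv

theorem FilterSpec.or {l p q v x c v' x' d} (h : PathSpec l p true v x c)
    (h' : PathSpec l q true v' x' d) :
    FilterSpec l (.or p q) (v ++ v') (x ++ x') (c || d) := by
  refine ⟨by simp [FExpr.size, h.1, h'.1], fun t ht hv => ?_⟩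
  rw [FExpr.size, show (FExpr.or p q).vec = fun t => p.vec (fun _ => True) t ++
    q.vec (fun _ => True) t from funext fun t => by rw [FExpr.vec],
    orMap_append (p.length_vec _)] at hv
  obtain ⟨h1, h2⟩ := List.append_inj hv (by rw [length_orMap (p.length_vec _), h.1])
  obtain ⟨h3, h4⟩ := h.2 _ t ht (by simp) h1
  obtain ⟨h5, h6⟩ := h'.2 _ t ht (by simp) h2
  exact ⟨by rw [FExpr.vec, h3, h5], by rw [FExpr.holds_or, h4, h6, Bool.or_eq_true]⟩

theorem PathSpec.step {l s v x c} (k b d : Bool) (h : StepSpec l s v x c) :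
    PathSpec l (.step s) k (b :: d :: v) ((c && k) :: s.axis.combine (c && k) b d :: x)
      (s.axis.combine (c && k) b d) := by
  classical
  refine ⟨by simp [LPath.size, h.1], fun K t ht hk hv => ?_⟩
  rw [LPath.size, show (LPath.step s).vec K = fun t => decide (s.Passes t ∧ K t) ::
    decide ((LPath.step s).Sat K t) :: s.vec t from
      funext fun t => by rw [LPath.vec], orMap_cons, orMap_cons] at hv
  simp only [List.cons.injEq] at hv
  obtain ⟨rfl, rfl, h1⟩ := hv
  obtain ⟨h3, h4⟩ := h.2 t ht h1
  have h5 : s.Passes t ∧ K t ↔ (c && k) = true := by rw [h4, hk, Bool.and_eq_true]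
  have h6 : (LPath.step s).Sat K t ↔ s.axis.combine (c && k)
      (t.children.any fun t => decide (s.Passes t ∧ K t))
      (t.children.any fun t => decide ((LPath.step s).Sat K t)) = true := by
    cases ha : s.axis with
    | self => rw [LPath.sat_step_self ha, h5, Axis.combine]
    | child => simp [LPath.sat_step_child ha, Axis.combine]
    | descendant =>
      rw [LPath.sat_step_descendant ha]
      simp [Axis.combine, and_or_left, exists_or]
  refine ⟨?_, h6⟩
  rw [LPath.vec, h3]
  congr 1
  · simp [h5]
  · congr 1
    simp only [h6, Bool.decide_eq_true]

theorem PathSpec.seq {l p q k v x e v' x' e'} (h : PathSpec l p e' v x e)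
    (h' : PathSpec l q k v' x' e') : PathSpec l (.seq p q) k (v ++ v') (x ++ x') e := by
  refine ⟨by simp [LPath.size, h.1, h'.1], fun K t ht hk hv => ?_⟩
  rw [LPath.size, show (LPath.seq p q).vec K = fun t => p.vec (q.Sat K) t ++ q.vec K t from
    funext fun t => by rw [LPath.vec], orMap_append (p.length_vec _)] at hv
  obtain ⟨h1, h2⟩ := List.append_inj hv (by rw [length_orMap (p.length_vec _), h.1])
  obtain ⟨h5, h6⟩ := h'.2 _ t ht hk h2
  obtain ⟨h3, h4⟩ := h.2 _ t ht h6 h1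
  exact ⟨by rw [LPath.vec, h3, h5], by rw [LPath.sat_seq, h4]⟩

theorem PathSpec.union {l p q k v x c v' x' d} (h : PathSpec l p k v x c)
    (h' : PathSpec l q k v' x' d) :
    PathSpec l (.union p q) k (v ++ v') (x ++ x') (c || d) := by
  refine ⟨by simp [LPath.size, h.1, h'.1], fun K t ht hk hv => ?_⟩
  rw [LPath.size, show (LPath.union p q).vec K = fun t => p.vec K t ++ q.vec K t from
    funext fun t => by rw [LPath.vec], orMap_append (p.length_vec _)] at hv
  obtain ⟨h1, h2⟩ := List.append_inj hv (by rw [length_orMap (p.length_vec _), h.1])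
  obtain ⟨h3, h4⟩ := h.2 _ t ht hk h1
  obtain ⟨h5, h6⟩ := h'.2 _ t ht hk h2
  exact ⟨by rw [LPath.vec, h3, h5], by rw [LPath.sat_union, h4, h6, Bool.or_eq_true]⟩

/-! ### Trees that obey the rules of a DTD -/

/-- Every vertex of the tree obeys the rules of the DTD. -/
def DTD.Conforms (d : DTD) (t : XTree) : Prop :=
  ∀ u s, t.subtree? u = some s →
    ∃ r, (s.label, r) ∈ d.rules ∧ s.children.map XTree.label ∈ r.matches'

theorem DTD.conforms_iff {d : DTD} {t : XTree} :
    d.Conforms t ↔ (∃ r, (t.label, r) ∈ d.rules ∧ t.children.map XTree.label ∈ r.matches') ∧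
      ∀ c ∈ t.children, d.Conforms c := by
  constructor
  · intro h
    refine ⟨h [] t t.subtree?_nil, fun c hc u s hs => ?_⟩
    obtain ⟨i, hi⟩ := List.getElem?_of_mem hc
    exact h (i :: u) s (subtree?_cons_eq_some.2 ⟨c, hi, hs⟩)
  · rintro ⟨h1, h2⟩ u s hs
    cases u with
    | nil =>
      rw [subtree?_nil] at hs
      obtain rfl := Option.some.inj hs
      exact h1
    | cons i u =>
      obtain ⟨c, hc, hs⟩ := subtree?_cons_eq_some.1 hs
      exact h2 c (List.mem_of_getElem? hc) u s hs

namespace Input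

variable (x : Input)

/-- The number of truth values that are kept for a tree. -/
def size : ℕ := x.p.size + x.q.size

/-- The truth values that are kept for a tree. -/
noncomputable def vec (t : XTree) : List Bool :=
  x.p.vec (fun _ => True) t ++ x.q.vec (fun _ => True) t

theorem length_vec (t : XTree) : (x.vec t).length = x.size := by
  simp [vec, size, LPath.length_vec]

theorem orMap_vec (l : List XTree) : orMap x.size x.vec l =
    orMap x.p.size (x.p.vec fun _ => True) l ++ orMap x.q.size (x.q.vec fun _ => True) l :=
  orMap_append (x.p.length_vec _) l

/-- Some list of trees that obey the DTD has its root labels in the language of `r`, and its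
vectors have disjunction `v`. -/
def Realizes (r : RegularExpression Label) (v : List Bool) : Prop :=
  ∃ ts : List XTree, (∀ t ∈ ts, x.dtd.Conforms t) ∧ ts.map XTree.label ∈ r.matches' ∧
    v = orMap x.size x.vec ts

variable {x}

theorem Realizes.comp {r s u v} (h : x.Realizes r u) (h' : x.Realizes s v) :
    x.Realizes (.comp r s) (List.zipWith or u v) := by
  obtain ⟨ts, h1, h2, rfl⟩ := h
  obtain ⟨ts', h3, h4, rfl⟩ := h'
  refine ⟨ts ++ ts', ?_, ?_, (orMap_list_append x.length_vec ts ts').symm⟩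
  · intro t ht
    exact (List.mem_append.1 ht).elim (h1 t) (h3 t)
  · rw [List.map_append]
    exact Language.append_mem_mul h2 h4

theorem Realizes.star {r u v} (h : x.Realizes r u) (h' : x.Realizes (.star r) v) :
    x.Realizes (.star r) (List.zipWith or u v) := by
  obtain ⟨ts, h1, h2, h3⟩ := h.comp h'
  refine ⟨ts, h1, ?_, h3⟩
  obtain ⟨a, ha, b, hb, h4⟩ := Language.mem_mul.1 h2
  obtain ⟨L, rfl, hL⟩ := Language.mem_kstar.1 hb
  refine Language.mem_kstar.2 ⟨a :: L, by simpa using h4.symm, fun y hy => ?_⟩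
  rcases List.mem_cons.1 hy with rfl | hy
  exacts [ha, hL y hy]

theorem Realizes.node {l r v₁ v₂ x₁ x₂ e₁ e₂} (hl : (l, r) ∈ x.dtd.rules)
    (h : x.Realizes r (v₁ ++ v₂)) (h₁ : PathSpec l x.p true v₁ x₁ e₁)
    (h₂ : PathSpec l x.q true v₂ x₂ e₂) :
    ∃ t, x.dtd.Conforms t ∧ t.label = l ∧ x.vec t = x₁ ++ x₂ ∧
      (x.p.Models t ↔ e₁ = true) ∧ (x.q.Models t ↔ e₂ = true) := by
  obtain ⟨ts, h3, h4, h5⟩ := h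
  rw [orMap_vec] at h5
  obtain ⟨h6, h7⟩ := List.append_inj h5 (by rw [h₁.1, length_orMap (x.p.length_vec _)])
  obtain ⟨h8, h9⟩ := h₁.2 (fun _ => True) (.node l ts) rfl (by simp) h6.symm
  obtain ⟨ha, hb⟩ := h₂.2 (fun _ => True) (.node l ts) rfl (by simp) h7.symm
  refine ⟨.node l ts, DTD.conforms_iff.2 ⟨⟨r, hl, h4⟩, h3⟩, rfl, ?_, ?_, ?_⟩
  · rw [vec, h8, ha]
  · rw [← h9, LPath.sat_true, LPath.Models]
  · rw [← hb, LPath.sat_true, LPath.Models]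

theorem Realizes.char {t : XTree} (h : x.dtd.Conforms t) :
    x.Realizes (.char t.label) (x.vec t) :=
  ⟨[t], by simpa using h, by rfl, (orMap_singleton x.length_vec t).symm⟩

end Input

end XPath

namespace XPath

open Saturation

/-! ### A Horn program for the complement of containment -/

/-- The predicates of the program. -/
inductive Pred : Type
  | input | label | labelEq | zeros | disj
  | step | filter | path
  | regex | rules | start | rule | type | refuted
  deriving DecidableEq

instance : Fintype Pred :=
  Fintype.ofList [.input, .label, .labelEq, .zeros, .disj, .step, .filter, .path, .regex, .rules,
    .start, .rule, .type, .refuted] (by intro p; cases p <;> simp)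

/-- The code of an axis. -/
def Axis.tok : Axis → Tok
  | .self => .axSelf
  | .child => .axChild
  | .descendant => .axDescendant

instance : Fintype Axis where
  elems := ⟨([.self, .child, .descendant] : List Axis), by simp⟩
  complete a := by cases a <;> simp

/-- The names of the clauses. -/
inductive Rule : Type
  | labelEnd | labelBit (b : Bool)
  | eqEnd | eqLeft (b : Bool) | eqRight (b : Bool) | eqBit (b c : Bool)
  | zerosNil | zerosCons
  | disjNil | disjCons (b c : Bool)
  | stepWildcard (a : Axis) | stepName (a : Axis) | stepFilter (b c : Bool)
  | filterPath | filterOr (b c : Bool)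
  | pathStep (a : Axis) (c k b d : Bool) | pathSeq | pathUnion (b c : Bool)
  | regexZero | regexEpsilon | regexChar | regexPlus | regexComp | regexStar
  | rulesStart | startLabel | rulesCons | ruleHead
  | typeEpsilon | typePlusLeft | typePlusRight | typeComp | typeStarNil | typeStarCons | typeChar
  | refute
  deriving Fintype

open Item in
/-- The clauses of the program. -/
def Rule.clause : Rule → Clause Tok Pred
  | labelEnd => ⟨⟨.label, [[letter .endLabel]]⟩, []⟩
  | labelBit b => ⟨⟨.label, [[letter (.bit b), var 0]]⟩, [⟨.label, [[var 0]]⟩]⟩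
  | eqEnd => ⟨⟨.labelEq, [[letter .endLabel], [letter .endLabel], [letter (.bit true)]]⟩, []⟩
  | eqLeft b =>
    ⟨⟨.labelEq, [[letter .endLabel], [letter (.bit b), var 0], [letter (.bit false)]]⟩,
      [⟨.label, [[var 0]]⟩]⟩
  | eqRight b =>
    ⟨⟨.labelEq, [[letter (.bit b), var 0], [letter .endLabel], [letter (.bit false)]]⟩,
      [⟨.label, [[var 0]]⟩]⟩
  | eqBit b c =>
    ⟨⟨.labelEq, [[letter (.bit b), var 0], [letter (.bit c), var 1],
        [if b = c then var 2 else letter (.bit false)]]⟩,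
      [⟨.labelEq, [[var 0], [var 1], [var 2]]⟩]⟩
  | zerosNil => ⟨⟨.zeros, [[]]⟩, []⟩
  | zerosCons => ⟨⟨.zeros, [[letter (.bit false), var 0]]⟩, [⟨.zeros, [[var 0]]⟩]⟩
  | disjNil => ⟨⟨.disj, [[], [], []]⟩, []⟩
  | disjCons b c =>
    ⟨⟨.disj, [[letter (.bit b), var 0], [letter (.bit c), var 1],
        [letter (.bit (b || c)), var 2]]⟩,
      [⟨.disj, [[var 0], [var 1], [var 2]]⟩]⟩
  | stepWildcard a =>
    ⟨⟨.step, [[var 0], [letter .base, letter a.tok, letter .wildcard], [letter a.tok], [], [],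
        [letter (.bit true)]]⟩,
      [⟨.label, [[var 0]]⟩]⟩
  | stepName a =>
    ⟨⟨.step, [[var 0], [letter .base, letter a.tok, letter .name, var 1], [letter a.tok], [], [],
        [var 2]]⟩,
      [⟨.labelEq, [[var 0], [var 1], [var 2]]⟩]⟩
  | stepFilter b c =>
    ⟨⟨.step, [[var 0], [letter .filter, var 1, var 2], [var 3], [var 4, var 5], [var 6, var 7],
        [letter (.bit (b && c))]]⟩,
      [⟨.step, [[var 0], [var 1], [var 3], [var 4], [var 6], [letter (.bit b)]]⟩,
        ⟨.filter, [[var 0], [var 2], [var 5], [var 7], [letter (.bit c)]]⟩]⟩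
  | filterPath =>
    ⟨⟨.filter, [[var 0], [letter .filterPath, var 1], [var 2], [var 3], [var 4]]⟩,
      [⟨.path, [[var 0], [var 1], [letter (.bit true)], [var 2], [var 3], [var 4]]⟩]⟩
  | filterOr b c =>
    ⟨⟨.filter, [[var 0], [letter .filterOr, var 1, var 2], [var 3, var 4], [var 5, var 6],
        [letter (.bit (b || c))]]⟩,
      [⟨.path, [[var 0], [var 1], [letter (.bit true)], [var 3], [var 5], [letter (.bit b)]]⟩,
        ⟨.path, [[var 0], [var 2], [letter (.bit true)], [var 4], [var 6], [letter (.bit c)]]⟩]⟩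
  | pathStep a c k b d =>
    ⟨⟨.path, [[var 0], [letter .step, var 1], [letter (.bit k)],
        [letter (.bit b), letter (.bit d), var 2],
        [letter (.bit (c && k)), letter (.bit (a.combine (c && k) b d)), var 3],
        [letter (.bit (a.combine (c && k) b d))]]⟩,
      [⟨.step, [[var 0], [var 1], [letter a.tok], [var 2], [var 3], [letter (.bit c)]]⟩]⟩
  | pathSeq =>
    ⟨⟨.path, [[var 0], [letter .seq, var 1, var 2], [var 3], [var 4, var 5], [var 6, var 7],
        [var 8]]⟩,
      [⟨.path, [[var 0], [var 2], [var 3], [var 5], [var 7], [var 9]]⟩,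
        ⟨.path, [[var 0], [var 1], [var 9], [var 4], [var 6], [var 8]]⟩]⟩
  | pathUnion b c =>
    ⟨⟨.path, [[var 0], [letter .union, var 1, var 2], [var 3], [var 4, var 5], [var 6, var 7],
        [letter (.bit (b || c))]]⟩,
      [⟨.path, [[var 0], [var 1], [var 3], [var 4], [var 6], [letter (.bit b)]]⟩,
        ⟨.path, [[var 0], [var 2], [var 3], [var 5], [var 7], [letter (.bit c)]]⟩]⟩
  | regexZero => ⟨⟨.regex, [[letter .rzero]]⟩, []⟩
  | regexEpsilon => ⟨⟨.regex, [[letter .repsilon]]⟩, []⟩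
  | regexChar => ⟨⟨.regex, [[letter .rchar, var 0]]⟩, [⟨.label, [[var 0]]⟩]⟩
  | regexPlus =>
    ⟨⟨.regex, [[letter .rplus, var 0, var 1]]⟩, [⟨.regex, [[var 0]]⟩, ⟨.regex, [[var 1]]⟩]⟩
  | regexComp =>
    ⟨⟨.regex, [[letter .rcomp, var 0, var 1]]⟩, [⟨.regex, [[var 0]]⟩, ⟨.regex, [[var 1]]⟩]⟩
  | regexStar => ⟨⟨.regex, [[letter .rstar, var 0]]⟩, [⟨.regex, [[var 0]]⟩]⟩
  | rulesStart => ⟨⟨.rules, [[var 1]]⟩, [⟨.input, [[var 0, var 1]]⟩, ⟨.label, [[var 0]]⟩]⟩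
  | startLabel => ⟨⟨.start, [[var 0]]⟩, [⟨.input, [[var 0, var 1]]⟩, ⟨.label, [[var 0]]⟩]⟩
  | rulesCons =>
    ⟨⟨.rules, [[var 2]]⟩, [⟨.rules, [[letter .rule, var 0, var 1, var 2]]⟩,
      ⟨.label, [[var 0]]⟩, ⟨.regex, [[var 1]]⟩]⟩
  | ruleHead =>
    ⟨⟨.rule, [[var 0], [var 1]]⟩, [⟨.rules, [[letter .rule, var 0, var 1, var 2]]⟩,
      ⟨.label, [[var 0]]⟩, ⟨.regex, [[var 1]]⟩]⟩
  | typeEpsilon => ⟨⟨.type, [[letter .repsilon], [var 0]]⟩, [⟨.zeros, [[var 0]]⟩]⟩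
  | typePlusLeft =>
    ⟨⟨.type, [[letter .rplus, var 0, var 1], [var 2]]⟩,
      [⟨.type, [[var 0], [var 2]]⟩, ⟨.regex, [[var 1]]⟩]⟩
  | typePlusRight =>
    ⟨⟨.type, [[letter .rplus, var 0, var 1], [var 2]]⟩,
      [⟨.regex, [[var 0]]⟩, ⟨.type, [[var 1], [var 2]]⟩]⟩
  | typeComp =>
    ⟨⟨.type, [[letter .rcomp, var 0, var 1], [var 4]]⟩,
      [⟨.type, [[var 0], [var 2]]⟩, ⟨.type, [[var 1], [var 3]]⟩,
        ⟨.disj, [[var 2], [var 3], [var 4]]⟩]⟩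
  | typeStarNil =>
    ⟨⟨.type, [[letter .rstar, var 0], [var 1]]⟩, [⟨.regex, [[var 0]]⟩, ⟨.zeros, [[var 1]]⟩]⟩
  | typeStarCons =>
    ⟨⟨.type, [[letter .rstar, var 0], [var 3]]⟩,
      [⟨.type, [[var 0], [var 1]]⟩, ⟨.type, [[letter .rstar, var 0], [var 2]]⟩,
        ⟨.disj, [[var 1], [var 2], [var 3]]⟩]⟩
  | typeChar =>
    ⟨⟨.type, [[letter .rchar, var 0], [var 7, var 8]]⟩,
      [⟨.rule, [[var 0], [var 1]]⟩, ⟨.type, [[var 1], [var 2, var 3]]⟩,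
        ⟨.rules, [[letter .endRules, var 4, var 5]]⟩,
        ⟨.path, [[var 0], [var 4], [letter (.bit true)], [var 2], [var 7], [var 6]]⟩,
        ⟨.path, [[var 0], [var 5], [letter (.bit true)], [var 3], [var 8], [var 9]]⟩]⟩
  | refute =>
    ⟨⟨.refuted, []⟩,
      [⟨.start, [[var 0]]⟩, ⟨.rule, [[var 0], [var 1]]⟩, ⟨.type, [[var 1], [var 2, var 3]]⟩,
        ⟨.rules, [[letter .endRules, var 4, var 5]]⟩,
        ⟨.path, [[var 0], [var 4], [letter (.bit true)], [var 2], [var 7], [letter (.bit true)]]⟩,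
        ⟨.path, [[var 0], [var 5], [letter (.bit true)], [var 3], [var 8],
          [letter (.bit false)]]⟩]⟩

/-- The program. -/
noncomputable def clauses : List (Clause Tok Pred) := Finset.univ.toList.map Rule.clause

theorem Rule.clause_mem (r : Rule) : r.clause ∈ clauses :=
  List.mem_map_of_mem (by simp)

theorem clauses_varsBelow : clauses.all (Clause.VarsBelow 10) := by
  rw [List.all_eq_true]
  intro r hr
  obtain ⟨r, -, rfl⟩ := List.mem_map.1 hr
  cases r <;> simp [Rule.clause, Clause.VarsBelow, Atom.VarsBelow]
  split <;> grind

/-! ### Soundness of the program -/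

/-- The code of a list of truth values. -/
abbrev encBits (v : List Bool) : List Tok := v.map Tok.bit

/-- The facts that are true for an input. -/
def Valid (x : Input) (F : Fact Tok Pred) : Prop :=
  match F.pred with
  | .input => F.args = [encInput x]
  | .label => ∃ l, F.args = [encLabel l]
  | .labelEq => ∃ l m, F.args = [encLabel l, encLabel m, [.bit (decide (l = m))]]
  | .zeros => ∃ n, F.args = [encBits (List.replicate n false)]
  | .disj => ∃ u v, u.length = v.length ∧
      F.args = [encBits u, encBits v, encBits (List.zipWith or u v)]
  | .step => ∃ l s v y c, StepSpec l s v y c ∧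
      F.args = [encLabel l, encLStep s, [s.axis.tok], encBits v, encBits y, [.bit c]]
  | .filter => ∃ l e v y c, FilterSpec l e v y c ∧
      F.args = [encLabel l, encFExpr e, encBits v, encBits y, [.bit c]]
  | .path => ∃ l p k v y e, PathSpec l p k v y e ∧
      F.args = [encLabel l, encLPath p, [.bit k], encBits v, encBits y, [.bit e]]
  | .regex => ∃ r, F.args = [encRegex r]
  | .rules => ∃ l, (∀ e ∈ l, e ∈ x.dtd.rules) ∧
      F.args = [encRules l ++ encLPath x.p ++ encLPath x.q]
  | .start => F.args = [encLabel x.dtd.start]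
  | .rule => ∃ l r, (l, r) ∈ x.dtd.rules ∧ F.args = [encLabel l, encRegex r]
  | .type => ∃ r v, (v.length = x.size → x.Realizes r v) ∧ F.args = [encRegex r, encBits v]
  | .refuted => ¬ ContainedRel x.dtd x.p x.q

theorem encLabel_injective {l m : Label} (h : encLabel l = encLabel m) : l = m :=
  (encLabel_append_inj l m [] [] (by simp [h])).1

theorem encLPath_injective {p q : LPath} (h : encLPath p = encLPath q) : p = q :=
  (encLPath_append_inj p q [] [] (by simp [h])).1

theorem encRegex_injective {p q : RegularExpression Label} (h : encRegex p = encRegex q) : p = q :=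
  (encRegex_append_inj p q [] [] (by simp [h])).1

theorem encBits_injective {u v : List Bool} (h : encBits u = encBits v) : u = v :=
  List.map_injective_iff.2 (fun _ _ h => Tok.bit.inj h) h

theorem Axis.tok_injective {a b : Axis} (h : a.tok = b.tok) : a = b := by
  cases a <;> cases b <;> simp_all [Axis.tok]

theorem encAxis_eq (a : Axis) : encAxis a = [a.tok] := by cases a <;> rfl

theorem valid_clause (x : Input) (σ : ℕ → List Tok) (r : Rule)
    (h : ∀ p ∈ r.clause.prems, Valid x (p.inst σ)) : Valid x (r.clause.concl.inst σ) := by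
  cases r <;> simp only [Rule.clause, Atom.inst, Item.inst, Valid, List.map_cons, List.map_nil,
    List.flatMap_cons, List.flatMap_nil, List.append_nil, List.cons_append, List.nil_append,
    List.mem_cons, List.not_mem_nil, forall_eq_or_imp, forall_eq, or_false, IsEmpty.forall_iff,
    implies_true, List.cons.injEq, and_true, Tok.bit.injEq] at h ⊢
  case labelEnd => exact ⟨[], rfl⟩
  case labelBit b =>
    obtain ⟨l, hl⟩ := h
    exact ⟨b :: l, by simp [hl, encLabel]⟩
  case eqEnd => exact ⟨[], [], rfl, rfl, rfl⟩
  case eqLeft b =>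
    obtain ⟨l, hl⟩ := h
    exact ⟨[], b :: l, rfl, by simp [hl, encLabel], by simp⟩
  case eqRight b =>
    obtain ⟨l, hl⟩ := h
    exact ⟨b :: l, [], by simp [hl, encLabel], rfl, by simp⟩
  case eqBit b c =>
    obtain ⟨l, m, hl, hm, h⟩ := h
    refine ⟨b :: l, c :: m, by simp [hl, encLabel], by simp [hm, encLabel], ?_⟩
    by_cases hb : b = c <;> simp [hb, h]
  case zerosNil => exact ⟨0, rfl⟩
  case zerosCons =>
    obtain ⟨n, h⟩ := h
    exact ⟨n + 1, by simp [h, List.replicate_succ]⟩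
  case disjNil => exact ⟨[], [], rfl, rfl, rfl, rfl⟩
  case disjCons b c =>
    obtain ⟨u, v, h1, h2, h3, h4⟩ := h
    exact ⟨b :: u, c :: v, by simp [h1], by simp [h2], by simp [h3], by simp [h4]⟩
  case stepWildcard a =>
    obtain ⟨l, hl⟩ := h
    exact ⟨l, _, _, _, _, .wildcard l a, hl, by simp [encLStep, encAxis_eq, encNodeTest], rfl, rfl,
      rfl, rfl⟩
  case stepName a =>
    obtain ⟨l, m, hl, hm, h⟩ := h
    exact ⟨l, _, _, _, _, .name l m a, hl, by simp [encLStep, encAxis_eq, encNodeTest, hm], rfl,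
      rfl, rfl, h⟩
  case stepFilter b c =>
    obtain ⟨⟨l, s, v, y, _, h1, hl, hs, ha, hv, hy, rfl⟩, l', e, v', y', _, h2, hl', he, hv', hy',
      rfl⟩ := h
    obtain rfl := encLabel_injective (hl.symm.trans hl')
    exact ⟨l, _, _, _, _, h1.filter h2, hl, by simp [encLStep, hs, he], ha, by simp [hv, hv'],
      by simp [hy, hy'], rfl⟩
  case filterPath =>
    obtain ⟨l, p, _, v, y, e, h1, hl, hp, rfl, hv, hy, he⟩ := h
    exact ⟨l, _, _, _, _, FilterSpec.path h1, hl, by simp [encFExpr, hp], hv, hy, he⟩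
  case filterOr b c =>
    obtain ⟨⟨l, p, _, v, y, _, h1, hl, hp, rfl, hv, hy, rfl⟩, l', q, _, v', y', _, h2, hl', hq, rfl,
      hv', hy', rfl⟩ := h
    obtain rfl := encLabel_injective (hl.symm.trans hl')
    exact ⟨l, _, _, _, _, FilterSpec.or h1 h2, hl, by simp [encFExpr, hp, hq], by simp [hv, hv'],
      by simp [hy, hy'], rfl⟩
  case pathStep a c k b d =>
    obtain ⟨l, s, v, y, _, h1, hl, hs, ha, hv, hy, rfl⟩ := h
    obtain rfl := Axis.tok_injective ha
    exact ⟨l, _, _, _, _, _, PathSpec.step k b d h1, hl, by simp [encLPath, hs], rfl, by simp [hv],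
      by simp [hy], rfl⟩
  case pathSeq =>
    obtain ⟨⟨l, q, k, v, y, e, h1, hl, hq, hk, hv, hy, he⟩, l', p, k', v', y', e', h2, hl', hp, hk',
      hv', hy', he'⟩ := h
    obtain rfl := encLabel_injective (hl.symm.trans hl')
    obtain rfl : e = k' := by simpa [hk'] using he.symm
    exact ⟨l, _, _, _, _, _, h2.seq h1, hl, by simp [encLPath, hp, hq], hk, by simp [hv, hv'],
      by simp [hy, hy'], he'⟩
  case pathUnion b c =>
    obtain ⟨⟨l, p, k, v, y, _, h1, hl, hp, hk, hv, hy, rfl⟩, l', q, k', v', y', _, h2, hl', hq, hk',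
      hv', hy', rfl⟩ := h
    obtain rfl := encLabel_injective (hl.symm.trans hl')
    obtain rfl : k = k' := by simpa [hk'] using hk.symm
    exact ⟨l, _, _, _, _, _, h1.union h2, hl, by simp [encLPath, hp, hq], hk, by simp [hv, hv'],
      by simp [hy, hy'], rfl⟩
  case regexZero => exact ⟨.zero, rfl⟩
  case regexEpsilon => exact ⟨.epsilon, rfl⟩
  case regexChar =>
    obtain ⟨l, hl⟩ := h
    exact ⟨.char l, by simp [encRegex, hl]⟩
  case regexPlus =>
    obtain ⟨⟨r, hr⟩, s, hs⟩ := h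
    exact ⟨.plus r s, by simp [encRegex, hr, hs]⟩
  case regexComp =>
    obtain ⟨⟨r, hr⟩, s, hs⟩ := h
    exact ⟨.comp r s, by simp [encRegex, hr, hs]⟩
  case regexStar =>
    obtain ⟨r, hr⟩ := h
    exact ⟨.star r, by simp [encRegex, hr]⟩
  case rulesStart =>
    obtain ⟨h, l, hl⟩ := h
    rw [hl, encInput, encDTD, List.append_assoc, List.append_assoc] at h
    exact ⟨x.dtd.rules, fun _ => id, by simp [(encLabel_append_inj _ _ _ _ h).2]⟩
  case startLabel =>
    obtain ⟨h, l, hl⟩ := h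
    rw [hl, encInput, encDTD, List.append_assoc, List.append_assoc] at h
    rw [hl, (encLabel_append_inj _ _ _ _ h).1]
  case rulesCons =>
    obtain ⟨⟨m, hm, h⟩, ⟨l, hl⟩, r, hr⟩ := h
    rw [hl, hr] at h
    rcases m with _ | ⟨e, m⟩ <;> simp [encRules] at h
    obtain ⟨-, h⟩ := encLabel_append_inj _ _ _ _ h
    obtain ⟨-, h⟩ := encRegex_append_inj _ _ _ _ h
    exact ⟨m, fun e he => hm e (List.mem_cons_of_mem _ he), by simp [h]⟩
  case ruleHead =>
    obtain ⟨⟨m, hm, h⟩, ⟨l, hl⟩, r, hr⟩ := h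
    rw [hl, hr] at h
    rcases m with _ | ⟨e, m⟩ <;> simp [encRules] at h
    obtain ⟨rfl, h'⟩ := encLabel_append_inj _ _ _ _ h
    obtain ⟨rfl, -⟩ := encRegex_append_inj _ _ _ _ h'
    exact ⟨_, _, hm e List.mem_cons_self, hl, hr⟩
  case typeEpsilon =>
    obtain ⟨n, h⟩ := h
    refine ⟨.epsilon, _, fun hn => ⟨[], by simp, rfl, ?_⟩, rfl, h⟩
    rw [List.length_replicate] at hn
    rw [hn]
    rfl
  case typePlusLeft =>
    obtain ⟨⟨r, v, h, hr, hv⟩, s, hs⟩ := h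
    refine ⟨.plus r s, v, fun hn => ?_, by simp [encRegex, hr, hs], hv⟩
    obtain ⟨ts, h1, h2, h3⟩ := h hn
    exact ⟨ts, h1, Or.inl h2, h3⟩
  case typePlusRight =>
    obtain ⟨⟨r, hr⟩, s, v, h, hs, hv⟩ := h
    refine ⟨.plus r s, v, fun hn => ?_, by simp [encRegex, hr, hs], hv⟩
    obtain ⟨ts, h1, h2, h3⟩ := h hn
    exact ⟨ts, h1, Or.inr h2, h3⟩
  case typeComp =>
    obtain ⟨⟨r, v, h1, hr, hv⟩, ⟨s, w, h2, hs, hw⟩, v', w', h3, hv', hw', h⟩ := h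
    obtain rfl := encBits_injective (hv.symm.trans hv')
    obtain rfl := encBits_injective (hw.symm.trans hw')
    refine ⟨.comp r s, _, fun hn => ?_, by simp [encRegex, hr, hs], h⟩
    rw [List.length_zipWith, h3, min_self] at hn
    exact (h1 (h3.trans hn)).comp (h2 hn)
  case typeStarNil =>
    obtain ⟨⟨r, hr⟩, n, h⟩ := h
    refine ⟨.star r, _, fun hn => ⟨[], by simp, Language.nil_mem_kstar _, ?_⟩,
      by simp [encRegex, hr], h⟩
    rw [List.length_replicate] at hn
    rw [hn]
    rfl
  case typeStarCons =>
    obtain ⟨⟨r, v, h1, hr, hv⟩, ⟨s, w, h2, hs, hw⟩, v', w', h3, hv', hw', h⟩ := h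
    obtain rfl := encBits_injective (hv.symm.trans hv')
    obtain rfl := encBits_injective (hw.symm.trans hw')
    rw [hr, show Tok.rstar :: encRegex r = encRegex (.star r) by rw [encRegex]] at hs ⊢
    obtain rfl := encRegex_injective hs
    refine ⟨.star r, _, fun hn => ?_, rfl, h⟩
    rw [List.length_zipWith, h3, min_self] at hn
    exact (h1 (h3.trans hn)).star (h2 hn)
  case typeChar =>
    obtain ⟨⟨l, r, hlr, hl, hr⟩, ⟨r', v, h, hr', hv⟩, ⟨m, -, hm⟩,
      ⟨l₁, p, _, v₁, y₁, e₁, h1, hl₁, hp, rfl, hv₁, hy₁, he₁⟩,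
      l₂, q, _, v₂, y₂, e₂, h2, hl₂, hq, rfl, hv₂, hy₂, he₂⟩ := h
    obtain rfl := encLabel_injective (hl.symm.trans hl₁)
    obtain rfl := encLabel_injective (hl.symm.trans hl₂)
    obtain rfl := encRegex_injective (hr.symm.trans hr')
    rcases m with _ | ⟨e, m⟩ <;> simp [encRules] at hm
    rw [hp, hq] at hm
    obtain ⟨rfl, hm'⟩ := encLPath_append_inj _ _ _ _ hm
    obtain rfl := encLPath_injective hm'
    obtain rfl : v = v₁ ++ v₂ := encBits_injective (by simp [← hv, hv₁, hv₂])
    obtain ⟨t, ht, rfl, hx, -⟩ :=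
      (h (by rw [List.length_append, h1.1, h2.1, Input.size])).node hlr h1 h2
    exact ⟨.char t.label, x.vec t, fun _ => .char ht, by simp [encRegex, hl],
      by simp [hx, hy₁, hy₂]⟩
  case refute =>
    obtain ⟨h0, ⟨l, r, hlr, hl, hr⟩, ⟨r', v, h, hr', hv⟩, ⟨m, -, hm⟩,
      ⟨l₁, p, _, v₁, y₁, _, h1, hl₁, hp, rfl, hv₁, hy₁, rfl⟩,
      l₂, q, _, v₂, y₂, _, h2, hl₂, hq, rfl, hv₂, hy₂, rfl⟩ := h
    obtain rfl := encLabel_injective (hl.symm.trans hl₁)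
    obtain rfl := encLabel_injective (hl.symm.trans hl₂)
    obtain rfl := encLabel_injective (hl.symm.trans h0)
    obtain rfl := encRegex_injective (hr.symm.trans hr')
    rcases m with _ | ⟨e, m⟩ <;> simp [encRules] at hm
    rw [hp, hq] at hm
    obtain ⟨rfl, hm'⟩ := encLPath_append_inj _ _ _ _ hm
    obtain rfl := encLPath_injective hm'
    obtain rfl : v = v₁ ++ v₂ := encBits_injective (by simp [← hv, hv₁, hv₂])
    obtain ⟨t, ht, h3, -, h4, h5⟩ :=
      (h (by rw [List.length_append, h1.1, h2.1, Input.size])).node hlr h1 h2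
    intro hc
    exact Bool.false_ne_true (h5.1 (hc t ⟨h3, ht⟩ (h4.2 rfl)))

theorem closed_valid (x : Input) : Closed clauses {F | Valid x F} := by
  intro r hr σ h
  obtain ⟨r, -, rfl⟩ := List.mem_map.1 hr
  exact valid_clause x σ r h

end XPath

namespace XPath

open Saturation

/-! ### Completeness of the program -/

/-- Derivability from an input. -/
abbrev Derivable (x : Input) (q : Pred) (args : List (List Tok)) : Prop :=
  Derives clauses .input (encInput x) ⟨q, args⟩

section Complete

variable {x : Input}

theorem Derivable.valid {q args} (h : Derivable x q args) : Valid x ⟨q, args⟩ := by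
  have key : ∀ F, Derives clauses .input (encInput x) F → Valid x F := by
    intro F h
    induction h with
    | input => rfl
    | clause r hr σ _ _ ih => exact closed_valid x r hr σ ih
  exact key _ h

theorem derives_clause (r : Rule) (vs : List (List Tok))
    (hvs : ∀ v ∈ vs, v.length ≤ (encInput x).length)
    (h : ∀ p ∈ r.clause.prems,
      Derives clauses .input (encInput x) (p.inst fun i => vs.getD i [])) :
    Derives clauses .input (encInput x) (r.clause.concl.inst fun i => vs.getD i []) := by
  refine .clause _ r.clause_mem _ (fun i => ?_) h
  rw [List.getD_eq_getElem?_getD]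
  by_cases hi : i < vs.length
  · simpa [hi] using hvs _ (List.getElem_mem hi)
  · simp [not_lt.1 hi]

theorem derivable_label (l : Label) (hl : (encLabel l).length ≤ (encInput x).length) :
    Derivable x .label [encLabel l] := by
  induction l with
  | nil => simpa [Rule.clause, Atom.inst, Item.inst, encLabel] using
      derives_clause (x := x) .labelEnd [] (by simp) (by simp [Rule.clause])
  | cons b l ih =>
    have h1 : (encLabel l).length ≤ (encInput x).length := by
      simp [encLabel] at hl ⊢; omega
    simpa [Rule.clause, Atom.inst, Item.inst, encLabel] using
      derives_clause (x := x) (.labelBit b) [encLabel l] (by simpa using h1)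
        (by simpa [Rule.clause, Atom.inst, Item.inst] using ih h1)

theorem derivable_labelEq (l m : Label) (hl : (encLabel l).length ≤ (encInput x).length)
    (hm : (encLabel m).length ≤ (encInput x).length) :
    Derivable x .labelEq [encLabel l, encLabel m, [.bit (decide (l = m))]] := by
  have tail : ∀ (b : Bool) (l : Label), (encLabel (b :: l)).length ≤ (encInput x).length →
      (encLabel l).length ≤ (encInput x).length := by
    intro b l h
    simp [encLabel] at h ⊢; omega
  induction l generalizing m with
  | nil =>
    cases m with
    | nil => simpa [Rule.clause, Atom.inst, Item.inst, encLabel] using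
        derives_clause (x := x) .eqEnd [] (by simp) (by simp [Rule.clause])
    | cons c m =>
      simpa [Rule.clause, Atom.inst, Item.inst, encLabel] using
        derives_clause (x := x) (.eqLeft c) [encLabel m] (by simpa using tail _ _ hm)
          (by simpa [Rule.clause, Atom.inst, Item.inst] using derivable_label m (tail _ _ hm))
  | cons b l ih =>
    cases m with
    | nil =>
      simpa [Rule.clause, Atom.inst, Item.inst, encLabel] using
        derives_clause (x := x) (.eqRight b) [encLabel l] (by simpa using tail _ _ hl)
          (by simpa [Rule.clause, Atom.inst, Item.inst] using derivable_label l (tail _ _ hl))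
    | cons c m =>
      have h1 := derives_clause (x := x) (.eqBit b c)
        [encLabel l, encLabel m, [.bit (decide (l = m))]]
        (by simp [tail _ _ hl, tail _ _ hm]; have := tail _ _ hl; simp [encLabel] at this; omega)
        (by simpa [Rule.clause, Atom.inst, Item.inst] using ih m (tail _ _ hl) (tail _ _ hm))
      by_cases hb : b = c
      · simpa [Rule.clause, Atom.inst, Item.inst, encLabel, hb] using h1
      · simpa [Rule.clause, Atom.inst, Item.inst, encLabel, hb] using h1

theorem derivable_zeros (n : ℕ) (hn : n ≤ (encInput x).length) :
    Derivable x .zeros [encBits (List.replicate n false)] := by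
  induction n with
  | zero => simpa [Rule.clause, Atom.inst, Item.inst] using
      derives_clause (x := x) .zerosNil [] (by simp) (by simp [Rule.clause])
  | succ n ih =>
    simpa [Rule.clause, Atom.inst, Item.inst, List.replicate_succ] using
      derives_clause (x := x) .zerosCons [encBits (List.replicate n false)]
        (by simp; omega) (by simpa [Rule.clause, Atom.inst, Item.inst] using ih (by omega))

theorem derivable_disj (u v : List Bool) (h : u.length = v.length)
    (hu : u.length ≤ (encInput x).length) :
    Derivable x .disj [encBits u, encBits v, encBits (List.zipWith or u v)] := by
  induction u generalizing v with
  | nil =>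
    obtain rfl : v = [] := List.length_eq_zero_iff.1 h.symm
    simpa [Rule.clause, Atom.inst, Item.inst] using
      derives_clause (x := x) .disjNil [] (by simp) (by simp [Rule.clause])
  | cons b u ih =>
    obtain _ | ⟨c, v⟩ := v
    · simp at h
    · simp only [List.length_cons, Nat.add_right_cancel_iff] at h hu
      simpa [Rule.clause, Atom.inst, Item.inst] using
        derives_clause (x := x) (.disjCons b c)
          [encBits u, encBits v, encBits (List.zipWith or u v)] (by simp [← h]; omega)
          (by simpa [Rule.clause, Atom.inst, Item.inst] using ih v h (by omega))

theorem exists_append_of_length_eq {v : List Bool} {m n : ℕ} (h : v.length = m + n) :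
    ∃ u w, v = u ++ w ∧ u.length = m ∧ w.length = n :=
  ⟨v.take m, v.drop m, by simp, by simp [h], by simp [h]⟩

mutual

theorem derivable_path {l : Label} (hl : (encLabel l).length ≤ (encInput x).length) :
    ∀ (p : LPath), (encLPath p).length ≤ (encInput x).length → ∀ (k : Bool) (v : List Bool),
      v.length = p.size → ∃ y e, y.length = p.size ∧ Derivable x .path
        [encLabel l, encLPath p, [.bit k], encBits v, encBits y, [.bit e]]
  | .step s, hp, k, v, hv => by
    have hs := s.size_le
    simp only [encLPath, List.length_cons, LPath.size] at hp hv ⊢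
    obtain _ | ⟨b, _ | ⟨d, v⟩⟩ := v
    · simp at hv
    · simp at hv
    simp only [List.length_cons, Nat.add_right_cancel_iff] at hv
    obtain ⟨y, c, hy, h⟩ := derivable_step hl s (by omega) v hv
    refine ⟨(c && k) :: s.axis.combine (c && k) b d :: y, s.axis.combine (c && k) b d,
      by simp [hy], ?_⟩
    simpa [Rule.clause, Atom.inst, Item.inst] using
      derives_clause (x := x) (.pathStep s.axis c k b d)
        [encLabel l, encLStep s, encBits v, encBits y]
        (by simp [hl, hv, hy]; omega)
        (by simpa [Rule.clause, Atom.inst, Item.inst] using h)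
  | .seq p q, hp, k, v, hv => by
    have hs := p.size_le
    have ht := q.size_le
    simp only [encLPath, List.length_cons, List.length_append, LPath.size] at hp hv ⊢
    obtain ⟨v, v', rfl, hv, hv'⟩ := exists_append_of_length_eq hv
    obtain ⟨y', e', hy', h'⟩ := derivable_path hl q (by omega) k v' hv'
    obtain ⟨y, e, hy, h⟩ := derivable_path hl p (by omega) e' v hv
    refine ⟨y ++ y', e, by simp [hy, hy'], ?_⟩
    simpa [Rule.clause, Atom.inst, Item.inst] using
      derives_clause (x := x) .pathSeq
        [encLabel l, encLPath p, encLPath q, [.bit k], encBits v, encBits v', encBits y,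
          encBits y', [.bit e], [.bit e']]
        (by simp [hl, hv, hy, hv', hy']; omega)
        (by simpa [Rule.clause, Atom.inst, Item.inst] using ⟨h', h⟩)
  | .union p q, hp, k, v, hv => by
    have hs := p.size_le
    have ht := q.size_le
    simp only [encLPath, List.length_cons, List.length_append, LPath.size] at hp hv ⊢
    obtain ⟨v, v', rfl, hv, hv'⟩ := exists_append_of_length_eq hv
    obtain ⟨y', e', hy', h'⟩ := derivable_path hl q (by omega) k v' hv'
    obtain ⟨y, e, hy, h⟩ := derivable_path hl p (by omega) k v hv
    refine ⟨y ++ y', e || e', by simp [hy, hy'], ?_⟩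
    simpa [Rule.clause, Atom.inst, Item.inst] using
      derives_clause (x := x) (.pathUnion e e')
        [encLabel l, encLPath p, encLPath q, [.bit k], encBits v, encBits v', encBits y,
          encBits y']
        (by simp [hl, hv, hy, hv', hy']; omega)
        (by simpa [Rule.clause, Atom.inst, Item.inst] using ⟨h, h'⟩)

theorem derivable_step {l : Label} (hl : (encLabel l).length ≤ (encInput x).length) :
    ∀ (s : LStep), (encLStep s).length ≤ (encInput x).length → ∀ (v : List Bool),
      v.length = s.size → ∃ y c, y.length = s.size ∧ Derivable x .step
        [encLabel l, encLStep s, [s.axis.tok], encBits v, encBits y, [.bit c]]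
  | .base a .wildcard, hp, v, hv => by
    obtain rfl : v = [] := List.length_eq_zero_iff.1 hv
    refine ⟨[], true, rfl, ?_⟩
    simpa [Rule.clause, Atom.inst, Item.inst, encLStep, encAxis_eq, encNodeTest, LStep.axis] using
      derives_clause (x := x) (.stepWildcard a) [encLabel l] (by simpa using hl)
        (by simpa [Rule.clause, Atom.inst, Item.inst] using derivable_label l hl)
  | .base a (.name m), hp, v, hv => by
    obtain rfl : v = [] := List.length_eq_zero_iff.1 hv
    refine ⟨[], decide (l = m), rfl, ?_⟩
    have hm : (encLabel m).length ≤ (encInput x).length := by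
      simp [encLStep, encNodeTest] at hp; omega
    simpa [Rule.clause, Atom.inst, Item.inst, encLStep, encAxis_eq, encNodeTest, LStep.axis] using
      derives_clause (x := x) (.stepName a) [encLabel l, encLabel m, [.bit (decide (l = m))]]
        (by simp [hl, hm]; simp [encLabel] at hl; omega)
        (by simpa [Rule.clause, Atom.inst, Item.inst] using derivable_labelEq l m hl hm)
  | .filter s e, hp, v, hv => by
    have hs := s.size_le
    have ht := e.size_le
    simp only [encLStep, List.length_cons, List.length_append, LStep.size] at hp hv ⊢
    obtain ⟨v, v', rfl, hv, hv'⟩ := exists_append_of_length_eq hv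
    obtain ⟨y', c', hy', h'⟩ := derivable_filter hl e (by omega) v' hv'
    obtain ⟨y, c, hy, h⟩ := derivable_step hl s (by omega) v hv
    refine ⟨y ++ y', c && c', by simp [hy, hy'], ?_⟩
    simpa [Rule.clause, Atom.inst, Item.inst, LStep.axis] using
      derives_clause (x := x) (.stepFilter c c')
        [encLabel l, encLStep s, encFExpr e, [s.axis.tok], encBits v, encBits v', encBits y,
          encBits y']
        (by simp [hl, hv, hy, hv', hy']; omega)
        (by simpa [Rule.clause, Atom.inst, Item.inst] using ⟨h, h'⟩)

theorem derivable_filter {l : Label} (hl : (encLabel l).length ≤ (encInput x).length) :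
    ∀ (e : FExpr), (encFExpr e).length ≤ (encInput x).length → ∀ (v : List Bool),
      v.length = e.size → ∃ y c, y.length = e.size ∧ Derivable x .filter
        [encLabel l, encFExpr e, encBits v, encBits y, [.bit c]]
  | .path p, hp, v, hv => by
    have hs := p.size_le
    simp only [encFExpr, List.length_cons, FExpr.size] at hp hv ⊢
    obtain ⟨y, c, hy, h⟩ := derivable_path hl p (by omega) true v hv
    refine ⟨y, c, hy, ?_⟩
    simpa [Rule.clause, Atom.inst, Item.inst] using
      derives_clause (x := x) .filterPath
        [encLabel l, encLPath p, encBits v, encBits y, [.bit c]]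
        (by simp [hl, hv, hy]; omega)
        (by simpa [Rule.clause, Atom.inst, Item.inst] using h)
  | .or p q, hp, v, hv => by
    have hs := p.size_le
    have ht := q.size_le
    simp only [encFExpr, List.length_cons, List.length_append, FExpr.size] at hp hv ⊢
    obtain ⟨v, v', rfl, hv, hv'⟩ := exists_append_of_length_eq hv
    obtain ⟨y', e', hy', h'⟩ := derivable_path hl q (by omega) true v' hv'
    obtain ⟨y, e, hy, h⟩ := derivable_path hl p (by omega) true v hv
    refine ⟨y ++ y', e || e', by simp [hy, hy'], ?_⟩
    simpa [Rule.clause, Atom.inst, Item.inst] using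
      derives_clause (x := x) (.filterOr e e')
        [encLabel l, encLPath p, encLPath q, encBits v, encBits v', encBits y, encBits y']
        (by simp [hl, hv, hy, hv', hy']; omega)
        (by simpa [Rule.clause, Atom.inst, Item.inst] using ⟨h, h'⟩)

end

theorem derivable_regex : ∀ (r : RegularExpression Label),
    (encRegex r).length ≤ (encInput x).length → Derivable x .regex [encRegex r]
  | .zero, h => by
    simpa [Rule.clause, Atom.inst, Item.inst, encRegex] using
      derives_clause (x := x) .regexZero [] (by simp) (by simp [Rule.clause])
  | .epsilon, h => by
    simpa [Rule.clause, Atom.inst, Item.inst, encRegex] using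
      derives_clause (x := x) .regexEpsilon [] (by simp) (by simp [Rule.clause])
  | .char l, h => by
    have h1 : (encLabel l).length ≤ (encInput x).length := by
      simp only [encRegex, List.length_cons] at h; omega
    simpa [Rule.clause, Atom.inst, Item.inst, encRegex] using
      derives_clause (x := x) .regexChar [encLabel l] (by simpa using h1)
        (by simpa [Rule.clause, Atom.inst, Item.inst] using derivable_label l h1)
  | .plus r s, h => by
    simp only [encRegex, List.length_cons, List.length_append] at h
    have h1 := derivable_regex r (by omega)
    have h2 := derivable_regex s (by omega)
    simpa [Rule.clause, Atom.inst, Item.inst, encRegex] using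
      derives_clause (x := x) .regexPlus [encRegex r, encRegex s] (by simp; omega)
        (by simpa [Rule.clause, Atom.inst, Item.inst] using ⟨h1, h2⟩)
  | .comp r s, h => by
    simp only [encRegex, List.length_cons, List.length_append] at h
    have h1 := derivable_regex r (by omega)
    have h2 := derivable_regex s (by omega)
    simpa [Rule.clause, Atom.inst, Item.inst, encRegex] using
      derives_clause (x := x) .regexComp [encRegex r, encRegex s] (by simp; omega)
        (by simpa [Rule.clause, Atom.inst, Item.inst] using ⟨h1, h2⟩)
  | .star r, h => by
    simp only [encRegex, List.length_cons] at h
    have h1 := derivable_regex r (by omega)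
    simpa [Rule.clause, Atom.inst, Item.inst, encRegex] using
      derives_clause (x := x) .regexStar [encRegex r] (by simpa using by omega)
        (by simpa [Rule.clause, Atom.inst, Item.inst] using h1)

theorem derivable_rules {m l : List (Label × RegularExpression Label)}
    (h : x.dtd.rules = m ++ l) :
    Derivable x .rules [encRules l ++ (encLPath x.p ++ encLPath x.q)] ∧
      (encRules l ++ (encLPath x.p ++ encLPath x.q)).length ≤ (encInput x).length := by
  induction m using List.reverseRecOn generalizing l with
  | nil =>
    rw [List.nil_append] at h
    rw [← h]
    have h1 : (encLabel x.dtd.start).length ≤ (encInput x).length := by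
      simp [encInput, encDTD]
    refine ⟨?_, by simp [encInput, encDTD]⟩
    have h2 : Derivable x .input
        [encLabel x.dtd.start ++ (encRules x.dtd.rules ++ (encLPath x.p ++ encLPath x.q))] := by
      rw [← List.append_assoc, ← List.append_assoc]
      exact .input
    simpa [Rule.clause, Atom.inst, Item.inst] using
      derives_clause (x := x) .rulesStart
        [encLabel x.dtd.start, encRules x.dtd.rules ++ (encLPath x.p ++ encLPath x.q)]
        (by simp [h1]; simp [encInput, encDTD])
        (by simpa [Rule.clause, Atom.inst, Item.inst] using ⟨h2, derivable_label _ h1⟩)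
  | append_singleton m e ih =>
    obtain ⟨h1, h2⟩ := ih (l := e :: l) (by simpa using h)
    simp only [encRules, List.cons_append, List.append_assoc, List.length_cons,
      List.length_append] at h1 h2 ⊢
    refine ⟨?_, by omega⟩
    simpa [Rule.clause, Atom.inst, Item.inst] using
      derives_clause (x := x) .rulesCons
        [encLabel e.1, encRegex e.2, encRules l ++ (encLPath x.p ++ encLPath x.q)]
        (by simp; omega)
        (by simpa [Rule.clause, Atom.inst, Item.inst] using
          ⟨h1, derivable_label _ (by omega), derivable_regex _ (by omega)⟩)

theorem derivable_rule {l r} (h : (l, r) ∈ x.dtd.rules) :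
    Derivable x .rule [encLabel l, encRegex r] ∧ (encLabel l).length ≤ (encInput x).length ∧
      (encRegex r).length ≤ (encInput x).length := by
  obtain ⟨m, m', hm⟩ := List.append_of_mem h
  obtain ⟨h1, h2⟩ := derivable_rules hm
  simp only [encRules, List.cons_append, List.append_assoc, List.length_cons,
    List.length_append] at h1 h2 ⊢
  refine ⟨?_, by omega, by omega⟩
  simpa [Rule.clause, Atom.inst, Item.inst] using
    derives_clause (x := x) .ruleHead
      [encLabel l, encRegex r, encRules m' ++ (encLPath x.p ++ encLPath x.q)]
      (by simp; omega)
      (by simpa [Rule.clause, Atom.inst, Item.inst] using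
        ⟨h1, derivable_label _ (by omega), derivable_regex _ (by omega)⟩)

theorem derivable_start : Derivable x .start [encLabel x.dtd.start] := by
  have h1 : (encLabel x.dtd.start).length ≤ (encInput x).length := by
    simp [encInput, encDTD]
  have h2 : Derivable x .input
      [encLabel x.dtd.start ++ (encRules x.dtd.rules ++ (encLPath x.p ++ encLPath x.q))] := by
    rw [← List.append_assoc, ← List.append_assoc]
    exact .input
  simpa [Rule.clause, Atom.inst, Item.inst] using
    derives_clause (x := x) .startLabel
      [encLabel x.dtd.start, encRules x.dtd.rules ++ (encLPath x.p ++ encLPath x.q)]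
      (by simp [h1]; simp [encInput, encDTD])
      (by simpa [Rule.clause, Atom.inst, Item.inst] using ⟨h2, derivable_label _ h1⟩)

theorem derivable_endRules :
    Derivable x .rules [Tok.endRules :: (encLPath x.p ++ encLPath x.q)] := by
  simpa [encRules] using (derivable_rules (x := x) (List.append_nil _).symm).1

theorem Derivable.pathSpec {l p k v y e} (h : Derivable x .path
    [encLabel l, encLPath p, [.bit k], encBits v, encBits y, [.bit e]]) :
    PathSpec l p k v y e := by
  obtain ⟨l', p', k', v', y', e', h1, h2⟩ := h.valid
  simp only [List.cons.injEq, and_true, Tok.bit.injEq] at h2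
  obtain ⟨hl, hp, rfl, hv, hy, rfl⟩ := h2
  obtain rfl := encLabel_injective hl
  obtain rfl := encLPath_injective hp
  obtain rfl := encBits_injective hv
  obtain rfl := encBits_injective hy
  exact h1

theorem derivable_path_vec {t : XTree} (ht : (encLabel t.label).length ≤ (encInput x).length)
    (p : LPath) (hp : (encLPath p).length ≤ (encInput x).length) :
    ∃ e, (p.Models t ↔ e = true) ∧ Derivable x .path
      [encLabel t.label, encLPath p, [.bit true],
        encBits (orMap p.size (p.vec fun _ => True) t.children),
        encBits (p.vec (fun _ => True) t), [.bit e]] := by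
  obtain ⟨y, e, -, h⟩ := derivable_path ht p hp true _ (length_orMap (p.length_vec _) t.children)
  obtain ⟨h1, h2⟩ := h.pathSpec.2 (fun _ => True) t rfl (by simp) rfl
  rw [LPath.sat_true] at h2
  rw [h1]
  exact ⟨e, h2, h⟩

theorem encLPath_length_le :
    (encLPath x.p).length ≤ (encInput x).length ∧ (encLPath x.q).length ≤ (encInput x).length ∧
      x.size ≤ (encInput x).length := by
  have h1 := x.p.size_le
  have h2 := x.q.size_le
  simp only [encInput, Input.size, List.length_append]
  omega

theorem derivable_type_char {t : XTree} {r} (hr : (t.label, r) ∈ x.dtd.rules)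
    (h : Derivable x .type [encRegex r, encBits (orMap x.size x.vec t.children)]) :
    Derivable x .type [encRegex (.char t.label), encBits (x.vec t)] := by
  obtain ⟨h1, h2, h3⟩ := derivable_rule hr
  obtain ⟨hp, hq, hs⟩ := encLPath_length_le (x := x)
  obtain ⟨e₁, -, h4⟩ := derivable_path_vec h2 x.p hp
  obtain ⟨e₂, -, h5⟩ := derivable_path_vec h2 x.q hq
  rw [x.orMap_vec, encBits, List.map_append] at h
  rw [Input.size] at hs
  simpa [Rule.clause, Atom.inst, Item.inst, encRegex, Input.vec] using
    derives_clause (x := x) .typeChar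
      [encLabel t.label, encRegex r, encBits (orMap x.p.size (x.p.vec fun _ => True) t.children),
        encBits (orMap x.q.size (x.q.vec fun _ => True) t.children), encLPath x.p, encLPath x.q,
        [.bit e₁], encBits (x.p.vec (fun _ => True) t), encBits (x.q.vec (fun _ => True) t),
        [.bit e₂]]
      (by
        simp [length_orMap (x.p.length_vec _), length_orMap (x.q.length_vec _), LPath.length_vec,
          h2, h3, hp, hq]
        simp [encLabel] at h2
        omega)
      (by simpa [Rule.clause, Atom.inst, Item.inst] using ⟨h1, h, derivable_endRules, h4, h5⟩)

theorem derivable_type_of_mem (r : RegularExpression Label)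
    (hr : (encRegex r).length ≤ (encInput x).length) (ts : List XTree)
    (hts : ∀ t ∈ ts, Derivable x .type [encRegex (.char t.label), encBits (x.vec t)])
    (h : ts.map XTree.label ∈ r.matches') :
    Derivable x .type [encRegex r, encBits (orMap x.size x.vec ts)] := by
  have hs := (encLPath_length_le (x := x)).2.2
  have hl : ∀ ts, (orMap x.size x.vec ts).length = x.size := length_orMap x.length_vec
  induction r generalizing ts with
  | zero => exact absurd h (Set.notMem_empty _)
  | epsilon =>
    obtain rfl : ts = [] := by simpa [RegularExpression.matches'] using h
    simpa [Rule.clause, Atom.inst, Item.inst, encRegex, orMap] using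
      derives_clause (x := x) .typeEpsilon [encBits (orMap x.size x.vec [])]
        (by simp [hl, hs])
        (by simpa [Rule.clause, Atom.inst, Item.inst, orMap] using derivable_zeros x.size hs)
  | char a =>
    have h1 : ts.map XTree.label = [a] := h
    obtain ⟨t, rfl, rfl⟩ := List.map_eq_singleton_iff.1 h1
    rw [orMap_singleton x.length_vec]
    exact hts t (by simp)
  | plus r s ihr ihs =>
    simp only [encRegex, List.length_cons, List.length_append] at hr
    rcases h with h | h
    · have h1 := ihr (by omega) ts hts h
      simpa [Rule.clause, Atom.inst, Item.inst, encRegex] using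
        derives_clause (x := x) .typePlusLeft
          [encRegex r, encRegex s, encBits (orMap x.size x.vec ts)]
          (by simp [hl]; omega)
          (by simpa [Rule.clause, Atom.inst, Item.inst] using
            ⟨h1, derivable_regex s (by omega)⟩)
    · have h1 := ihs (by omega) ts hts h
      simpa [Rule.clause, Atom.inst, Item.inst, encRegex] using
        derives_clause (x := x) .typePlusRight
          [encRegex r, encRegex s, encBits (orMap x.size x.vec ts)]
          (by simp [hl]; omega)
          (by simpa [Rule.clause, Atom.inst, Item.inst] using
            ⟨derivable_regex r (by omega), h1⟩)
  | comp r s ihr ihs =>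
    simp only [encRegex, List.length_cons, List.length_append] at hr
    obtain ⟨a, ha, b, hb, hab⟩ := Language.mem_mul.1 h
    obtain ⟨ts₁, ts₂, rfl, rfl, rfl⟩ := List.map_eq_append_iff.1 hab.symm
    have h1 := ihr (by omega) ts₁ (fun t ht => hts t (by simp [ht])) ha
    have h2 := ihs (by omega) ts₂ (fun t ht => hts t (by simp [ht])) hb
    have h3 := derivable_disj (x := x) (orMap x.size x.vec ts₁) (orMap x.size x.vec ts₂)
      (by simp [hl]) (by simp [hl, hs])
    rw [← orMap_list_append x.length_vec] at h3
    simpa [Rule.clause, Atom.inst, Item.inst, encRegex] using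
      derives_clause (x := x) .typeComp
        [encRegex r, encRegex s, encBits (orMap x.size x.vec ts₁),
          encBits (orMap x.size x.vec ts₂), encBits (orMap x.size x.vec (ts₁ ++ ts₂))]
        (by simp [hl]; omega)
        (by simpa [Rule.clause, Atom.inst, Item.inst] using ⟨h1, h2, h3⟩)
  | star r ihr =>
    simp only [encRegex, List.length_cons] at hr
    obtain ⟨L, hL, hm⟩ := Language.mem_kstar.1 h
    clear h
    induction L generalizing ts with
    | nil =>
      obtain rfl : ts = [] := by simpa using hL
      simpa [Rule.clause, Atom.inst, Item.inst, encRegex, orMap] using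
        derives_clause (x := x) .typeStarNil [encRegex r, encBits (orMap x.size x.vec [])]
          (by simp [hl]; omega)
          (by simpa [Rule.clause, Atom.inst, Item.inst, orMap] using
            ⟨derivable_regex r (by omega), by simpa using derivable_zeros (x := x) x.size hs⟩)
    | cons a L ih =>
      rw [List.flatten_cons] at hL
      obtain ⟨ts₁, ts₂, rfl, ha, hb⟩ := List.map_eq_append_iff.1 hL
      have h1 := ihr (by omega) ts₁ (fun t ht => hts t (by simp [ht])) (ha ▸ hm a (by simp))
      have h2 := ih ts₂ (fun t ht => hts t (by simp [ht])) hb fun y hy => hm y (by simp [hy])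
      have h3 := derivable_disj (x := x) (orMap x.size x.vec ts₁) (orMap x.size x.vec ts₂)
        (by simp [hl]) (by simp [hl, hs])
      rw [← orMap_list_append x.length_vec] at h3
      rw [encRegex] at h2
      simpa [Rule.clause, Atom.inst, Item.inst, encRegex] using
        derives_clause (x := x) .typeStarCons
          [encRegex r, encBits (orMap x.size x.vec ts₁),
            encBits (orMap x.size x.vec ts₂), encBits (orMap x.size x.vec (ts₁ ++ ts₂))]
          (by simp [hl]; omega)
          (by simpa [Rule.clause, Atom.inst, Item.inst] using ⟨h1, h2, h3⟩)

theorem derivable_type_of_conforms (t : XTree) (ht : x.dtd.Conforms t) :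
    ∃ r, (t.label, r) ∈ x.dtd.rules ∧
      Derivable x .type [encRegex r, encBits (orMap x.size x.vec t.children)] := by
  induction t using XTree.induction_children with
  | h t ih =>
    obtain ⟨⟨r, hr, h⟩, hc⟩ := DTD.conforms_iff.1 ht
    refine ⟨r, hr, derivable_type_of_mem r (derivable_rule hr).2.2 _ (fun c h1 => ?_) h⟩
    obtain ⟨s, hs, h2⟩ := ih c h1 (hc c h1)
    exact derivable_type_char hs h2

theorem derivable_refuted (h : ¬ ContainedRel x.dtd x.p x.q) : Derivable x .refuted [] := by
  simp only [ContainedRel, not_forall] at h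
  obtain ⟨t, ⟨hs, ht⟩, hp, hq⟩ := h
  obtain ⟨r, hr, h⟩ := derivable_type_of_conforms t ht
  obtain ⟨h1, h2, h3⟩ := derivable_rule hr
  obtain ⟨hp', hq', hn⟩ := encLPath_length_le (x := x)
  obtain ⟨e₁, he₁, h4⟩ := derivable_path_vec h2 x.p hp'
  obtain ⟨e₂, he₂, h5⟩ := derivable_path_vec h2 x.q hq'
  obtain rfl := he₁.1 hp
  obtain rfl : e₂ = false := by simpa [hq] using he₂
  rw [x.orMap_vec, encBits, List.map_append] at h
  rw [Input.size] at hn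
  have h0 := derivable_start (x := x)
  rw [← hs] at h0
  simpa [Rule.clause, Atom.inst, Item.inst] using
    derives_clause (x := x) .refute
      [encLabel t.label, encRegex r, encBits (orMap x.p.size (x.p.vec fun _ => True) t.children),
        encBits (orMap x.q.size (x.q.vec fun _ => True) t.children), encLPath x.p, encLPath x.q,
        [], encBits (x.p.vec (fun _ => True) t), encBits (x.q.vec (fun _ => True) t)]
      (by
        simp [length_orMap (x.p.length_vec _), length_orMap (x.q.length_vec _), LPath.length_vec,
          h2, h3, hp', hq']
        omega)
      (by simpa [Rule.clause, Atom.inst, Item.inst] using ⟨h0, h1, h, derivable_endRules, h4, h5⟩)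

end Complete

end XPath

theorem theorem4p4 : XPath.InEXPTIME XPath.inputEncoding XPath.XDContainment := by
  have : Nonempty XPath.Tok := ⟨.rule⟩
  exact Saturation.inEXPTIME _ _ XPath.clauses .input .refuted 10 XPath.clauses_varsBelow
    (fun x hx => ⟨{F | XPath.Valid x F}, XPath.closed_valid x, rfl, fun h => h hx⟩)
    fun _ hx => XPath.derivable_refuted hx
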